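/- **Definitions.** Rows are numbered from the top, columns from the left, and a cell is a pair (row, column). *ASM and bumpless pipe dreams.* A bumpless pipe dream (BPD) of size $n$ is a tiling of the $n\times n$ grid by six tiles (crossing, horizontal, vertical, the $r$-tile joining the south and east sides, the $j$-tile joining the west and north sides, blank) forming $n$ pipes from the south border to the east border. It corresponds to the $n\times n$ alternating sign matrix (ASM) with $1$ at the $r$-tiles, $-1$ at the $j$-tiles and $0$ elsewhere. Its permutation is read off from top to bottom on the east border, the pipes being labelled $1,\dots,n$ from left to right on the south border, and repeated crossings of two pipes being ignored (Demazure product). $\mathrm{ASM}(\pi)$ is the set of ASM whose BPD has permutation $\pi$. The Rothe BPD of $\pi$ is the BPD of the permutation matrix of $\pi$ (with $1$ at the cells $(i,\pi(i))$); its blank cells form the Rothe diagram $\{(i,j):\pi(i)>j,\ \pi^{-1}(j)>i\}$. A simple droop takes a $2\times2$ square with an $r$-tile in the NW and a blank in the SE corner and pushes the pipe through the NW corner into the SE corner, so that the NW corner becomes blank and the SE corner a $j$-tile; the pipe may enter the SW tile from the south or the west and leave the NE tile to the east or the north. $\mathrm{droop}(\pi)$ is the poset of the BPD obtained from the Rothe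 BPD of $\pi$ by simple droops, which go up in the order. *TSSCPP and pipe dreams.* A pipe dream of size $n$ is a filling of the $n\times n$ grid with cross-tiles and elbow-tiles, with crosses only at cells $(i,j)$ with $i+j\le n$; it is reduced if no two pipes cross twice, and its permutation is read off from top to bottom on the west border, the pipes being labelled $1,\dots,n$ from left to right on the north border. A simple slide takes a $2\times 2$ square whose only cross is in the SW corner and moves that cross to the NE corner. $\mathrm{slide}(\pi)$ is the poset of the pipe dreams obtained by simple slides, which go up in the order, from the bottom pipe dream of $\pi$, the reduced pipe dream of $\pi$ with all crosses left-justified; $P^*$ is the dual of a poset $P$. A totally symmetric self-complementary plane partition $t$ in a $2n\times2n\times2n$ box (TSSCPP) has a pipe dream: with $c_{k,e}=\#\{r\ge1: r+e\le n,\ t_{n+r,n+r+e}\ge k\}$, there is a cross at $(i,j)$, for $i,j\ge1$ and $i+j\le n$, if and only if $c_{k,i-1}=c_{k,i}$ for $k=n+1-i-j$. (So the boolean triangle $b_{n-i,i+j-1}=y_{i,j}$, where $y_{i,j}=1$ at the crosses and $0$ at the elbows, records the west steps ($1$) and south steps ($0$) of the non-intersecting lattice paths in the fundamental domain of $t$.)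 $\mathrm{TSSCPP}^{red}(\pi)$ is the set of TSSCPP whose pipe dream is reduced and has permutation $\pi$. *Block decomposition.* A permutation is Grassmannian if it has at most one descent, and inverse-Grassmannian if its inverse is Grassmannian. The dominant region $\mathrm{dom}(\pi)$ is the edge-connected region of the Rothe diagram of $\pi$ that contains $(1,1)$ (possibly empty). The essential boxes are the cells $(i,j)$ of the Rothe diagram such that $(i+1,j)$ and $(i,j+1)$ are not in it. The blocks of $\pi$ are the classes of the essential boxes outside $\mathrm{dom}(\pi)$ under the equivalence relation generated by lying in the same row or in the same column. A block is Grassmannian if its essential boxes lie in one row, and inverse-Grassmannian if they lie in one column; a block with a single essential box may be given either kind. Let $R$ be the largest row and $J$ the largest column of an essential box of a block $b$. If $b$ is Grassmannian, let $c_b$ be the least $c$ with $(R,c)\notin\mathrm{dom}(\pi)$ and $r_b$ the least $r$ with $(r,c_b)\notin\mathrm{dom}(\pi)$; if $b$ is inverse-Grassmannian, let $r_b$ be the least $r$ with $(r,J)\notin\mathrm{dom}(\pi)$ and $c_b$ the least $c$ with $(r_b,c)\notin\mathrm{dom}(\pi)$. The rectangle of $b$ consists of the rows $r_b,\dots,R$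 and the columns $c_b,\dots,J$. The permutation of $b$ is the permutation, Grassmannian or inverse-Grassmannian according to the kind of $b$, whose Rothe diagram is the part of the Rothe diagram of $\pi$ in this rectangle, translated so that $(r_b,c_b)$ moves to $(1,1)$. It lies in $S_{h+l}$, where for a Grassmannian block $h=R-r_b+1$ and $l$ is the number of cells $(R,j)$, $j\ge c_b$, of the Rothe diagram of $\pi$, and for an inverse-Grassmannian block $h=J-c_b+1$ and $l$ is the number of cells $(i,J)$, $i\ge r_b$, of it. **Statement.** Suppose $\pi\in S_n$ avoids both $2143$ and $1432$. Then the essential boxes of every block lie in one row or in one column. For every admissible choice of kinds, the permutation of each block exists, the rectangles of the blocks are pairwise disjoint and disjoint from $\mathrm{dom}(\pi)$, and together with $\mathrm{dom}(\pi)$ they cover the Rothe diagram. Let $\sigma_1,\dots,\sigma_k$ be the permutations of the inverse-Grassmannian blocks and $\tau_1,\dots,\tau_\ell$ those of the Grassmannian blocks. The correspondence between ASM and BPD restricts to a bijection between $\mathrm{ASM}(\pi)$ and $\mathrm{droop}(\pi)$, and there are a poset isomorphism $$\Phi:\ \mathrm{droop}(\pi)\ \cong\ \mathrm{slide}(\sigma_1)\times\cdots\times\mathrm{slide}(\sigma_k)\times\mathrm{slide}(\tau_1)^*\times\cdots\times\mathrm{slide}(\tau_\ell)^*$$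 and a bijection $\psi:\mathrm{ASM}(\pi)\to\mathrm{TSSCPP}^{red}(\pi)$, given explicitly as follows. For $D\in\mathrm{droop}(\pi)$, the component of $\Phi(D)$ at a block $b$ is the pipe dream whose crosses are the mirror images of the blank cells $(i,j)$ of $D$ in the rectangle of $b$: the cells $(i-r_b+1,\ J-j+1)$ if $b$ is inverse-Grassmannian, and the cells $(R-i+1,\ j-c_b+1)$ if $b$ is Grassmannian. For $A\in\mathrm{ASM}(\pi)$ with BPD $D$, the crosses of the pipe dream of $\psi(A)$ are the cells of $\mathrm{dom}(\pi)$ together with, for every block $b$, the crosses of the component of $\Phi(D)$ at $b$, translated so that $(1,1)$ moves to $(r_b,c_b)$. -/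

import Mathlib

namespace PipeDreams

open Relation

/-! ### Permutations

All rows, columns, labels and permutation values are numbered from `0`; a cell is a pair
`(row, column)`, rows being counted from the top and columns from the left. -/

/-- `π` avoids the pattern with one-line notation `p`. -/
def Avoids {n k : ℕ} (π : Equiv.Perm (Fin n)) (p : Fin k → ℕ) : Prop :=
  ¬ ∃ f : Fin k ↪o Fin n, ∀ a b, π (f a) < π (f b) ↔ p a < p b

/-- Grassmannian: at most one descent. -/
def IsGrassmannian {n : ℕ} (π : Equiv.Perm (Fin n)) : Prop :=
  {i : Fin n | ∃ i' : Fin n, i'.val = i.val + 1 ∧ π i' < π i}.Subsingleton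

/-- Inverse-Grassmannian: the inverse is Grassmannian. -/
def IsInvGrassmannian {n : ℕ} (π : Equiv.Perm (Fin n)) : Prop :=
  IsGrassmannian π⁻¹

/-! ### Alternating sign matrices -/

structure IsASM {n : ℕ} (A : Matrix (Fin n) (Fin n) ℤ) : Prop where
  entries : ∀ i j, A i j = 0 ∨ A i j = 1 ∨ A i j = -1
  row_sum : ∀ i, ∑ j, A i j = 1
  col_sum : ∀ j, ∑ i, A i j = 1
  row_alternate : ∀ i j j', j < j' → A i j ≠ 0 → A i j' ≠ 0 →
    (∀ k, j < k → k < j' → A i k = 0) → A i j' = - A i j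
  col_alternate : ∀ j i i', i < i' → A i j ≠ 0 → A i' j ≠ 0 →
    (∀ k, i < k → k < i' → A k j = 0) → A i' j = - A i j

/-! ### Bumpless pipe dreams -/

/-- The six tiles: a crossing, a horizontal pipe, a vertical pipe, the `r`-tile (a pipe joining the
south and the east side), the `j`-tile (a pipe joining the west and the north side), the blank. -/
inductive Tile where
  | cross | horiz | vert | rtile | jtile | blank
  deriving DecidableEq

/-- Which sides of a tile are met by a pipe. -/
def Tile.north : Tile → Bool
  | .cross | .vert | .jtile => true
  | _ => false

def Tile.south : Tile → Bool
  | .cross | .vert | .rtile => true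
  | _ => false

def Tile.west : Tile → Bool
  | .cross | .horiz | .jtile => true
  | _ => false

def Tile.east : Tile → Bool
  | .cross | .horiz | .rtile => true
  | _ => false

/-- Bumpless pipe dreams of size `n`: tilings of the `n × n` grid in which the pipes of neighbouring
tiles join up, a pipe enters through each of the `n` segments of the south border, a pipe leaves
through each of the `n` segments of the east border, and no pipe meets the other two borders. -/
structure BPD (n : ℕ) where
  tile : Fin n → Fin n → Tile
  vertical : ∀ i i' j : Fin n, i'.val = i.val + 1 → (tile i j).south = (tile i' j).north
  horizontal : ∀ i j j' : Fin n, j'.val = j.val + 1 → (tile i j).east = (tile i j').west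
  north_border : ∀ i j : Fin n, i.val = 0 → (tile i j).north = false
  west_border : ∀ i j : Fin n, j.val = 0 → (tile i j).west = false
  south_border : ∀ i j : Fin n, i.val + 1 = n → (tile i j).south = true
  east_border : ∀ i j : Fin n, j.val + 1 = n → (tile i j).east = true

namespace BPD

variable {n : ℕ}

/-- The matrix of a bumpless pipe dream: `1` at the `r`-tiles, `-1` at the `j`-tiles. -/
def toMatrix (D : BPD n) : Matrix (Fin n) (Fin n) ℤ :=
  fun i j => match D.tile i j with
    | .rtile => 1
    | .jtile => -1
    | _ => 0

/-- The cells holding a blank tile, as elements of `Fin n × Fin n`. -/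
def blankCells (D : BPD n) : Finset (Fin n × Fin n) :=
  Finset.univ.filter fun c => D.tile c.1 c.2 = Tile.blank

/-- The cells holding a blank tile. -/
def blanks (D : BPD n) : Set (ℕ × ℕ) :=
  {c | ∃ i j : Fin n, c = (i.val, j.val) ∧ D.tile i j = Tile.blank}

def tileAt (D : BPD n) (i j : ℕ) : Tile :=
  if h : i < n ∧ j < n then D.tile ⟨i, h.1⟩ ⟨j, h.2⟩ else Tile.blank

/-- Label of the pipe leaving a tile through its north side, if the pipes entering it from the west
and from the south have labels `w` and `s`. At a crossing tile with `w < s` the two pipes have not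
crossed before, and they cross. If `w > s` they have crossed before, and the repeated crossing is
ignored (the pipes bounce off each other); this computes the Demazure product. For a reduced
bumpless pipe dream the second case does not occur. The value `0` stands for the absence of a pipe
and is never used. -/
def northLabel : Tile → ℕ → ℕ → ℕ
  | .cross, w, s => max w s
  | .vert, _, s => s
  | .jtile, w, _ => w
  | _, _, _ => 0

/-- Label of the pipe leaving a tile through its east side; see `northLabel`. -/
def eastLabel : Tile → ℕ → ℕ → ℕ
  | .cross, w, s => min w s
  | .horiz, w, _ => w
  | .rtile, _, s => s
  | _, _, _ => 0

/-- Label on the west side of the cell `(i, j)`, given the labels `s` on the south sides of the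
cells of row `i`. -/
def westOf (D : BPD n) (s : ℕ → ℕ) (i : ℕ) : ℕ → ℕ
  | 0 => 0
  | j + 1 => eastLabel (D.tileAt i j) (westOf D s i j) (s j)

/-- Labels on the south sides of the cells of the `r`-th row from the bottom; on the south border
the pipes are labelled from left to right. -/
def southOf (D : BPD n) : ℕ → ℕ → ℕ
  | 0 => fun j => j
  | r + 1 => fun j =>
      northLabel (D.tileAt (n - 1 - r) j) (westOf D (southOf D r) (n - 1 - r) j) (southOf D r j)

/-- The label of the pipe that leaves the grid at the east end of row `i`. -/
def exitLabel (D : BPD n) (i : ℕ) : ℕ :=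
  westOf D (southOf D (n - 1 - i)) i n

/-- `D` has permutation `π`: the pipe labels on the east border, from top to bottom, are
`π 0, π 1, …`. -/
def HasPerm (D : BPD n) (π : Equiv.Perm (Fin n)) : Prop :=
  ∀ i : Fin n, D.exitLabel i = (π i).val

/-- `D` is the Rothe bumpless pipe dream of `π`: its matrix is the permutation matrix of `π`. -/
def IsRothe (D : BPD n) (π : Equiv.Perm (Fin n)) : Prop :=
  D.toMatrix = fun i j => if π i = j then 1 else 0

/-- `D'` arises from `D` by a simple droop: in a `2 × 2` square with an `r`-tile in its NW corner and
a blank in its SE corner, the pipe through the NW corner is pushed into the SE corner. The pipe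
enters the SW tile from the south or from the west, and leaves the NE tile to the east or to the
north. -/
def SimpleDroop (D D' : BPD n) : Prop :=
  ∃ i i' j j' : Fin n, i'.val = i.val + 1 ∧ j'.val = j.val + 1 ∧
    D.tile i j = .rtile ∧ D'.tile i j = .blank ∧
    D.tile i' j' = .blank ∧ D'.tile i' j' = .jtile ∧
    ((D.tile i j' = .horiz ∧ D'.tile i j' = .rtile) ∨
      (D.tile i j' = .jtile ∧ D'.tile i j' = .vert)) ∧
    ((D.tile i' j = .vert ∧ D'.tile i' j = .rtile) ∨
      (D.tile i' j = .jtile ∧ D'.tile i' j = .horiz)) ∧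
    ∀ k l : Fin n, ¬ ((k = i ∨ k = i') ∧ (l = j ∨ l = j')) → D'.tile k l = D.tile k l

def rank (D : BPD n) : ℕ := ∑ c ∈ D.blankCells, (c.1.val + c.2.val)

theorem SimpleDroop.rank_lt {D D' : BPD n} (h : SimpleDroop D D') : D'.rank < D.rank := by
  obtain ⟨i, i', j, j', hi, hj, h1, h2, h3, h4, h5, h6, h7⟩ := h
  have hne : i ≠ i' := fun h => by simp [h] at hi
  have hne' : j ≠ j' := fun h => by simp [h] at hj
  have hmem : (i', j') ∈ D.blankCells := by simp [blankCells, h3]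
  have hB : D'.blankCells = insert (i, j) (D.blankCells.erase (i', j')) := by
    ext ⟨k, l⟩
    simp only [blankCells, Finset.mem_filter, Finset.mem_univ, true_and, Finset.mem_insert,
      Finset.mem_erase, Prod.mk.injEq, ne_eq]
    by_cases hk : (k = i ∨ k = i') ∧ (l = j ∨ l = j')
    · obtain ⟨rfl | rfl, rfl | rfl⟩ := hk
      · simp [h2]
      · rcases h5 with h5 | h5 <;> simp [h5, hne'.symm]
      · rcases h6 with h6 | h6 <;> simp [h6, hne.symm]
      · simp [h4, hne.symm]
    · rw [h7 k l hk]
      constructor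
      · intro h
        refine Or.inr ⟨?_, h⟩
        rintro ⟨rfl, rfl⟩
        exact hk ⟨Or.inr rfl, Or.inr rfl⟩
      · rintro (⟨rfl, rfl⟩ | h)
        · exact absurd ⟨Or.inl rfl, Or.inl rfl⟩ hk
        · exact h.2
  have hn : (i, j) ∉ D.blankCells.erase (i', j') := by
    simp [blankCells, h1]
  have := Finset.add_sum_erase D.blankCells (fun c : Fin n × Fin n => c.1.val + c.2.val) hmem
  unfold rank
  rw [hB, Finset.sum_insert hn]
  simp only at this ⊢
  omega

end BPD

/-- A relation each step of which lowers a rank generates an antisymmetric preorder. -/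
theorem antisymm_of_rank {α : Type*} {r : α → α → Prop} (f : α → ℕ)
    (h : ∀ {a b}, r a b → f b < f a) {a b : α}
    (hab : ReflTransGen r a b) (hba : ReflTransGen r b a) : a = b := by
  have key : ∀ {x y}, ReflTransGen r x y → x = y ∨ f y < f x := by
    intro x y hxy
    induction hxy with
    | refl => exact Or.inl rfl
    | tail _ h2 ih =>
      rcases ih with rfl | ih
      · exact Or.inr (h h2)
      · exact Or.inr ((h h2).trans ih)
  rcases key hab with h1 | h1
  · exact h1
  · rcases key hba with h2 | h2
    · exact h2.symm
    · omega

/-- `droop(π)`: the bumpless pipe dreams obtained from the Rothe bumpless pipe dream of `π` by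
simple droops. -/
def Droop {n : ℕ} (π : Equiv.Perm (Fin n)) : Type :=
  {D : BPD n // ∃ R : BPD n, R.IsRothe π ∧ ReflTransGen BPD.SimpleDroop R D}

/-- The order on `droop(π)`: simple droops go up. -/
instance {n : ℕ} (π : Equiv.Perm (Fin n)) : PartialOrder (Droop π) where
  le D D' := ReflTransGen BPD.SimpleDroop D.1 D'.1
  le_refl _ := ReflTransGen.refl
  le_trans _ _ _ := ReflTransGen.trans
  le_antisymm _ _ h h' := Subtype.ext (antisymm_of_rank BPD.rank BPD.SimpleDroop.rank_lt h h')

/-- `ASM(π)`: the alternating sign matrices whose bumpless pipe dream has permutation `π`. -/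
def ASMOf {n : ℕ} (π : Equiv.Perm (Fin n)) : Type :=
  {A : Matrix (Fin n) (Fin n) ℤ // IsASM A ∧ ∃ D : BPD n, D.toMatrix = A ∧ D.HasPerm π}

/-! ### Pipe dreams -/

/-- Pipe dreams of size `n`, given by the cells holding a cross-tile, all of which lie strictly above
the main antidiagonal; all other cells hold elbow-tiles. -/
structure PD (n : ℕ) where
  crosses : Finset (ℕ × ℕ)
  above : ∀ c ∈ crosses, c.1 + c.2 + 2 ≤ n

namespace PD

variable {n : ℕ}

/-- The first column `≥ j` that holds an elbow in row `i`. -/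
noncomputable def nextElbow (D : PD n) (i j : ℕ) : ℕ :=
  sInf {k | j ≤ k ∧ (i, k) ∉ D.crosses}

/-- The label of the pipe entering the cell `(i, j)` from the north. On the north border the pipes
are labelled from left to right. An elbow joins the north side to the west side and the east side to
the south side, a cross goes straight; so the pipe on the south side of an elbow has come from the
north side of the next elbow to the right in its row. -/
noncomputable def top (D : PD n) : ℕ → ℕ → ℕ
  | 0 => fun j => j
  | i + 1 => fun j =>
      if (i, j) ∈ D.crosses then top D i j else top D i (D.nextElbow i (j + 1))

/-- The label of the pipe entering the cell `(i, j)` from the east. -/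
noncomputable def right (D : PD n) (i j : ℕ) : ℕ := D.top i (D.nextElbow i (j + 1))

/-- The label of the pipe that leaves the grid at the west end of row `i`. -/
noncomputable def exitLabel (D : PD n) (i : ℕ) : ℕ := D.top i (D.nextElbow i 0)

/-- No two pipes cross twice. -/
def IsReduced (D : PD n) : Prop :=
  ∀ p ∈ D.crosses, ∀ q ∈ D.crosses,
    s(D.top p.1 p.2, D.right p.1 p.2) = s(D.top q.1 q.2, D.right q.1 q.2) → p = q

/-- The pipe labels on the west border, from top to bottom, are `π 0, π 1, …`. -/
def HasPerm (D : PD n) (π : Equiv.Perm (Fin n)) : Prop :=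
  ∀ i : Fin n, D.exitLabel i = (π i).val

/-- `D` is the bottom pipe dream of `π`: reduced, with permutation `π` and with all crosses
left-justified. -/
def IsBottom (D : PD n) (π : Equiv.Perm (Fin n)) : Prop :=
  D.IsReduced ∧ D.HasPerm π ∧ ∀ i j j', j' < j → (i, j) ∈ D.crosses → (i, j') ∈ D.crosses

/-- `D'` arises from `D` by a simple slide: in a `2 × 2` square whose only cross is in the SW corner,
that cross moves to the NE corner. -/
def SimpleSlide (D D' : PD n) : Prop :=
  ∃ i j : ℕ, (i + 1, j) ∈ D.crosses ∧ (i, j) ∉ D.crosses ∧ (i, j + 1) ∉ D.crosses ∧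
    (i + 1, j + 1) ∉ D.crosses ∧
    D'.crosses = insert (i, j + 1) (D.crosses.erase (i + 1, j))

def rank (D : PD n) : ℕ := ∑ c ∈ D.crosses, c.1

theorem SimpleSlide.rank_lt {D D' : PD n} (h : SimpleSlide D D') : D'.rank < D.rank := by
  obtain ⟨i, j, h1, -, h3, -, h5⟩ := h
  have := Finset.add_sum_erase D.crosses (fun c : ℕ × ℕ => c.1) h1
  unfold rank
  rw [h5, Finset.sum_insert (by simp [h3])]
  simp only at this ⊢
  omega

end PD

/-- `slide(π)`: the pipe dreams obtained from the bottom pipe dream of `π` by simple slides. -/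
def Slide {n : ℕ} (π : Equiv.Perm (Fin n)) : Type :=
  {D : PD n // ∃ B : PD n, B.IsBottom π ∧ ReflTransGen PD.SimpleSlide B D}

/-- The order on `slide(π)`: simple slides go up. -/
instance {n : ℕ} (π : Equiv.Perm (Fin n)) : PartialOrder (Slide π) where
  le D D' := ReflTransGen PD.SimpleSlide D.1 D'.1
  le_refl _ := ReflTransGen.refl
  le_trans _ _ _ := ReflTransGen.trans
  le_antisymm _ _ h h' := Subtype.ext (antisymm_of_rank PD.rank PD.SimpleSlide.rank_lt h h')

/-! ### Totally symmetric self-complementary plane partitions -/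

/-- Totally symmetric self-complementary plane partitions in a `2n × 2n × 2n` box. The lattice point
`(i, j, k)` (coordinates from `0`) belongs to the plane partition if `k < t i j`. -/
structure TSSCPP (n : ℕ) where
  t : Fin (2 * n) → Fin (2 * n) → ℕ
  le_box : ∀ i j, t i j ≤ 2 * n
  antitone : ∀ i i' j j', i ≤ i' → j ≤ j' → t i' j' ≤ t i j
  symmetric : ∀ i j, t i j = t j i
  cyclic : ∀ i j k : Fin (2 * n), k.val < t i j → i.val < t j k
  self_compl : ∀ i j, t i j = 2 * n - t i.rev j.rev

namespace TSSCPP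

variable {n : ℕ}

def entry (T : TSSCPP n) (i j : ℕ) : ℕ :=
  if h : i < 2 * n ∧ j < 2 * n then T.t ⟨i, h.1⟩ ⟨j, h.2⟩ else 0

/-- A TSSCPP is determined by its fundamental domain, the entries `t_{i,j}` with `n ≤ i ≤ j < 2n`
(indices from `0`). For `1 ≤ k ≤ n - 1` the entries `≥ k` in the fundamental domain form a shifted
Young diagram, at the boundary of which runs a lattice path that starts at the NE corner (above the
first row, to the right of the `(n - k)`-th column), makes `n - k` unit steps, each to the south or
to the west, and ends on the main diagonal. `diagCount T k e` is the number of cells of that Young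
diagram on the `e`-th diagonal; equivalently, it is the number of south steps that the path has made
when it reaches the line `column - row = e`, after `n - k - e` steps. -/
def diagCount (T : TSSCPP n) (k e : ℕ) : ℕ :=
  ((Finset.range n).filter fun r => k ≤ T.entry (n + r) (n + r + e)).card

/-- The boolean triangle `b_{i,j}`, `1 ≤ i ≤ n - 1`, `n - i ≤ j ≤ n - 1` of a TSSCPP. Its `j`-th
diagonal `b_{n-j,j}, …, b_{n-1,j}` records the `j` steps of the lattice path of level `k = n - j`, in
order from its fixed starting point: `1` for a step to the west and `0` for a step to the south. So
`b_{i,j}` records the step from the line `column - row = n - i` to the line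
`column - row = n - i - 1`. -/
def boolTriangle (T : TSSCPP n) (i j : ℕ) : ℕ :=
  if T.diagCount (n - j) (n - i - 1) = T.diagCount (n - j) (n - i) then 1 else 0

/-- The pipe dream of a TSSCPP: the boolean triangle is flipped vertically and justified to the left,
`y_{i,j} = b_{n-i,i+j-1}` for `i, j ≥ 1`, and every `1` becomes a cross. -/
def toPD (T : TSSCPP n) : PD n where
  crosses := (Finset.range n ×ˢ Finset.range n).filter fun c =>
    c.1 + c.2 + 2 ≤ n ∧ T.boolTriangle (n - (c.1 + 1)) ((c.1 + 1) + (c.2 + 1) - 1) = 1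
  above := by
    intro c hc
    exact (Finset.mem_filter.1 hc).2.1

end TSSCPP

/-- `TSSCPP^red(π)`: the TSSCPP whose pipe dream is reduced and has permutation `π`. -/
def TSSCPPRed {n : ℕ} (π : Equiv.Perm (Fin n)) : Type :=
  {T : TSSCPP n // T.toPD.IsReduced ∧ T.toPD.HasPerm π}

/-! ### The block decomposition -/

section Blocks

variable {n : ℕ} (π : Equiv.Perm (Fin n))

/-- The Rothe diagram: the cells of the blank tiles of the Rothe bumpless pipe dream. -/
def rotheDiagram : Set (ℕ × ℕ) :=
  {c | ∃ i j : Fin n, c = (i.val, j.val) ∧ j < π i ∧ i < π.symm j}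

/-- Two cells share an edge. -/
def Adjacent (c d : ℕ × ℕ) : Prop :=
  (c.1 = d.1 ∧ (c.2 = d.2 + 1 ∨ d.2 = c.2 + 1)) ∨
    (c.2 = d.2 ∧ (c.1 = d.1 + 1 ∨ d.1 = c.1 + 1))

/-- The dominant region: the connected region of the Rothe diagram that contains the NW corner cell
of the grid (empty if that cell is not in the diagram). -/
def dominant : Set (ℕ × ℕ) :=
  {c | (0, 0) ∈ rotheDiagram π ∧
    ReflTransGen (fun d e => Adjacent d e ∧ e ∈ rotheDiagram π) (0, 0) c}

/-- The essential boxes: the SE-most corners of the connected regions of the Rothe diagram. -/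
def essential : Set (ℕ × ℕ) :=
  {c | c ∈ rotheDiagram π ∧ (c.1 + 1, c.2) ∉ rotheDiagram π ∧ (c.1, c.2 + 1) ∉ rotheDiagram π}

/-- Two essential boxes outside the dominant region lie in the same row or in the same column. -/
def Aligned (e f : {c : ℕ × ℕ // c ∈ essential π ∧ c ∉ dominant π}) : Prop :=
  e.1.1 = f.1.1 ∨ e.1.2 = f.1.2

/-- The blocks of `π`: the classes of the essential boxes outside the dominant region under the
equivalence relation generated by lying in the same row or in the same column. -/
def Block : Type := Quot (Aligned π)

inductive Kind where
  | grass | invGrass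

variable {π}

/-- The essential boxes of a block. -/
def Block.boxes (b : Block π) : Set (ℕ × ℕ) :=
  {c | ∃ h : c ∈ essential π ∧ c ∉ dominant π, Quot.mk (Aligned π) ⟨c, h⟩ = b}

/-- The lowest row of an essential box of the block. -/
noncomputable def Block.row (b : Block π) : ℕ := sSup (Prod.fst '' b.boxes)

/-- The rightmost column of an essential box of the block. -/
noncomputable def Block.col (b : Block π) : ℕ := sSup (Prod.snd '' b.boxes)

/-- The NW corner of a block. If the essential boxes lie in the row `r` (Grassmannian block), it is
`(r', c)` with `c` minimal such that `(r, c)` is not dominant and then `r'` minimal such that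
`(r', c)` is not dominant; the transpose of this if the essential boxes lie in one column. -/
noncomputable def Block.corner (b : Block π) : Kind → ℕ × ℕ
  | .grass =>
      let c := sInf {c | (b.row, c) ∉ dominant π}
      (sInf {r | (r, c) ∉ dominant π}, c)
  | .invGrass =>
      let r := sInf {r | (r, b.col) ∉ dominant π}
      (r, sInf {c | (r, c) ∉ dominant π})

/-- The rectangle of a block, from its NW corner to its SE-most essential box. -/
noncomputable def Block.region (b : Block π) (k : Kind) : Set (ℕ × ℕ) :=
  Set.Icc (b.corner k) (b.row, b.col)

/-- The size of the permutation of a block. For a Grassmannian block this is `h + l`, where `h` is the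
height of the rectangle and `l` the total width of the regions of blank tiles whose essential boxes
lie in the block (the number of blank tiles in their common bottom row); transposed for an
inverse-Grassmannian block. -/
noncomputable def Block.size (b : Block π) : Kind → ℕ
  | .grass => (b.row + 1 - (b.corner .grass).1) +
      {j | (b.corner .grass).2 ≤ j ∧ (b.row, j) ∈ rotheDiagram π}.ncard
  | .invGrass => (b.col + 1 - (b.corner .invGrass).2) +
      {i | (b.corner .invGrass).1 ≤ i ∧ (i, b.col) ∈ rotheDiagram π}.ncard

/-- A way to call each block Grassmannian (its essential boxes lie in one row) or inverse-Grassmannian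
(its essential boxes lie in one column). For a block with a single essential box both are allowed. -/
def IsKindAssignment (κ : Block π → Kind) : Prop :=
  ∀ b, match κ b with
    | .grass => ∀ e ∈ b.boxes, ∀ f ∈ b.boxes, e.1 = f.1
    | .invGrass => ∀ e ∈ b.boxes, ∀ f ∈ b.boxes, e.2 = f.2

/-- `σ` is the permutation of the block `b` of kind `k`: it is Grassmannian or inverse-Grassmannian,
and its Rothe diagram is the part of the Rothe diagram of `π` in the rectangle of `b`, moved to the NW
corner of the grid. -/
def IsBlockPerm (b : Block π) (k : Kind) {m : ℕ} (σ : Equiv.Perm (Fin m)) : Prop :=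
  (match k with
    | .grass => IsGrassmannian σ
    | .invGrass => IsInvGrassmannian σ) ∧
  rotheDiagram σ = {c | b.corner k + c ∈ rotheDiagram π ∩ b.region k}

/-- The block decomposition of `π`, where `κ b` is the kind and `σ b` the permutation of the block
`b`. -/
structure IsBlockDecomposition (κ : Block π → Kind)
    (σ : ∀ b : Block π, Equiv.Perm (Fin (b.size (κ b)))) : Prop where
  kinds : IsKindAssignment κ
  perms : ∀ b : Block π, IsBlockPerm b (κ b) (σ b)
  disjoint : ∀ b b' : Block π, b ≠ b' → Disjoint (b.region (κ b)) (b'.region (κ b'))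
  disjoint_dominant : ∀ b : Block π, Disjoint (dominant π) (b.region (κ b))
  cover : rotheDiagram π ⊆ dominant π ∪ ⋃ b : Block π, b.region (κ b)

/-- The mirror image of the blank tiles of `D` in the rectangle of a block, in coordinates relative to
the NW corner of the block. The rectangle is reflected upside down for a Grassmannian block (so that
the bottom-aligned blanks of the Rothe bumpless pipe dream become the crosses of the top pipe dream)
and left to right for an inverse-Grassmannian one (so that they become the crosses of the bottom pipe
dream). -/
noncomputable def Block.mirror (b : Block π) (k : Kind) (D : BPD n) : Set (ℕ × ℕ) :=
  match k with
  | .grass => (fun c => (b.row - c.1, c.2 - (b.corner k).2)) '' (D.blanks ∩ b.region k)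
  | .invGrass => (fun c => (c.1 - (b.corner k).1, b.col - c.2)) '' (D.blanks ∩ b.region k)

end Blocks

end PipeDreams

open PipeDreams

/-!
# Bumpless pipe dreams, pipe dreams and plane partitions of permutations avoiding `2143` and `1432`

Permutations are extended to `ℕ` by fixed points (`extPerm`), so that rows and columns need no bounds.

*Blocks.* If `p` avoids `2143`, then from every cell of its diagram outside the dominant region one
sees an inner corner of the dominant region (`IsCorner`, `exists_isCorner`): a cell `(i, p i)` up to
which the dominant region reaches both in the row and in the column of the given cell. If `p` also
avoids `1432`, then two essential boxes with the same corner lie in the same row or column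
(`essBoxes_aligned`), while boxes in a common row or column have the same corner. So blocks correspond
to corners, the rectangle of a block consists of cells that see its corner, and the diagram is
justified in it to the bottom (Grassmannian blocks) or to the right (inverse-Grassmannian blocks). This
is collected in `IsBlockSystem`; a diagram justified to the bottom in a rectangle belongs to a
Grassmannian permutation (`exists_isGrassmannian_window`).

*Bumpless pipe dreams.* A crossing weakly NW of a blank or a `j`-tile would give an occurrence of
`2143` (`BPD.tame_of_avoids`). Therefore a `j`-tile without other `j`-tiles to its NW has been produced
by a simple droop, and every bumpless pipe dream of `π` arises from the Rothe bumpless pipe dream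
(`BPD.HasPerm.exists_isRothe`). Moreover the simple droops are exactly the possible diagonal moves of
the blanks, and the blanks determine the bumpless pipe dream (`Droop.le_iff`, `Droop.eq_of_blanks`).

*Pipe dreams.* If `p` avoids `1432`, then every reduced pipe dream of `p` that is not left-justified is
the result of a simple slide (`PD.IsReducedOf.exists_slideAt`). Therefore the slide poset consists of
all reduced pipe dreams; it has a least element, which is left-justified, and, by transposition, a
greatest one, which is top-justified.

*Gluing.* The blanks of an element of `droop(π)`, reflected in each block, form a family of reduced
pipe dreams of the permutations of the blocks, as this holds for the Rothe bumpless pipe dream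
(`glue_mirrorChart_eq_diagram`) and a diagonal move of a blank is a slide, or a reversed slide, in one
block. In the same way the reduced pipe dreams of `π` consist of the dominant region and translated
reduced pipe dreams of the blocks, as this holds for the left-justified one
(`glue_add_eq_bottomCells`). Both are instances of `IsGluing`, and in both cases all families occur
and are ordered componentwise (`IsGluing.reflTransGen_iff`).

*Plane partitions.* The pipe dream of a totally symmetric self-complementary plane partition
determines it (`TSSCPP.toPD_injective`). A pipe dream comes from such a plane partition if the lattice
paths read off from its antidiagonals do not intersect (`TSSCPP.exists_toPD_crosses_eq`). This holds
for left-justified pipe dreams and is preserved by simple slides, hence it holds for all reduced pipe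
dreams of a permutation avoiding `1432` (`PD.IsReducedOf.nonIntersecting`).
-/


namespace PipeDreams

open Relation

/-! ### Permutations of `ℕ` and their diagrams -/

/-- The extension of a permutation of `{0, …, n - 1}` to `ℕ` by fixed points. -/
def extPerm {n : ℕ} (π : Equiv.Perm (Fin n)) : Equiv.Perm ℕ :=
  π.extendDomain Fin.equivSubtype

section extPerm

variable {n : ℕ} (π : Equiv.Perm (Fin n))

lemma extPerm_coe (i : Fin n) : extPerm π i = π i :=
  Equiv.Perm.extendDomain_apply_image π Fin.equivSubtype i

lemma extPerm_of_lt {i : ℕ} (h : i < n) : extPerm π i = π ⟨i, h⟩ := extPerm_coe π ⟨i, h⟩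

lemma extPerm_of_le {i : ℕ} (h : n ≤ i) : extPerm π i = i :=
  Equiv.Perm.extendDomain_apply_not_subtype π Fin.equivSubtype (by simpa using h)

lemma extPerm_symm : (extPerm π).symm = extPerm π.symm := rfl

lemma extPerm_lt_iff {i : ℕ} : extPerm π i < n ↔ i < n := by
  by_cases h : i < n
  · rw [extPerm_of_lt π h]; simp [h]
  · rw [extPerm_of_le π (not_lt.1 h)]

lemma lt_of_extPerm_inversion {a b : ℕ} (hab : a < b) (h : extPerm π b < extPerm π a) :
    b < n := by
  by_contra hb
  rw [not_lt] at hb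
  rw [extPerm_of_le π hb] at h
  have : ¬ extPerm π a < n := by omega
  rw [extPerm_lt_iff, not_lt] at this
  rw [extPerm_of_le π this] at h
  omega

end extPerm

/-- The Rothe diagram of a permutation of `ℕ`. -/
def diagram (p : Equiv.Perm ℕ) : Set (ℕ × ℕ) := {c | c.2 < p c.1 ∧ c.1 < p.symm c.2}

lemma mem_diagram {p : Equiv.Perm ℕ} {i j : ℕ} :
    (i, j) ∈ diagram p ↔ j < p i ∧ i < p.symm j := Iff.rfl

lemma mem_diagram_symm {p : Equiv.Perm ℕ} {i j : ℕ} :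
    (i, j) ∈ diagram p.symm ↔ (j, i) ∈ diagram p := by
  simp [mem_diagram, and_comm]

lemma rotheDiagram_eq {n : ℕ} (π : Equiv.Perm (Fin n)) :
    rotheDiagram π = diagram (extPerm π) := by
  ext ⟨i, j⟩
  rw [mem_diagram]
  constructor
  · rintro ⟨i', j', h, h1, h2⟩
    obtain ⟨rfl, rfl⟩ := Prod.mk.inj h
    rw [extPerm_symm, extPerm_coe, extPerm_coe]
    exact ⟨h1, h2⟩
  · rintro ⟨h1, h2⟩
    have key : extPerm π (extPerm π |>.symm j) = j := by simp
    have hn := lt_of_extPerm_inversion π h2 (by simpa using h1)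
    have hj : j < n := by rw [← key, extPerm_lt_iff]; exact hn
    have hi : i < n := by omega
    rw [extPerm_of_lt π hi] at h1
    rw [extPerm_symm, extPerm_of_lt _ hj] at h2
    exact ⟨⟨i, hi⟩, ⟨j, hj⟩, rfl, h1, h2⟩

/-- Avoidance of the pattern `2143` for permutations of `ℕ`. -/
def Avoids2143 (p : Equiv.Perm ℕ) : Prop :=
  ∀ a b c d, a < b → b < c → c < d → p b < p a → p a < p d → p d < p c → False

/-- Avoidance of the pattern `1432` for permutations of `ℕ`. -/
def Avoids1432 (p : Equiv.Perm ℕ) : Prop :=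
  ∀ a b c d, a < b → b < c → c < d → p a < p d → p d < p c → p c < p b → False

lemma exists_orderEmb_four {n a b c d : ℕ} (hab : a < b) (hbc : b < c) (hcd : c < d)
    (hd : d < n) : ∃ f : Fin 4 ↪o Fin n,
      (f 0).val = a ∧ (f 1).val = b ∧ (f 2).val = c ∧ (f 3).val = d := by
  refine ⟨OrderEmbedding.ofStrictMono
    ![⟨a, by omega⟩, ⟨b, by omega⟩, ⟨c, by omega⟩, ⟨d, hd⟩] ?_, rfl, rfl, rfl, rfl⟩
  intro x y hxy
  fin_cases x <;> fin_cases y <;> simp_all [Fin.lt_def] <;> omega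

lemma Avoids.ext2143 {n : ℕ} {π : Equiv.Perm (Fin n)} (h : Avoids π ![2, 1, 4, 3]) :
    Avoids2143 (extPerm π) := by
  intro a b c d hab hbc hcd h1 h2 h3
  have hd := lt_of_extPerm_inversion π hcd h3
  obtain ⟨f, f0, f1, f2, f3⟩ := exists_orderEmb_four hab hbc hcd hd
  apply h
  refine ⟨f, ?_⟩
  rw [← f0, ← f1, extPerm_coe, extPerm_coe] at h1
  rw [← f0, ← f3, extPerm_coe, extPerm_coe] at h2
  rw [← f2, ← f3, extPerm_coe, extPerm_coe] at h3
  intro x y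
  rw [Fin.lt_def]
  fin_cases x <;> fin_cases y <;> simp <;> omega

lemma Avoids.ext1432 {n : ℕ} {π : Equiv.Perm (Fin n)} (h : Avoids π ![1, 4, 3, 2]) :
    Avoids1432 (extPerm π) := by
  intro a b c d hab hbc hcd h1 h2 h3
  have hd := lt_of_extPerm_inversion π hcd h2
  obtain ⟨f, f0, f1, f2, f3⟩ := exists_orderEmb_four hab hbc hcd hd
  apply h
  refine ⟨f, ?_⟩
  rw [← f0, ← f3, extPerm_coe, extPerm_coe] at h1
  rw [← f2, ← f3, extPerm_coe, extPerm_coe] at h2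
  rw [← f2, ← f1, extPerm_coe, extPerm_coe] at h3
  intro x y
  rw [Fin.lt_def]
  fin_cases x <;> fin_cases y <;> simp <;> omega

lemma Avoids1432.symm {p : Equiv.Perm ℕ} (h : Avoids1432 p) : Avoids1432 p.symm := by
  intro a b c d hab hbc hcd h1 h2 h3
  exact h (p.symm a) (p.symm d) (p.symm c) (p.symm b) h1 h2 h3 (by simpa using hab)
    (by simpa using hbc) (by simpa using hcd)

/-! ### Corners of the dominant region -/

/-- The dominant region of a permutation of `ℕ`: the cells that are not weakly SE of a cell
`(i, p i)`. -/
def domRegion (p : Equiv.Perm ℕ) : Set (ℕ × ℕ) := {c | ∀ i ≤ c.1, c.2 < p i}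

lemma mem_domRegion {p : Equiv.Perm ℕ} {i j : ℕ} :
    (i, j) ∈ domRegion p ↔ ∀ i' ≤ i, j < p i' := Iff.rfl

lemma mem_domRegion' {p : Equiv.Perm ℕ} {i j : ℕ} :
    (i, j) ∈ domRegion p ↔ ∀ j' ≤ j, i < p.symm j' := by
  rw [mem_domRegion]
  constructor
  · intro h j' hj'
    by_contra hc
    have := h _ (not_lt.1 hc)
    rw [Equiv.apply_symm_apply] at this
    omega
  · intro h i' hi'
    by_contra hc
    have := h _ (not_lt.1 hc)
    rw [Equiv.symm_apply_apply] at this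
    omega

lemma mem_domRegion_symm {p : Equiv.Perm ℕ} {i j : ℕ} :
    (i, j) ∈ domRegion p.symm ↔ (j, i) ∈ domRegion p := by
  rw [mem_domRegion', mem_domRegion]; rfl

lemma domRegion_mono {p : Equiv.Perm ℕ} {i j i' j' : ℕ} (h : (i, j) ∈ domRegion p)
    (hi : i' ≤ i) (hj : j' ≤ j) : (i', j') ∈ domRegion p := by
  intro k hk
  have := h k (le_trans hk hi)
  simp only at this ⊢
  omega

lemma domRegion_subset (p : Equiv.Perm ℕ) : domRegion p ⊆ diagram p := by
  rintro ⟨i, j⟩ h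
  exact ⟨h i le_rfl, mem_domRegion'.1 h j le_rfl⟩

lemma dominant_eq {n : ℕ} (π : Equiv.Perm (Fin n)) : dominant π = domRegion (extPerm π) := by
  set p := extPerm π
  have hr : rotheDiagram π = diagram p := rotheDiagram_eq π
  ext ⟨i, j⟩
  constructor
  · rintro ⟨h0, h⟩
    rw [hr] at h0 h
    have base : (0, 0) ∈ domRegion p := by
      intro k hk
      obtain rfl : k = 0 := by simpa using hk
      exact h0.1
    have step : ∀ d e : ℕ × ℕ, d ∈ domRegion p → Adjacent d e → e ∈ diagram p →
        e ∈ domRegion p := by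
      rintro ⟨a, b⟩ ⟨a', b'⟩ hd had he
      simp only [Adjacent] at had
      have hne : ∀ k ≤ a, k ≤ a' → b' = b + 1 → b' < p k := by
        rintro k hk hk' rfl
        have h1 : b < p k := hd k hk
        have h2 := he.2
        have : p k ≠ b + 1 := by
          intro h3
          rw [← h3, Equiv.symm_apply_apply] at h2
          simp only at h2
          omega
        omega
      intro k hk
      have hk : k ≤ a' := hk
      have hk1 : k = a' ∨ k ≤ a := by omega
      rcases hk1 with rfl | hk1
      · exact he.1
      · have h1 : b < p k := hd k hk1
        have h2 := hne k hk1 hk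
        show b' < p k
        by_cases hb : b' = b + 1
        · exact h2 hb
        · omega
    have : ∀ c, ReflTransGen (fun d e => Adjacent d e ∧ e ∈ diagram p) (0, 0) c →
        c ∈ domRegion p := by
      intro c hc
      induction hc with
      | refl => exact base
      | tail _ h2 ih => exact step _ _ ih h2.1 h2.2
    exact this _ h
  · intro h
    rw [dominant, hr]
    refine ⟨domRegion_subset p (domRegion_mono h (Nat.zero_le _) (Nat.zero_le _)), ?_⟩
    have h1 : ∀ a ≤ i, ReflTransGen (fun d e => Adjacent d e ∧ e ∈ diagram p) (0, 0) (a, 0) := by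
      intro a ha
      induction a with
      | zero => exact .refl
      | succ a ih =>
        refine (ih (by omega)).tail ⟨?_, domRegion_subset p (domRegion_mono h ha (Nat.zero_le _))⟩
        simp [Adjacent]
    have h2 : ∀ b ≤ j, ReflTransGen (fun d e => Adjacent d e ∧ e ∈ diagram p) (0, 0) (i, b) := by
      intro b hb
      induction b with
      | zero => exact h1 i le_rfl
      | succ b ih =>
        refine (ih (by omega)).tail ⟨?_, domRegion_subset p (domRegion_mono h le_rfl hb)⟩
        simp [Adjacent]
    exact h2 j le_rfl

/-- `k` is the inner corner of the dominant region that is seen from the cell `c`: the corner cell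
`(k.1, p k.1)` lies weakly NW of `c`, the dominant region reaches exactly up to it in the row and in
the column of `c`. -/
structure IsCorner (p : Equiv.Perm ℕ) (k c : ℕ × ℕ) : Prop where
  apply : p k.1 = k.2
  le : k ≤ c
  row : ∀ i ≤ c.1, k.2 ≤ p i
  col : ∀ j ≤ c.2, k.1 ≤ p.symm j

namespace IsCorner

variable {p : Equiv.Perm ℕ} {k k' c c' : ℕ × ℕ}

lemma symm_apply (h : IsCorner p k c) : p.symm k.2 = k.1 := by rw [← h.apply]; simp

lemma eq_of_fst (h : IsCorner p k c) (h' : IsCorner p k' c') (e : c.1 = c'.1) : k = k' := by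
  have h2 : k.2 = k'.2 := by
    apply le_antisymm
    · rw [← h'.apply]; exact h.row _ (e ▸ h'.le.1)
    · rw [← h.apply]; exact h'.row _ (e ▸ h.le.1)
  exact Prod.ext (by rw [← h.symm_apply, ← h'.symm_apply, h2]) h2

lemma eq_of_snd (h : IsCorner p k c) (h' : IsCorner p k' c') (e : c.2 = c'.2) : k = k' := by
  have h1 : k.1 = k'.1 := by
    apply le_antisymm
    · rw [← h'.symm_apply]; exact h.col _ (e ▸ h'.le.2)
    · rw [← h.symm_apply]; exact h'.col _ (e ▸ h.le.2)
  exact Prod.ext h1 (by rw [← h.apply, ← h'.apply, h1])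

lemma mono (h : IsCorner p k c) (h1 : k ≤ c') (h2 : c' ≤ c) : IsCorner p k c' :=
  ⟨h.apply, h1, fun i hi => h.row i (hi.trans h2.1), fun j hj => h.col j (hj.trans h2.2)⟩

lemma mk' {i j : ℕ} (h : IsCorner p k c) (h' : IsCorner p k c') (hi : i = c.1) (hj : j = c'.2) :
    IsCorner p k (i, j) := by
  subst hi hj
  exact ⟨h.apply, ⟨h.le.1, h'.le.2⟩, h.row, h'.col⟩

lemma swap (h : IsCorner p k c) : IsCorner p.symm k.swap c.swap :=
  ⟨h.symm_apply, ⟨h.le.2, h.le.1⟩, h.col, h.row⟩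

lemma not_mem_dom (h : IsCorner p k c) : c ∉ domRegion p := by
  intro hc
  have := hc k.1 h.le.1
  rw [h.apply] at this
  exact absurd h.le.2 (not_le.2 this)

lemma mem_dom_row (h : IsCorner p k c) {j : ℕ} : (c.1, j) ∈ domRegion p ↔ j < k.2 := by
  constructor
  · intro hj
    rw [← h.apply]
    exact hj _ h.le.1
  · intro hj i hi
    exact hj.trans_le (h.row i hi)

lemma mem_dom_col (h : IsCorner p k c) {i : ℕ} : (i, c.2) ∈ domRegion p ↔ i < k.1 := by
  have := h.swap.mem_dom_row (j := i)
  rwa [mem_domRegion_symm] at this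

end IsCorner

/-- Seen from a cell of the diagram outside the dominant region, the dominant region has a corner:
otherwise the pattern `2143` occurs. -/
lemma exists_isCorner {p : Equiv.Perm ℕ} (hp : Avoids2143 p) {c : ℕ × ℕ} (hc : c ∈ diagram p)
    (hd : c ∉ domRegion p) : ∃ k, IsCorner p k c := by
  obtain ⟨i, j⟩ := c
  obtain ⟨h1, h2⟩ := hc
  simp only at h1 h2
  obtain ⟨r, hr, hrmin⟩ := Finset.exists_min_image (Finset.range (i + 1)) p ⟨0, by simp⟩
  obtain ⟨s, hs, hsmin⟩ := Finset.exists_min_image (Finset.range (j + 1)) p.symm ⟨0, by simp⟩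
  have hr' : r ≤ i := by simpa [Nat.lt_succ_iff] using hr
  have hs' : s ≤ j := by simpa [Nat.lt_succ_iff] using hs
  have hrj : p r ≤ j := by
    by_contra hcon
    apply hd
    intro i' hi'
    have := hrmin i' (by simpa [Nat.lt_succ_iff] using hi')
    simp only
    omega
  have hsr : p.symm s ≤ r := by
    have := hsmin (p r) (by simpa [Nat.lt_succ_iff] using hrj)
    simpa using this
  have hrs : p r ≤ s := by
    have := hrmin (p.symm s) (by simp; omega)
    simpa using this
  have hri : r ≠ i := by rintro rfl; omega
  have hsj : s ≠ j := by rintro rfl; omega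
  have heq : p.symm s = r := by
    by_contra hne
    have hlt : p.symm s < r := lt_of_le_of_ne hsr hne
    have hps : p r ≠ s := by
      rintro h
      exact hne (by rw [← h]; simp)
    exact hp (p.symm s) r i (p.symm j) hlt (by omega) h2 (by simp; omega) (by simp; omega)
      (by simpa using h1)
  refine ⟨(r, p r), rfl, ⟨hr', hrj⟩, ?_, ?_⟩
  · intro i' hi'
    exact hrmin i' (by simpa [Nat.lt_succ_iff] using hi')
  · intro j' hj'
    simp only
    rw [← heq]
    exact hsmin j' (by simpa [Nat.lt_succ_iff] using hj')

/-! ### Essential boxes -/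

/-- The essential boxes of a permutation of `ℕ`. -/
def essBoxes (p : Equiv.Perm ℕ) : Set (ℕ × ℕ) :=
  {c | c ∈ diagram p ∧ (c.1 + 1, c.2) ∉ diagram p ∧ (c.1, c.2 + 1) ∉ diagram p}

lemma essential_eq {n : ℕ} (π : Equiv.Perm (Fin n)) : essential π = essBoxes (extPerm π) := by
  rw [essential, rotheDiagram_eq]; rfl

lemma mem_essBoxes_symm {p : Equiv.Perm ℕ} {i j : ℕ} :
    (i, j) ∈ essBoxes p.symm ↔ (j, i) ∈ essBoxes p := by
  simp only [essBoxes, Set.mem_ofPred_eq, mem_diagram_symm]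
  tauto

/-- The values at and next to an essential box. -/
lemma essBoxes_iff {p : Equiv.Perm ℕ} {i j : ℕ} : (i, j) ∈ essBoxes p ↔
    j < p i ∧ i < p.symm j ∧ p (i + 1) ≤ j ∧ p.symm (j + 1) ≤ i := by
  simp only [essBoxes, Set.mem_ofPred_eq, mem_diagram, not_and_or, not_lt]
  constructor
  · rintro ⟨⟨h1, h2⟩, h3, h4⟩
    refine ⟨h1, h2, ?_, ?_⟩
    · rcases h3 with h3 | h3
      · exact h3
      · have : p.symm j = i + 1 := by omega
        rw [← this]; simp
    · rcases h4 with h4 | h4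
      · have : p i = j + 1 := by omega
        rw [← this]; simp
      · exact h4
  · rintro ⟨h1, h2, h3, h4⟩
    exact ⟨⟨h1, h2⟩, Or.inl h3, Or.inr h4⟩

/-- At the right end of a run of cells of the diagram whose lower neighbours are not in the diagram
there is an essential box. -/
lemma exists_essBox_right {p : Equiv.Perm ℕ} {i j : ℕ} (h : (i, j) ∈ diagram p)
    (h' : (i + 1, j) ∉ diagram p) : ∃ j' ≥ j, (i, j') ∈ essBoxes p := by
  have hpi : p (i + 1) ≤ j := by
    rw [mem_diagram, not_and_or, not_lt, not_lt] at h'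
    rcases h' with h' | h'
    · exact h'
    · have : p.symm j = i + 1 := by have := h.2; simp only at this; omega
      rw [← this]; simp
  have hex : ∃ k, (i, j + k + 1) ∉ diagram p := by
    refine ⟨p i, fun h => ?_⟩
    have := h.1
    simp only at this
    omega
  classical
  obtain ⟨k, hk, hmin⟩ := Nat.findX hex
  have hk' : (i, j + k) ∈ diagram p := by
    rcases k with - | k
    · exact h
    · have := hmin k (by omega)
      rwa [not_not] at this
  refine ⟨j + k, by omega, hk', ?_, hk⟩
  intro hc
  have := hc.1
  simp only at this
  omega

lemma exists_diagram_bottom {p : Equiv.Perm ℕ} {i j : ℕ} (h : (i, j) ∈ diagram p) :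
    ∃ i' ≥ i, (i', j) ∈ diagram p ∧ (i' + 1, j) ∉ diagram p := by
  have hex : ∃ k, (i + k + 1, j) ∉ diagram p := by
    refine ⟨p.symm j, fun h => ?_⟩
    have := h.2
    simp only at this
    omega
  classical
  obtain ⟨k, hk, hmin⟩ := Nat.findX hex
  refine ⟨i + k, by omega, ?_, hk⟩
  rcases k with - | k
  · exact h
  · have := hmin k (by omega)
    rwa [not_not] at this

/-- From a cell of the diagram with corner `k` one can go down and then to the right inside the
diagram to an essential box with the same corner. -/
lemma exists_essBox_of_mem_diagram {p : Equiv.Perm ℕ} (hp : Avoids2143 p) {k c : ℕ × ℕ}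
    (hk : IsCorner p k c) (hc : c ∈ diagram p) :
    ∃ e ∈ essBoxes p, c ≤ e ∧ IsCorner p k e := by
  obtain ⟨i, j⟩ := c
  obtain ⟨i', hi', h1, h2⟩ := exists_diagram_bottom hc
  have hnd : (i', j) ∉ domRegion p := fun h => hk.not_mem_dom (domRegion_mono h hi' le_rfl)
  obtain ⟨k', hk'⟩ := exists_isCorner hp h1 hnd
  obtain rfl := hk.eq_of_snd hk' rfl
  obtain ⟨j', hj', h3⟩ := exists_essBox_right h1 h2
  have hnd' : (i', j') ∉ domRegion p := fun h => hnd (domRegion_mono h le_rfl hj')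
  obtain ⟨k', hk''⟩ := exists_isCorner hp h3.1 hnd'
  obtain rfl := hk'.eq_of_fst hk'' rfl
  exact ⟨_, h3, ⟨hi', hj'⟩, hk''⟩

/-- Two essential boxes with the same corner lie in the same row or in the same column: otherwise the
corner and the values at the two boxes yield one of the patterns `2143` and `1432`. -/
lemma essBoxes_aligned {p : Equiv.Perm ℕ} (h2143 : Avoids2143 p) (h1432 : Avoids1432 p)
    {k e f : ℕ × ℕ} (he : e ∈ essBoxes p) (hf : f ∈ essBoxes p) (hke : IsCorner p k e)
    (hkf : IsCorner p k f) : e.1 = f.1 ∨ e.2 = f.2 := by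
  -- It suffices to treat boxes `e` and `f` with `e` strictly above `f`.
  suffices key : ∀ e f : ℕ × ℕ, e ∈ essBoxes p → f ∈ essBoxes p → IsCorner p k e →
      IsCorner p k f → e.1 < f.1 → e.2 = f.2 by
    rcases lt_trichotomy e.1 f.1 with h | h | h
    · exact Or.inr (key e f he hf hke hkf h)
    · exact Or.inl h
    · exact Or.inr (key f e hf he hkf hke h).symm
  rintro ⟨i, j⟩ ⟨i', j'⟩ he hf hke hkf hlt
  obtain ⟨r, c⟩ := k
  simp only at hlt ⊢
  have hrc : p r = c := hke.apply
  rw [essBoxes_iff] at he hf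
  obtain ⟨e1, e2, e3, e4⟩ := he
  obtain ⟨f1, f2, f3, f4⟩ := hf
  have hr1 : r ≤ i := hke.le.1
  have hc1 : c ≤ j := hke.le.2
  have hr2 : r ≤ i' := hkf.le.1
  have hc2 : c ≤ j' := hkf.le.2
  have hri : r ≠ i := by rintro rfl; omega
  have hcj' : c ≠ j' := by
    rintro rfl
    have : p.symm c = r := by rw [← hrc]; simp
    omega
  rcases lt_trichotomy j j' with hjj | hjj | hjj
  · -- `f` is strictly SE of `e`: the neighbours of `e` and the box `f` form the pattern `2143`.
    exfalso
    have h1 : i + 1 ≠ i' := by rintro rfl; omega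
    have h2 : j + 1 ≠ j' := by rintro rfl; omega
    exact h2143 (p.symm (j + 1)) (i + 1) i' (p.symm j') (by omega) (by omega) f2
      (by simp; omega) (by simp; omega) (by simpa using f1)
  · exact hjj
  · exfalso
    have hpj : p (p.symm j) = j := by simp
    have hpj' : p (p.symm j') = j' := by simp
    have hpj1 : p (p.symm (j' + 1)) = j' + 1 := by simp
    have hne : ∀ a b, p a = p b → a = b := fun a b => p.injective.eq_iff.1
    -- A decreasing triple `4 3 2` in rows below `r` ending in the row of the value `j'`.
    have H : ∀ x, i < x → x < p.symm j' → j' < p x → p x < p i → False :=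
      fun x hx hx' h1 h2 => h1432 r i x (p.symm j') (by omega) hx hx' (by omega) (by omega) h2
    have hii' : p i < p i' := by
      by_contra hcon
      have h1 : p i ≠ p i' := fun h => by have := hne _ _ h; omega
      exact H i' hlt f2 f1 (by omega)
    have hx : i' < p.symm j := by
      by_contra hcon
      have h1 : p.symm j ≠ i' := by rintro h; rw [h] at hpj; omega
      exact H (p.symm j) e2 (by omega) (by omega) (by omega)
    have hy : i + 1 < i' := by
      have h1 : i + 1 ≠ i' := by rintro rfl; omega
      omega
    have hyj : p (i + 1) ≠ j' := by rintro rfl; simp at f2; omega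
    have hyj' : p (i + 1) < j' := by
      by_contra hcon
      exact H (i + 1) (by omega) (by omega) (by omega) (by omega)
    have hz1 : j' + 1 ≠ j := by rintro rfl; omega
    have hz : p.symm (j' + 1) ≤ i := by
      by_contra hcon
      exact H (p.symm (j' + 1)) (by omega) (by omega) (by omega) (by omega)
    exact h2143 (p.symm (j' + 1)) (i + 1) i' (p.symm j) (by omega) hy hx (by omega) (by omega)
      (by omega)

/-! ### Grassmannian permutations with a prescribed diagram -/

/-- The Grassmannian permutation with descent at `h` whose first `h` entries are the `h` smallest numbers
outside `L`. The set `L` is then the set of the nonempty columns of the diagram. -/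
lemma exists_isGrassmannian (h : ℕ) (L : Finset ℕ)
    (hL : ∀ y ∈ L, (Finset.range y \ L).card < h) :
    ∃ σ : Equiv.Perm (Fin (h + L.card)), IsGrassmannian σ ∧
      ∀ i y, (i, y) ∈ rotheDiagram σ ↔ y ∈ L ∧ i < h ∧ (Finset.range y \ L).card ≤ i := by
  classical
  set l := L.card with hl
  have hLt : ∀ y ∈ L, y < h + l := by
    intro y hy
    have h1 := Finset.card_sdiff_add_card_inter (Finset.range y) L
    have h2 : (Finset.range y ∩ L).card ≤ l := Finset.card_le_card Finset.inter_subset_right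
    have h3 := hL y hy
    rw [Finset.card_range] at h1
    omega
  set s : Finset (Fin (h + l)) := Finset.univ.filter fun k => k.val ∉ L with hs
  have hsc : sᶜ = Finset.univ.filter fun k : Fin (h + l) => k.val ∈ L := by
    ext; simp [hs]
  have hsc_card : sᶜ.card = l := by
    rw [hsc]
    show _ = L.card
    refine Finset.card_bij (fun k _ => k.val) (by simp) (fun a _ b _ => Fin.ext) ?_
    intro y hy
    exact ⟨⟨y, hLt y hy⟩, by simpa using hy, rfl⟩
  have hs_card : s.card = h := by
    have := Finset.card_add_card_compl s
    rw [Fintype.card_fin] at this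
    omega
  set f := s.orderEmbOfFin hs_card with hf
  set g := sᶜ.orderEmbOfFin hsc_card with hg
  set σ : Equiv.Perm (Fin (h + l)) :=
    finSumFinEquiv.symm.trans (finSumEquivOfFinset hs_card hsc_card) with hσ
  have σl : ∀ i : Fin h, σ (Fin.castAdd l i) = f i := by
    intro i; simp [hσ, hf]
  have σr : ∀ i : Fin l, σ (Fin.natAdd h i) = g i := by
    intro i; simp [hσ, hg]
  have hfs : ∀ i, (f i).val ∉ L := by
    intro i
    have : f i ∈ s := Finset.orderEmbOfFin_mem s hs_card i
    simpa [hs] using this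
  have hgs : ∀ i, (g i).val ∈ L := by
    intro i
    have : g i ∈ sᶜ := Finset.orderEmbOfFin_mem sᶜ hsc_card i
    rw [hsc] at this
    simpa using this
  have hfsurj : ∀ k ∈ s, ∃ i, f i = k := by
    intro k hk
    have := Finset.range_orderEmbOfFin s hs_card
    rw [← Finset.mem_coe, ← this] at hk
    exact hk
  -- An element outside `s` is below the `i`-th element of `s` iff at most `i` elements of `s`
  -- are below it.
  have hcount : ∀ (i : Fin h) (y : Fin (h + l)), y.val ∈ L →
      (y < f i ↔ (Finset.range y \ L).card ≤ i) := by
    intro i y hy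
    have hmap : (Finset.range y \ L).card = (s.filter (· < y)).card := by
      symm
      refine Finset.card_bij (fun k _ => k.val) ?_ (fun a _ b _ => Fin.ext) ?_
      · intro k hk
        simp only [hs, Finset.mem_filter, Finset.mem_univ, true_and, Fin.lt_def] at hk
        rw [Finset.mem_sdiff, Finset.mem_range]
        exact hk.symm
      · intro k hk
        simp only [Finset.mem_sdiff, Finset.mem_range] at hk
        refine ⟨⟨k, hk.1.trans y.2⟩, ?_, rfl⟩
        rw [hs, Finset.mem_filter, Finset.mem_filter]
        exact ⟨⟨Finset.mem_univ _, hk.2⟩, hk.1⟩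
    rw [hmap]
    constructor
    · intro hlt
      have hsub : s.filter (· < y) ⊆ (Finset.univ.filter (· < i)).image f := by
        intro k hk
        rw [Finset.mem_filter] at hk
        obtain ⟨a, rfl⟩ := hfsurj k hk.1
        exact Finset.mem_image_of_mem _ (by simpa using f.lt_iff_lt.1 (hk.2.trans hlt))
      calc _ ≤ _ := Finset.card_le_card hsub
        _ ≤ _ := Finset.card_image_le
        _ = i := by rw [Finset.filter_gt_eq_Iio, Fin.card_Iio]
    · intro hle
      by_contra hcon
      have hne : f i ≠ y := fun e => hfs i (e ▸ hy)
      have hlt : f i < y := lt_of_le_of_ne (not_lt.1 hcon) hne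
      have hsub : (Finset.univ.filter (· ≤ i)).image f ⊆ s.filter (· < y) := by
        intro k hk
        obtain ⟨a, ha, rfl⟩ := Finset.mem_image.1 hk
        rw [Finset.mem_filter]
        refine ⟨Finset.orderEmbOfFin_mem s hs_card a, lt_of_le_of_lt ?_ hlt⟩
        exact f.le_iff_le.2 (by simpa using ha)
      have := Finset.card_le_card hsub
      rw [Finset.card_image_of_injective _ f.injective, Finset.filter_ge_eq_Iic, Fin.card_Iic]
        at this
      omega
  refine ⟨σ, ?_, ?_⟩
  · -- every descent is at the position `h - 1`
    have key : ∀ i i' : Fin (h + l), i'.val = i.val + 1 → σ i' < σ i → i'.val = h := by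
      intro i i' hi hlt
      induction i using Fin.addCases with
      | left i =>
        induction i' using Fin.addCases with
        | left i' =>
          rw [σl, σl, f.lt_iff_lt, Fin.lt_def] at hlt
          simp only [Fin.val_castAdd] at hi
          omega
        | right i' =>
          simp only [Fin.val_castAdd, Fin.val_natAdd] at hi ⊢
          omega
      | right i =>
        induction i' using Fin.addCases with
        | left i' =>
          simp only [Fin.val_castAdd, Fin.val_natAdd] at hi ⊢
          omega
        | right i' =>
          rw [σr, σr, g.lt_iff_lt, Fin.lt_def] at hlt
          simp only [Fin.val_natAdd] at hi
          omega
    rintro i ⟨i', h1, h2⟩ k ⟨k', h3, h4⟩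
    have := key i i' h1 h2
    have := key k k' h3 h4
    exact Fin.ext (by omega)
  · intro i y
    constructor
    · rintro ⟨a, b, hab, h1, h2⟩
      obtain ⟨rfl, rfl⟩ := Prod.mk.inj hab
      obtain ⟨x, rfl⟩ := σ.surjective b
      rw [Equiv.symm_apply_apply] at h2
      induction x using Fin.addCases with
      | left x =>
        induction a using Fin.addCases with
        | left a =>
          rw [σl, σl, f.lt_iff_lt, Fin.lt_def] at h1
          simp only [Fin.lt_def, Fin.val_castAdd] at h2
          omega
        | right a =>
          simp only [Fin.lt_def, Fin.val_castAdd, Fin.val_natAdd] at h2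
          omega
      | right x =>
        induction a using Fin.addCases with
        | left a =>
          rw [σr, σl] at h1
          rw [σr]
          exact ⟨hgs x, a.2, (hcount a (g x) (hgs x)).1 h1⟩
        | right a =>
          rw [σr, σr, g.lt_iff_lt, Fin.lt_def] at h1
          simp only [Fin.lt_def, Fin.val_natAdd] at h2
          omega
    · rintro ⟨hy, hi, hc⟩
      refine ⟨Fin.castAdd l ⟨i, hi⟩, ⟨y, hLt y hy⟩, rfl, ?_, ?_⟩
      · rw [σl, hcount _ _ hy]
        exact hc
      · obtain ⟨x, hx⟩ := σ.surjective ⟨y, hLt y hy⟩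
        rw [← hx, Equiv.symm_apply_apply]
        induction x using Fin.addCases with
        | left x =>
          exfalso
          apply hfs x
          rw [← σl, hx]
          exact hy
        | right x =>
          simp only [Fin.lt_def, Fin.val_castAdd, Fin.val_natAdd]
          omega

lemma mem_rotheDiagram_inv {m : ℕ} {σ : Equiv.Perm (Fin m)} {i j : ℕ} :
    (i, j) ∈ rotheDiagram σ⁻¹ ↔ (j, i) ∈ rotheDiagram σ := by
  rw [rotheDiagram_eq, rotheDiagram_eq, ← mem_diagram_symm]; rfl

/-- The part of a diagram in a rectangle at a corner of the dominant region, if all its columns reach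
down to the last row of the rectangle, is the diagram of a Grassmannian permutation. -/
lemma exists_isGrassmannian_window {p : Equiv.Perm ℕ} {r c R J : ℕ}
    (hk : IsCorner p (r, c) (R, J))
    (hdown : ∀ x x' j, r ≤ x → x ≤ x' → x' ≤ R → c ≤ j → j ≤ J → (x, j) ∈ diagram p →
      (x', j) ∈ diagram p)
    (hJ : ∀ j, c ≤ j → (R, j) ∈ diagram p → j ≤ J) :
    ∃ σ : Equiv.Perm (Fin ((R + 1 - r) + {j | c ≤ j ∧ (R, j) ∈ diagram p}.ncard)),
      IsGrassmannian σ ∧ ∀ i y, (i, y) ∈ rotheDiagram σ ↔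
        (r + i, c + y) ∈ diagram p ∧ r + i ≤ R ∧ c + y ≤ J := by
  classical
  have hrR : r ≤ R := hk.le.1
  set L : Finset ℕ := (Finset.range (p R)).filter fun y => (R, c + y) ∈ diagram p with hL
  have memL : ∀ y, y ∈ L ↔ (R, c + y) ∈ diagram p := by
    intro y
    rw [hL, Finset.mem_filter, Finset.mem_range, and_iff_right_iff_imp]
    intro h
    have := h.1
    simp only at this
    omega
  have hcard : {j | c ≤ j ∧ (R, j) ∈ diagram p}.ncard = L.card := by
    rw [← Set.ncard_coe_finset]
    symm
    refine Set.ncard_congr (fun y _ => c + y) ?_ ?_ ?_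
    · intro y hy
      exact ⟨by omega, (memL y).1 hy⟩
    · intro a b _ _ h
      omega
    · rintro j ⟨h1, h2⟩
      refine ⟨j - c, ?_, by omega⟩
      rw [Finset.mem_coe, memL]
      rwa [Nat.add_sub_cancel' h1]
  -- The columns left of a column of `L` that do not belong to `L` are met by the graph of `p` in the
  -- rows of the rectangle.
  have hcount : ∀ y ∈ L, (Finset.range y \ L).card =
      ((Finset.range (R + 1 - r)).filter fun i => p (r + i) < c + y).card := by
    intro y hy
    have hyR := (memL y).1 hy
    have hyJ := hJ _ (by omega) hyR
    have hsym : ∀ k ∈ Finset.range y \ L, r ≤ p.symm (c + k) ∧ p.symm (c + k) ≤ R := by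
      intro k hk'
      rw [Finset.mem_sdiff, Finset.mem_range, memL, mem_diagram, not_and_or, not_lt, not_lt] at hk'
      refine ⟨hk.col _ (by simp only; omega), ?_⟩
      rcases hk'.2 with h | h
      · have := hyR.1
        simp only at this
        omega
      · exact h
    refine Finset.card_bij (fun k _ => p.symm (c + k) - r) ?_ ?_ ?_
    · intro k hk'
      have h1 := hsym k hk'
      rw [Finset.mem_sdiff, Finset.mem_range] at hk'
      rw [Finset.mem_filter, Finset.mem_range, Nat.add_sub_cancel' h1.1]
      refine ⟨by omega, ?_⟩
      rw [Equiv.apply_symm_apply]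
      omega
    · intro a ha b hb hab
      have h1 := hsym a ha
      have h2 := hsym b hb
      have h3 : p.symm (c + a) = p.symm (c + b) := by omega
      have := p.symm.injective h3
      omega
    · intro i hi
      rw [Finset.mem_filter, Finset.mem_range] at hi
      have hci : c ≤ p (r + i) := hk.row _ (by simp only; omega)
      refine ⟨p (r + i) - c, ?_, ?_⟩
      · rw [Finset.mem_sdiff, Finset.mem_range, memL, Nat.add_sub_cancel' hci]
        refine ⟨by omega, fun h => ?_⟩
        have := h.2
        rw [Equiv.symm_apply_apply] at this
        simp only at this
        omega
      · rw [Nat.add_sub_cancel' hci, Equiv.symm_apply_apply]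
        omega
  -- Those rows are the topmost ones.
  have hinit : ∀ y ∈ L, ∀ i < R + 1 - r, (c + y < p (r + i) ↔ (Finset.range y \ L).card ≤ i) := by
    intro y hy i hi
    rw [hcount y hy]
    have hyR := (memL y).1 hy
    have hyJ := hJ _ (by omega) hyR
    have hup : ∀ a b, a ≤ b → b < R + 1 - r → c + y < p (r + a) → c + y < p (r + b) := by
      intro a b hab hb h
      refine (hdown (r + a) (r + b) (c + y) (by omega) (by omega) (by omega) (by omega) hyJ
        ⟨h, ?_⟩).1
      have := hyR.2
      simp only at this ⊢
      omega
    constructor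
    · intro h
      calc _ ≤ (Finset.range i).card := Finset.card_le_card ?_
        _ = i := Finset.card_range i
      intro a ha
      rw [Finset.mem_filter, Finset.mem_range] at ha
      rw [Finset.mem_range]
      by_contra hcon
      have := hup i a (by omega) ha.1 h
      omega
    · intro h
      by_contra hcon
      have hne : p (r + i) ≠ c + y := by
        intro e
        have := hyR.2
        rw [← e, Equiv.symm_apply_apply] at this
        simp only at this
        omega
      have hsub : Finset.range (i + 1) ⊆
          (Finset.range (R + 1 - r)).filter fun i => p (r + i) < c + y := by
        intro a ha
        rw [Finset.mem_range] at ha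
        rw [Finset.mem_filter, Finset.mem_range]
        refine ⟨by omega, ?_⟩
        by_contra hcon'
        have hne' : p (r + a) ≠ c + y := by
          intro e
          have := hyR.2
          rw [← e, Equiv.symm_apply_apply] at this
          simp only at this
          omega
        have := hup a i (by omega) hi (by omega)
        omega
      have := Finset.card_le_card hsub
      rw [Finset.card_range] at this
      omega
  have hlt : ∀ y ∈ L, (Finset.range y \ L).card < R + 1 - r := by
    intro y hy
    have hyR := (memL y).1 hy
    have h1 := (hinit y hy (R - r) (by omega)).1 (by
      rw [Nat.add_sub_cancel' hrR]
      exact hyR.1)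
    omega
  obtain ⟨σ, hσ1, hσ2⟩ := exists_isGrassmannian (R + 1 - r) L hlt
  rw [hcard]
  refine ⟨σ, hσ1, fun i y => ?_⟩
  rw [hσ2]
  constructor
  · rintro ⟨hy, hi, hc⟩
    have hyR := (memL y).1 hy
    refine ⟨⟨(hinit y hy i hi).2 hc, ?_⟩, by omega, hJ _ (by omega) hyR⟩
    have := hyR.2
    simp only at this ⊢
    omega
  · rintro ⟨h1, h2, h3⟩
    have hy : y ∈ L :=
      (memL y).2 (hdown (r + i) R (c + y) (by omega) h2 le_rfl (by omega) h3 h1)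
    exact ⟨hy, by omega, (hinit y hy i (by omega)).1 h1.1⟩

/-! ### Labels of the pipes of a bumpless pipe dream -/

namespace BPD

variable {n : ℕ} (D : BPD n)

lemma tileAt_of_lt {i j : ℕ} (hi : i < n) (hj : j < n) : D.tileAt i j = D.tile ⟨i, hi⟩ ⟨j, hj⟩ := by
  rw [tileAt, dif_pos ⟨hi, hj⟩]

lemma tileAt_coe (i j : Fin n) : D.tileAt i j = D.tile i j := D.tileAt_of_lt i.2 j.2

/-- The label on the south side of the cell `(i, j)`. -/
def southLabel (i j : ℕ) : ℕ := southOf D (n - 1 - i) j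

/-- The label on the west side of the cell `(i, j)`. -/
def westLabel (i j : ℕ) : ℕ := westOf D (D.southLabel i) i j

/-- Whether a pipe crosses the vertical segment to the west of the cell `(i, j)`. -/
def westEdge (i : ℕ) : ℕ → Bool
  | 0 => false
  | j + 1 => (D.tileAt i j).east

/-- The label on the north side of the cell `(i, j)`. -/
def topLabel (i j : ℕ) : ℕ := northLabel (D.tileAt i j) (D.westLabel i j) (D.southLabel i j)

variable {D} {i j k : ℕ}

lemma westEdge_eq (hi : i < n) (hj : j < n) : D.westEdge i j = (D.tileAt i j).west := by
  rcases j with - | j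
  · rw [D.tileAt_of_lt hi hj]
    exact (D.west_border _ _ rfl).symm
  · rw [westEdge, D.tileAt_of_lt hi hj, D.tileAt_of_lt hi (by omega)]
    exact D.horizontal _ _ _ rfl

lemma westEdge_end (hi : i < n) : D.westEdge i n = true := by
  obtain ⟨k, rfl⟩ : ∃ k, n = k + 1 := ⟨n - 1, by omega⟩
  rw [westEdge, D.tileAt_of_lt hi (Nat.lt_succ_self k)]
  exact D.east_border _ _ rfl

lemma south_eq_north (hi : i + 1 < n) (hj : j < n) :
    (D.tileAt i j).south = (D.tileAt (i + 1) j).north := by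
  rw [D.tileAt_of_lt hi hj, D.tileAt_of_lt (by omega) hj]
  exact D.vertical _ _ _ rfl

lemma south_last (hj : j < n) (hi : i + 1 = n) : (D.tileAt i j).south = true := by
  rw [D.tileAt_of_lt (by omega) hj]
  exact D.south_border _ _ hi

lemma north_zero (hj : j < n) : (D.tileAt 0 j).north = false := by
  rw [D.tileAt_of_lt (by omega) hj]
  exact D.north_border _ _ rfl

lemma westLabel_succ : D.westLabel i (j + 1) =
    eastLabel (D.tileAt i j) (D.westLabel i j) (D.southLabel i j) := rfl

lemma southLabel_last : D.southLabel (n - 1) j = j := by simp [southLabel, southOf]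

lemma southLabel_eq_topLabel (hi : i + 1 < n) : D.southLabel i j = D.topLabel (i + 1) j := by
  have h1 : n - 1 - i = (n - 1 - (i + 1)) + 1 := by omega
  have h2 : n - 1 - (n - 1 - (i + 1)) = i + 1 := by omega
  rw [southLabel, h1, southOf, h2]
  rfl

lemma exitLabel_eq : D.exitLabel i = D.westLabel i n := rfl

lemma northLabel_le (t : Tile) (w s : ℕ) : northLabel t w s ≤ max w s := by
  cases t <;> simp [northLabel]

lemma eastLabel_le (t : Tile) (w s : ℕ) : eastLabel t w s ≤ max w s := by
  cases t <;> simp [eastLabel]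

/-- Pipes travel to the north and to the east. -/
lemma labels_le (hi : i < n) (j : ℕ) : D.southLabel i j ≤ j ∧ D.westLabel i j ≤ j - 1 := by
  have row : ∀ i, (∀ j, D.southLabel i j ≤ j) → ∀ j, D.westLabel i j ≤ j - 1 := by
    intro i h j
    induction j with
    | zero => exact le_rfl
    | succ j ih =>
      rw [westLabel_succ]
      have := eastLabel_le (D.tileAt i j) (D.westLabel i j) (D.southLabel i j)
      have := h j
      omega
  have main : ∀ r, r < n → ∀ j, D.southLabel (n - 1 - r) j ≤ j := by
    intro r
    induction r with
    | zero => intro _ j; rw [Nat.sub_zero, southLabel_last]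
    | succ r ih =>
      intro hr j
      have h1 : n - 1 - (r + 1) + 1 = n - 1 - r := by omega
      rw [southLabel_eq_topLabel (by omega), h1, topLabel]
      have := northLabel_le (D.tileAt (n - 1 - r) j) (D.westLabel (n - 1 - r) j)
        (D.southLabel (n - 1 - r) j)
      have := ih (by omega) j
      have := row _ (ih (by omega)) j
      omega
  have := main (n - 1 - i) (by omega)
  rw [show n - 1 - (n - 1 - i) = i by omega] at this
  exact ⟨this j, row i this j⟩

/-! ### Pipes in a row -/

/-- A pipe travelling to the east leaves its row through the north or exits. -/
lemma exit_or_top_of_westEdge (hi : i < n) (hk : k ≤ n) (h : D.westEdge i k = true) :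
    D.exitLabel i = D.westLabel i k ∨
      ∃ l, k ≤ l ∧ l < n ∧ (D.tileAt i l).north = true ∧ D.topLabel i l = D.westLabel i k := by
  induction hk using Nat.decreasingInduction with
  | self => exact Or.inl rfl
  | of_succ k hk ih =>
    rw [westEdge_eq hi hk] at h
    have h2 := westLabel_succ (D := D) (i := i) (j := k)
    have h3 : D.westEdge i (k + 1) = (D.tileAt i k).east := rfl
    have key : D.westEdge i (k + 1) = true → D.westLabel i (k + 1) = D.westLabel i k →
        D.exitLabel i = D.westLabel i k ∨
      ∃ l, k ≤ l ∧ l < n ∧ (D.tileAt i l).north = true ∧ D.topLabel i l = D.westLabel i k := by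
      intro he hl
      rw [← hl]
      rcases ih he with h4 | ⟨l, h4, h5⟩
      · exact Or.inl h4
      · exact Or.inr ⟨l, by omega, h5⟩
    have key' : (D.tileAt i k).north = true → D.topLabel i k = D.westLabel i k →
        D.exitLabel i = D.westLabel i k ∨
      ∃ l, k ≤ l ∧ l < n ∧ (D.tileAt i l).north = true ∧ D.topLabel i l = D.westLabel i k :=
      fun hn ht => Or.inr ⟨k, le_rfl, hk, hn, ht⟩
    cases ht : D.tileAt i k <;> simp only [ht, Tile.west, Bool.false_eq_true] at h
    · rw [ht] at h2 h3
      rcases le_total (D.westLabel i k) (D.southLabel i k) with hle | hle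
      · exact key h3 (by rw [h2, eastLabel, min_eq_left hle])
      · exact key' (by rw [ht]; rfl) (by rw [topLabel, ht, northLabel, max_eq_left hle])
    · rw [ht] at h2 h3
      exact key h3 h2
    · exact key' (by rw [ht]; rfl) (by rw [topLabel, ht, northLabel])

/-- A pipe entering a cell from the south leaves it through the north or the east. -/
lemma top_or_westEdge_of_south (h : (D.tileAt i j).south = true) :
    ((D.tileAt i j).north = true ∧ D.topLabel i j = D.southLabel i j) ∨
      (D.westEdge i (j + 1) = true ∧ D.westLabel i (j + 1) = D.southLabel i j) := by
  rw [westLabel_succ, westEdge, topLabel]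
  cases ht : D.tileAt i j <;> simp [ht, Tile.south, Tile.north, Tile.east, northLabel, eastLabel]
    at h ⊢
  exact le_total _ _

/-- A pipe travelling to the east leaves its row to the north before, or when, it meets a pipe with
a smaller label that comes from the south. -/
lemma exists_top_of_lt (hi : i < n) (hkj : k ≤ j) (hj : j < n) (h : D.westEdge i k = true)
    (hs : (D.tileAt i j).south = true) (hlt : D.southLabel i j < D.westLabel i k) :
    ∃ l, k ≤ l ∧ l ≤ j ∧ (D.tileAt i l).north = true ∧ D.topLabel i l = D.westLabel i k ∧
      (l = j → D.westEdge i (j + 1) = true ∧ D.westLabel i (j + 1) = D.southLabel i j) := by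
  induction hkj using Nat.decreasingInduction with
  | self =>
    rw [westEdge_eq hi hj] at h
    refine ⟨j, le_rfl, le_rfl, ?_⟩
    rw [westLabel_succ, westEdge, topLabel]
    cases ht : D.tileAt i j <;> simp [ht, Tile.south, Tile.west] at h hs
    simp [Tile.north, Tile.east, northLabel, eastLabel, hlt.le]
  | of_succ k hk ih =>
    rw [westEdge_eq hi (by omega)] at h
    have h2 := westLabel_succ (D := D) (i := i) (j := k)
    have h3 : D.westEdge i (k + 1) = (D.tileAt i k).east := rfl
    have key : D.westEdge i (k + 1) = true → D.westLabel i (k + 1) = D.westLabel i k →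
        ∃ l, k ≤ l ∧ l ≤ j ∧ (D.tileAt i l).north = true ∧ D.topLabel i l = D.westLabel i k ∧
      (l = j → D.westEdge i (j + 1) = true ∧ D.westLabel i (j + 1) = D.southLabel i j) := by
      intro he hl
      rw [← hl]
      obtain ⟨l, h4, h5⟩ := ih he (by rw [hl]; exact hlt)
      exact ⟨l, by omega, h5⟩
    have key' : (D.tileAt i k).north = true → D.topLabel i k = D.westLabel i k →
        ∃ l, k ≤ l ∧ l ≤ j ∧ (D.tileAt i l).north = true ∧ D.topLabel i l = D.westLabel i k ∧
      (l = j → D.westEdge i (j + 1) = true ∧ D.westLabel i (j + 1) = D.southLabel i j) :=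
      fun hn ht => ⟨k, le_rfl, hk.le, hn, ht, fun e => absurd e hk.ne⟩
    cases ht : D.tileAt i k <;> simp only [ht, Tile.west, Bool.false_eq_true] at h
    · rw [ht] at h2 h3
      rcases le_total (D.westLabel i k) (D.southLabel i k) with hle | hle
      · exact key h3 (by rw [h2, eastLabel, min_eq_left hle])
      · exact key' (by rw [ht]; rfl) (by rw [topLabel, ht, northLabel, max_eq_left hle])
    · rw [ht] at h2 h3
      exact key h3 h2
    · exact key' (by rw [ht]; rfl) (by rw [topLabel, ht, northLabel])

/-- Two pipes that are not in increasing order below a row are in the same order above it, unless the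
smaller one exits. -/
lemma exists_top_pair (hi : i < n) (hjk : j < k) (hk : k < n)
    (hj' : (D.tileAt i j).south = true) (hk' : (D.tileAt i k).south = true)
    (hlt : D.southLabel i k < D.southLabel i j) :
    ∃ l < n, (D.tileAt i l).north = true ∧ D.topLabel i l = D.southLabel i j ∧
      (D.exitLabel i = D.southLabel i k ∨ ∃ l', l < l' ∧ l' < n ∧ (D.tileAt i l').north = true ∧
        D.topLabel i l' = D.southLabel i k) := by
  -- the fate of the second pipe
  have second : ∀ l < k, D.exitLabel i = D.southLabel i k ∨
      ∃ l', l < l' ∧ l' < n ∧ (D.tileAt i l').north = true ∧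
        D.topLabel i l' = D.southLabel i k := by
    intro l hl
    rcases top_or_westEdge_of_south hk' with ⟨h1, h2⟩ | ⟨h1, h2⟩
    · exact Or.inr ⟨k, hl, hk, h1, h2⟩
    · rw [← h2]
      rcases exit_or_top_of_westEdge hi hk h1 with h3 | ⟨l', h3, h4⟩
      · exact Or.inl h3
      · exact Or.inr ⟨l', by omega, h4⟩
  rcases top_or_westEdge_of_south hj' with ⟨h1, h2⟩ | ⟨h1, h2⟩
  · exact ⟨j, by omega, h1, h2, second j hjk⟩
  · obtain ⟨l, h3, h4, h5, h6, h7⟩ := exists_top_of_lt hi (show j + 1 ≤ k from hjk) hk h1 hk'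
      (by rw [h2]; exact hlt)
    refine ⟨l, by omega, h5, by rw [h6, h2], ?_⟩
    rcases Nat.lt_or_eq_of_le h4 with h8 | h8
    · exact second l h8
    · obtain ⟨h9, h10⟩ := h7 h8
      rw [← h10]
      rcases exit_or_top_of_westEdge hi hk h9 with h11 | ⟨l', h11, h12⟩
      · exact Or.inl h11
      · exact Or.inr ⟨l', by omega, h12⟩

/-- In each row the labels entering from the south leave through the north and the east. -/
lemma row_labels (hi : i < n) {j : ℕ} (hj : j ≤ n) :
    ((Multiset.range j).filter fun k => (D.tileAt i k).north = true).map (D.topLabel i) +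
        (if D.westEdge i j = true then {D.westLabel i j} else 0) =
      ((Multiset.range j).filter fun k => (D.tileAt i k).south = true).map (D.southLabel i) := by
  induction j with
  | zero => simp [westEdge]
  | succ j ih =>
    have h1 := ih (by omega)
    have h2 : D.westEdge i (j + 1) = (D.tileAt i j).east := rfl
    rw [westEdge_eq hi (by omega)] at h1
    rw [Multiset.range_succ, Multiset.filter_cons, Multiset.filter_cons, Multiset.map_add,
      Multiset.map_add, ← h1, h2, westLabel_succ]
    set M := ((Multiset.range j).filter fun k => (D.tileAt i k).north = true).map (D.topLabel i)
    have h3 : D.topLabel i j = northLabel (D.tileAt i j) (D.westLabel i j) (D.southLabel i j) := rfl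
    cases ht : D.tileAt i j <;> rw [ht] at h3 <;>
      simp only [h3, Tile.north, Tile.east, Tile.south, Tile.west, northLabel, eastLabel,
        Bool.false_eq_true, if_true, if_false, Multiset.map_singleton, Multiset.map_zero]
    case cross =>
      rcases le_total (D.westLabel i j) (D.southLabel i j) with hle | hle
      · rw [max_eq_right hle, min_eq_left hle]; abel
      · rw [max_eq_left hle, min_eq_right hle]; abel
    all_goals abel

end BPD

namespace BPD

variable {n : ℕ} {D : BPD n} {i j k : ℕ}

/-- The labels below the row `i` are those that exit in the rows `0, …, i`. -/
lemma south_labels (hi : i < n) :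
    ((Multiset.range n).filter fun k => (D.tileAt i k).south = true).map (D.southLabel i) =
      (Multiset.range (i + 1)).map D.exitLabel := by
  induction i with
  | zero =>
    rw [← row_labels hi le_rfl, westEdge_end hi, Multiset.filter_eq_nil.2]
    · simp [exitLabel_eq]
    · intro k hk
      rw [north_zero (Multiset.mem_range.1 hk)]
      simp
  | succ i ih =>
    rw [← row_labels hi le_rfl, westEdge_end hi, Multiset.range_succ (i + 1), Multiset.map_cons,
      ← ih (by omega), if_pos rfl, ← exitLabel_eq, add_comm, Multiset.singleton_add]
    congr 1
    have h1 : (Multiset.range n).filter (fun k => (D.tileAt (i + 1) k).north = true) =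
        (Multiset.range n).filter (fun k => (D.tileAt i k).south = true) := by
      apply Multiset.filter_congr
      intro k hk
      rw [south_eq_north hi (Multiset.mem_range.1 hk)]
    rw [h1]
    apply Multiset.map_congr rfl
    intro k _
    rw [southLabel_eq_topLabel hi]

/-! ### The order of two pipes that have crossed -/

section perm

variable {p : Equiv.Perm ℕ} (hp : ∀ i < n, D.exitLabel i = p i)
include hp

lemma nodup_south_labels (hi : i < n) :
    (((Multiset.range n).filter fun k => (D.tileAt i k).south = true).map
      (D.southLabel i)).Nodup := by
  rw [south_labels hi]
  refine Multiset.Nodup.map_on ?_ (Multiset.nodup_range _)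
  intro a ha b hb hab
  rw [Multiset.mem_range] at ha hb
  rw [hp a (by omega), hp b (by omega)] at hab
  exact p.injective hab

lemma symm_southLabel_le (hi : i < n) (hj : j < n) (h : (D.tileAt i j).south = true) :
    p.symm (D.southLabel i j) ≤ i := by
  have : D.southLabel i j ∈ (Multiset.range (i + 1)).map D.exitLabel := by
    rw [← south_labels hi]
    exact Multiset.mem_map_of_mem _ (by simp [hj, h])
  obtain ⟨a, ha, h1⟩ := Multiset.mem_map.1 this
  rw [Multiset.mem_range] at ha
  rw [← h1, hp a (by omega), Equiv.symm_apply_apply]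
  omega

/-- A pipe to the left of a pipe with a smaller label exits above it. -/
lemma symm_southLabel_lt (hi : i < n) (hjk : j < k) (hk : k < n)
    (hj' : (D.tileAt i j).south = true) (hk' : (D.tileAt i k).south = true)
    (hlt : D.southLabel i k < D.southLabel i j) :
    p.symm (D.southLabel i j) < p.symm (D.southLabel i k) := by
  induction i generalizing j k with
  | zero =>
    obtain ⟨l, h1, h2, -⟩ := exists_top_pair hi hjk hk hj' hk' hlt
    rw [north_zero h1] at h2
    simp at h2
  | succ i ih =>
    obtain ⟨l, h1, h2, h3, h4⟩ := exists_top_pair hi hjk hk hj' hk' hlt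
    rw [← h3, ← southLabel_eq_topLabel hi]
    rw [← south_eq_north hi h1] at h2
    rcases h4 with h4 | ⟨l', h5, h6, h7, h8⟩
    · rw [← h4, hp _ hi, Equiv.symm_apply_apply]
      exact Nat.lt_succ_of_le (symm_southLabel_le hp (by omega) h1 h2)
    · rw [← h8, ← southLabel_eq_topLabel hi]
      rw [← south_eq_north hi h6] at h7
      refine ih (by omega) h5 h6 h2 h7 ?_
      rw [southLabel_eq_topLabel hi, southLabel_eq_topLabel hi, h3, h8]
      exact hlt

/-- The two pipes at a crossing exit in decreasing order of their labels. -/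
lemma exists_inversion_of_cross (hi : i < n) (hj : j < n) (h : D.tileAt i j = .cross) :
    ∃ a b, a < b ∧ b ≤ i ∧ p b < p a ∧ p a ≤ j := by
  set w := D.westLabel i j with hw
  set s := D.southLabel i j with hs
  have htop : D.topLabel i j = max w s := by rw [topLabel, h]; rfl
  have heast : D.westLabel i (j + 1) = min w s := by rw [westLabel_succ, h]; rfl
  have hedge : D.westEdge i (j + 1) = true := by rw [westEdge, h]; rfl
  have hnorth : (D.tileAt i j).north = true := by rw [h]; rfl
  obtain ⟨i, rfl⟩ : ∃ i', i = i' + 1 := by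
    rcases i with - | i
    · rw [north_zero hj] at hnorth
      simp at hnorth
    · exact ⟨i, rfl⟩
  have hle := labels_le (D := D) hi j
  have hne : w ≠ s := by
    -- the labels in the row are distinct
    intro hws
    have h1 := row_labels (D := D) hi (show j + 1 ≤ n from hj)
    have h2 : (((Multiset.range (j + 1)).filter fun k => (D.tileAt (i + 1) k).south = true).map
        (D.southLabel (i + 1))).Nodup :=
      Multiset.nodup_of_le (Multiset.map_le_map (Multiset.filter_le_filter _
        (Multiset.range_le.2 hj))) (nodup_south_labels hp hi)
    rw [← h1, if_pos hedge, heast, Multiset.range_succ, Multiset.filter_cons_of_pos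
        (p := fun k => (D.tileAt (i + 1) k).north = true) _ hnorth,
      Multiset.map_cons, htop, hws, min_self, max_self, add_comm, Multiset.singleton_add] at h2
    simp at h2
  have hS : (D.tileAt i j).south = true := by rw [south_eq_north hi hj]; exact hnorth
  have hSl : D.southLabel i j = max w s := by rw [southLabel_eq_topLabel hi, htop]
  have hlt : p.symm (max w s) < p.symm (min w s) ∧ p.symm (min w s) ≤ i + 1 := by
    rcases exit_or_top_of_westEdge hi hj hedge with h1 | ⟨l, h1, h2, h3, h4⟩
    · rw [← heast, ← h1, hp _ hi, Equiv.symm_apply_apply, ← hSl]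
      exact ⟨Nat.lt_succ_of_le (symm_southLabel_le hp (by omega) hj hS), le_rfl⟩
    · rw [← south_eq_north hi h2] at h3
      rw [← southLabel_eq_topLabel hi, heast] at h4
      have h5 := symm_southLabel_le hp (by omega) h2 h3
      rw [← hSl, ← h4]
      refine ⟨symm_southLabel_lt hp (by omega) h1 h2 hS h3 ?_, by omega⟩
      rw [hSl, h4]
      exact min_lt_max.2 hne
  refine ⟨_, _, hlt.1, hlt.2, ?_, ?_⟩
  · simp [hne.symm]
  · rw [Equiv.apply_symm_apply]
    omega

end perm

/-! ### Regions without `j`-tiles -/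

section region

variable {c d : ℕ} (H : ∀ a b, c < a → d ≤ b → D.tileAt a b ≠ .jtile)
include H

/-- Where no pipe turns to the north, the vertical pipes come from the south border. -/
lemma southLabel_eq_self (hc : c ≤ i) (hi : i < n) (hd : d ≤ j) (hj : j < n)
    (h : (D.tileAt i j).south = true) : D.southLabel i j = j := by
  have main : ∀ r, r < n → c ≤ n - 1 - r → (D.tileAt (n - 1 - r) j).south = true →
      D.southLabel (n - 1 - r) j = j := by
    intro r
    induction r with
    | zero => intro _ _ _; rw [Nat.sub_zero, southLabel_last]
    | succ r ih =>
      intro hr hcr hs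
      have h1 : n - 1 - (r + 1) + 1 = n - 1 - r := by omega
      have h2 : n - 1 - (r + 1) + 1 < n := by omega
      rw [south_eq_north h2 hj, h1] at hs
      rw [southLabel_eq_topLabel h2, h1, topLabel]
      have h3 := H (n - 1 - r) j (by omega) hd
      have h4 := (labels_le (D := D) (show n - 1 - r < n by omega) j).2
      have h5 := ih (by omega) (by omega)
      cases ht : D.tileAt (n - 1 - r) j <;> rw [ht] at hs h3 h5 <;>
        simp [Tile.north, Tile.south] at hs h3 h5 ⊢
      · rw [northLabel, h5]
        omega
      · rw [northLabel, h5]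
  have := main (n - 1 - i) (by omega)
  rw [show n - 1 - (n - 1 - i) = i by omega] at this
  exact this hc h

lemma exitLabel_of_rtile (hc : c ≤ i) (hi : i < n) (hd : d ≤ j) (hj : j < n)
    (h : D.tileAt i j = .rtile) (hrow : ∀ b, j < b → D.tileAt i b ≠ .jtile) :
    D.exitLabel i = j := by
  have hs : (D.tileAt i j).south = true := by rw [h]; rfl
  have hsl := southLabel_eq_self H hc hi hd hj hs
  have main : ∀ b, j + 1 ≤ b → b ≤ n → D.westEdge i b = true ∧ D.westLabel i b = j := by
    intro b hb
    induction b, hb using Nat.le_induction with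
    | base =>
      intro _
      rw [westLabel_succ, westEdge, h, eastLabel, hsl]
      exact ⟨rfl, rfl⟩
    | succ b hb ih =>
      intro hbn
      obtain ⟨h1, h2⟩ := ih (by omega)
      have h3 := hrow b (by omega)
      have h4 : (D.tileAt i b).south = true → D.southLabel i b = b := fun h =>
        southLabel_eq_self H hc hi (by omega) (by omega) h
      rw [westEdge_eq hi (by omega)] at h1
      rw [westLabel_succ, westEdge, h2]
      cases ht : D.tileAt i b <;> rw [ht] at h1 h3 h4 <;>
        simp [Tile.west, Tile.south] at h1 h3 h4
      · rw [eastLabel, h4]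
        exact ⟨rfl, by omega⟩
      · exact ⟨rfl, rfl⟩
  exact (main n hj le_rfl).2

end region

/-! ### Crossings and patterns -/

/-- No crossing lies weakly NW of a tile with neither a south nor an east side, that is, of a blank or
a `j`-tile. -/
def Tame (D : BPD n) : Prop :=
  ∀ x y c d, x ≤ c → y ≤ d → c < n → d < n → D.tileAt x y = .cross →
    (D.tileAt c d).south = false → (D.tileAt c d).east = false → False

/-- If a crossing lies weakly NW of a blank or a `j`-tile, then the two pipes at the crossing,
together with the two pipes that first pass below and to the right of the SE-most such tile, form the
pattern `2143`. -/
lemma tame_of_avoids {p : Equiv.Perm ℕ} (hp : ∀ i < n, D.exitLabel i = p i)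
    (h2143 : Avoids2143 p) : D.Tame := by
  classical
  intro x y c₀ d₀ hx hy hc₀ hd₀ hcross hs₀ he₀
  set F := (Finset.range n ×ˢ Finset.range n).filter fun q => c₀ ≤ q.1 ∧ d₀ ≤ q.2 ∧
    (D.tileAt q.1 q.2).south = false ∧ (D.tileAt q.1 q.2).east = false with hF
  obtain ⟨⟨c, d⟩, hq, hmax⟩ := Finset.exists_max_image F (fun q => q.1 + q.2)
    ⟨(c₀, d₀), by simp [hF, hc₀, hd₀, hs₀, he₀]⟩
  simp only [hF, Finset.mem_filter, Finset.mem_product, Finset.mem_range] at hq hmax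
  obtain ⟨⟨hc, hd⟩, hcc, hdd, hs, he⟩ := hq
  have hj : ∀ a b, c ≤ a → d ≤ b → c + d < a + b → D.tileAt a b ≠ .jtile := by
    intro a b ha hb hab ht
    have hab' : a < n ∧ b < n := by
      by_contra hcon
      rw [tileAt, dif_neg hcon] at ht
      simp at ht
    have := hmax (a, b) ⟨hab', by omega, by omega, by rw [ht]; rfl, by rw [ht]; rfl⟩
    simp only at this
    omega
  have hjreg : ∀ a b, c < a → d ≤ b → D.tileAt a b ≠ .jtile := fun a b ha hb =>
    hj a b ha.le hb (by omega)
  -- the first pipe that crosses the row to the right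
  obtain ⟨d₁, hd₁, hd₁n, hpc⟩ : ∃ d₁, d < d₁ ∧ d₁ < n ∧ p c = d₁ := by
    have hex : ∃ l, d < l ∧ D.westEdge c (l + 1) = true := by
      refine ⟨n - 1, ?_, ?_⟩
      · by_contra hcon
        have h1 : n = d + 1 := by omega
        have h2 := westEdge_end (D := D) hc
        have h3 : D.westEdge c n = D.westEdge c (d + 1) := congrArg _ h1
        rw [h3, westEdge, he] at h2
        simp at h2
      · rw [Nat.sub_add_cancel (by omega)]
        exact westEdge_end hc
    obtain ⟨d₁, ⟨h1, h2⟩, hmin⟩ := Nat.findX hex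
    have hd₁ : d₁ < n := by
      by_contra hcon
      rw [westEdge, tileAt, dif_neg (by omega)] at h2
      simp [Tile.east] at h2
    refine ⟨d₁, h1, hd₁, ?_⟩
    have h3 : D.westEdge c d₁ = false := by
      obtain ⟨l, rfl⟩ : ∃ l, d₁ = l + 1 := ⟨d₁ - 1, by omega⟩
      by_cases hl : l = d
      · rw [hl, westEdge, he]
      · have := hmin l (by omega)
        rw [not_and, Bool.not_eq_true] at this
        exact this (by omega)
    rw [westEdge_eq hc hd₁] at h3
    have h4 : D.tileAt c d₁ = .rtile := by
      rw [westEdge] at h2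
      cases ht : D.tileAt c d₁ <;> rw [ht] at h2 h3 <;> simp [Tile.west, Tile.east] at h2 h3
    rw [← hp c hc]
    exact exitLabel_of_rtile hjreg le_rfl hc h1.le hd₁ h4
      fun b hb => hj c b le_rfl (by omega) (by omega)
  -- the first pipe that crosses the column below
  obtain ⟨c₁, hc₁, hpc₁⟩ : ∃ c₁, c < c₁ ∧ p c₁ = d := by
    have hex : ∃ l, c < l ∧ (D.tileAt l d).south = true := by
      refine ⟨n - 1, ?_, south_last hd (by omega)⟩
      by_contra hcon
      rw [south_last hd (by omega)] at hs
      simp at hs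
    obtain ⟨c₁, ⟨h1, h2⟩, hmin⟩ := Nat.findX hex
    have hc₁ : c₁ < n := by
      by_contra hcon
      rw [tileAt, dif_neg (by omega)] at h2
      simp [Tile.south] at h2
    refine ⟨c₁, h1, ?_⟩
    have h3 : (D.tileAt c₁ d).north = false := by
      obtain ⟨l, rfl⟩ : ∃ l, c₁ = l + 1 := ⟨c₁ - 1, by omega⟩
      rw [← south_eq_north hc₁ hd]
      by_cases hl : l = c
      · rw [hl, hs]
      · have := hmin l (by omega)
        rw [not_and, Bool.not_eq_true] at this
        exact this (by omega)
    have h4 : D.tileAt c₁ d = .rtile := by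
      cases ht : D.tileAt c₁ d <;> rw [ht] at h2 h3 <;> simp [Tile.north, Tile.south] at h2 h3
    rw [← hp c₁ hc₁]
    exact exitLabel_of_rtile hjreg h1.le hc₁ le_rfl hd h4
      fun b hb => hj c₁ b h1.le (by omega) (by omega)
  obtain ⟨a, b, hab, hbx, hpab, hpa⟩ := exists_inversion_of_cross hp (show x < n by omega)
    (show y < n by omega) hcross
  have hbc : b ≠ c := by rintro rfl; omega
  have had : p a ≠ d := by
    intro h
    have := p.injective (h.trans hpc₁.symm)
    omega
  exact h2143 a b c c₁ hab (by omega) hc₁ hpab (by omega) (by omega)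

end BPD

/-! ### Bumpless pipe dreams and alternating sign matrices -/

lemma Tile.ext_edges {t t' : Tile} (hn : t.north = t'.north) (hs : t.south = t'.south)
    (hw : t.west = t'.west) (he : t.east = t'.east) : t = t' := by
  cases t <;> cases t' <;> simp_all [Tile.north, Tile.south, Tile.west, Tile.east]

namespace BPD

variable {n : ℕ} {D D' : BPD n} {i j k : ℕ}

lemma ext_tileAt (h : ∀ i < n, ∀ j < n, D.tileAt i j = D'.tileAt i j) : D = D' := by
  have : D.tile = D'.tile := by
    funext i j
    rw [← tileAt_coe, ← tileAt_coe]
    exact h i i.2 j j.2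
  cases D; cases D'; simp_all

/-- Whether a pipe crosses the horizontal segment to the north of the cell `(i, j)`. -/
def northEdge (D : BPD n) (j : ℕ) : ℕ → Bool
  | 0 => false
  | i + 1 => (D.tileAt i j).south

lemma northEdge_eq (hi : i < n) (hj : j < n) : D.northEdge j i = (D.tileAt i j).north := by
  rcases i with - | i
  · exact (north_zero hj).symm
  · exact south_eq_north hi hj

lemma northEdge_end (hj : j < n) : D.northEdge j n = true := by
  obtain ⟨k, rfl⟩ : ∃ k, n = k + 1 := ⟨n - 1, by omega⟩
  exact south_last hj rfl

lemma toMatrix_eq_row (i j : Fin n) :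
    D.toMatrix i j = (D.westEdge i (j + 1)).toNat - (D.westEdge i j).toNat := by
  rw [westEdge_eq i.2 j.2, westEdge, toMatrix, ← tileAt_coe]
  cases D.tileAt i j <;> simp [Tile.east, Tile.west]

lemma toMatrix_eq_col (i j : Fin n) :
    D.toMatrix i j = (D.northEdge j (i + 1)).toNat - (D.northEdge j i).toNat := by
  rw [northEdge_eq i.2 j.2, northEdge, toMatrix, ← tileAt_coe]
  cases D.tileAt i j <;> simp [Tile.south, Tile.north]

/-- The nonzero increments of a `0`-`1`-sequence alternate in sign. -/
lemma alternate_of_increments {e : ℕ → Bool} {a : ℕ → ℤ}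
    (ha : ∀ k, a k = (e (k + 1)).toNat - (e k).toNat) {j j' : ℕ} (hjj : j < j') (h : a j ≠ 0)
    (h' : a j' ≠ 0) (hz : ∀ k, j < k → k < j' → a k = 0) : a j' = - a j := by
  have key : ∀ k, j + 1 ≤ k → k ≤ j' → e k = e (j + 1) := by
    intro k hk
    induction k, hk using Nat.le_induction with
    | base => exact fun _ => rfl
    | succ k hk ih =>
      intro hkj
      have h1 := hz k hk (by omega)
      rw [ha] at h1
      rw [← ih (by omega)]
      cases h2 : e (k + 1) <;> cases h3 : e k <;> rw [h2, h3] at h1 <;> simp at h1 ⊢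
  rw [ha] at h h' ⊢
  rw [ha]
  rw [key j' hjj le_rfl] at h' ⊢
  cases h1 : e (j + 1) <;> cases h2 : e (j' + 1) <;> cases h3 : e j <;> simp_all

lemma isASM_toMatrix (D : BPD n) : IsASM D.toMatrix where
  entries i j := by
    rw [toMatrix]
    cases D.tile i j <;> simp
  row_sum i := by
    simp only [toMatrix_eq_row]
    rw [Fin.sum_univ_eq_sum_range
      (fun j => ((D.westEdge i (j + 1)).toNat : ℤ) - (D.westEdge i j).toNat) n,
      Finset.sum_range_sub (fun j => ((D.westEdge i j).toNat : ℤ)), westEdge_end i.2]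
    rfl
  col_sum j := by
    simp only [toMatrix_eq_col]
    rw [Fin.sum_univ_eq_sum_range
      (fun i => ((D.northEdge j (i + 1)).toNat : ℤ) - (D.northEdge j i).toNat) n,
      Finset.sum_range_sub (fun i => ((D.northEdge j i).toNat : ℤ)), northEdge_end j.2]
    rfl
  row_alternate i j j' hjj h h' hz := by
    simp only [toMatrix_eq_row] at h h' hz ⊢
    refine alternate_of_increments (e := D.westEdge i) (fun k => rfl) (show j.val < j'.val from hjj)
      h h' ?_
    intro k h1 h2
    exact hz ⟨k, h2.trans j'.2⟩ h1 h2
  col_alternate j i i' hii h h' hz := by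
    simp only [toMatrix_eq_col] at h h' hz ⊢
    refine alternate_of_increments (e := D.northEdge j) (fun k => rfl)
      (show i.val < i'.val from hii) h h' ?_
    intro k h1 h2
    exact hz ⟨k, h2.trans i'.2⟩ h1 h2

lemma toMatrix_injective : Function.Injective (toMatrix : BPD n → _) := by
  intro D D' h
  have hb : ∀ b b' : Bool, (b.toNat : ℤ) = b'.toNat → b = b' := by decide
  have hw : ∀ i < n, ∀ j ≤ n, D.westEdge i j = D'.westEdge i j := by
    intro i hi j
    induction j with
    | zero => exact fun _ => rfl
    | succ j ih =>
      intro hj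
      have h1 := congrFun (congrFun h ⟨i, hi⟩) ⟨j, hj⟩
      rw [toMatrix_eq_row, toMatrix_eq_row] at h1
      simp only [ih (by omega)] at h1
      exact hb _ _ (by omega)
  have hn : ∀ j < n, ∀ i ≤ n, D.northEdge j i = D'.northEdge j i := by
    intro j hj i
    induction i with
    | zero => exact fun _ => rfl
    | succ i ih =>
      intro hi
      have h1 := congrFun (congrFun h ⟨i, hi⟩) ⟨j, hj⟩
      rw [toMatrix_eq_col, toMatrix_eq_col] at h1
      simp only [ih (by omega)] at h1
      exact hb _ _ (by omega)
  refine ext_tileAt fun i hi j hj => Tile.ext_edges ?_ ?_ ?_ ?_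
  · rw [← northEdge_eq hi hj, ← northEdge_eq hi hj, hn j hj i hi.le]
  · exact hn j hj (i + 1) hi
  · rw [← westEdge_eq hi hj, ← westEdge_eq hi hj, hw i hi j hj.le]
  · exact hw i hi (j + 1) hj

/-- A bumpless pipe dream is determined by the positions of its blanks and crossings. -/
lemma ext_of_blank_cross
    (hb : ∀ i < n, ∀ j < n, D.tileAt i j = .blank ↔ D'.tileAt i j = .blank)
    (hc : ∀ i < n, ∀ j < n, D.tileAt i j = .cross ↔ D'.tileAt i j = .cross) : D = D' := by
  refine ext_tileAt ?_
  suffices h : ∀ s i j, i + j = s → i < n → j < n → D.tileAt i j = D'.tileAt i j from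
    fun i hi j hj => h _ i j rfl hi hj
  intro s
  induction s using Nat.strong_induction_on with
  | _ s ih =>
    rintro i j rfl hi hj
    have h1 : (D.tileAt i j).north = (D'.tileAt i j).north := by
      rw [← northEdge_eq hi hj, ← northEdge_eq hi hj]
      rcases i with - | i
      · rfl
      · rw [northEdge, northEdge, ih (i + j) (by omega) i j rfl (by omega) hj]
    have h2 : (D.tileAt i j).west = (D'.tileAt i j).west := by
      rw [← westEdge_eq hi hj, ← westEdge_eq hi hj]
      rcases j with - | j
      · rfl
      · rw [westEdge, westEdge, ih (i + j) (by omega) i j rfl hi (by omega)]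
    have h3 := hb i hi j hj
    have h4 := hc i hi j hj
    revert h1 h2 h3 h4
    cases D.tileAt i j <;> cases D'.tileAt i j <;> simp [Tile.north, Tile.west]

lemma mem_blanks : (i, j) ∈ D.blanks ↔ i < n ∧ j < n ∧ D.tileAt i j = .blank := by
  constructor
  · rintro ⟨a, b, h1, h2⟩
    obtain ⟨rfl, rfl⟩ := Prod.mk.inj h1
    exact ⟨a.2, b.2, by rw [tileAt_coe, h2]⟩
  · rintro ⟨hi, hj, h⟩
    exact ⟨⟨i, hi⟩, ⟨j, hj⟩, rfl, by rw [← h, D.tileAt_of_lt hi hj]⟩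

/-! ### The Rothe bumpless pipe dream -/

/-- A bumpless pipe dream given by a tile at every cell of `ℕ × ℕ`. -/
def ofTileAt (n : ℕ) (t : ℕ → ℕ → Tile)
    (hv : ∀ i j, i + 1 < n → j < n → (t i j).south = (t (i + 1) j).north)
    (hh : ∀ i j, i < n → j + 1 < n → (t i j).east = (t i (j + 1)).west)
    (hn : ∀ j < n, (t 0 j).north = false) (hw : ∀ i < n, (t i 0).west = false)
    (hs : ∀ i j, i + 1 = n → j < n → (t i j).south = true)
    (he : ∀ i j, i < n → j + 1 = n → (t i j).east = true) : BPD n where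
  tile i j := t i j
  vertical i i' j h := by rw [h]; exact hv i j (h ▸ i'.2) j.2
  horizontal i j j' h := by rw [h]; exact hh i j i.2 (h ▸ j'.2)
  north_border i j h := by rw [h]; exact hn j j.2
  west_border i j h := by rw [h]; exact hw i i.2
  south_border i j h := hs i j h j.2
  east_border i j h := he i j i.2 h

lemma tileAt_ofTileAt {t : ℕ → ℕ → Tile} {hv hh hn hw hs he} (hi : i < n) (hj : j < n) :
    (ofTileAt n t hv hh hn hw hs he).tileAt i j = t i j := by
  rw [tileAt_of_lt _ hi hj]; rfl

/-- The tile at a cell of the Rothe bumpless pipe dream. -/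
def rotheTile (p : Equiv.Perm ℕ) (i j : ℕ) : Tile :=
  if p i = j then .rtile
  else if j < p i then (if p.symm j < i then .vert else .blank)
  else (if p.symm j < i then .cross else .horiz)

lemma rotheTile_edges (p : Equiv.Perm ℕ) (i j : ℕ) :
    ((rotheTile p i j).north = true ↔ p.symm j < i) ∧
    ((rotheTile p i j).south = true ↔ p.symm j ≤ i) ∧
    ((rotheTile p i j).west = true ↔ p i < j) ∧
    ((rotheTile p i j).east = true ↔ p i ≤ j) := by
  rw [rotheTile]
  by_cases h1 : p i = j
  · subst h1
    simp [Tile.north, Tile.south, Tile.west, Tile.east]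
  · have h1' : p.symm j ≠ i := by rintro rfl; simp at h1
    rw [if_neg h1]
    split_ifs with h2 h3 h3 <;>
      simp only [Tile.north, Tile.south, Tile.west, Tile.east, Bool.false_eq_true, true_iff,
        false_iff] <;> omega

lemma exitLabel_eq_of_rtile (H : ∀ a b, D.tileAt a b ≠ .jtile) (hi : i < n) (hj : j < n)
    (h : D.tileAt i j = .rtile) : D.exitLabel i = j :=
  exitLabel_of_rtile (c := 0) (d := 0) (fun a b _ _ => H a b) (Nat.zero_le _) hi (Nat.zero_le _) hj h
    (fun b _ => H i b)

lemma exists_isRothe (π : Equiv.Perm (Fin n)) :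
    ∃ R : BPD n, R.IsRothe π ∧ R.HasPerm π ∧ R.blanks = diagram (extPerm π) := by
  set p := extPerm π with hp
  have hb : ∀ b b' : Bool, (b = true ↔ b' = true) → b = b' := by decide
  have hE := rotheTile_edges p
  have hlt : ∀ i, i < n → p i < n := fun i hi => (extPerm_lt_iff π).2 hi
  have hlt' : ∀ i, i < n → p.symm i < n := fun i hi => by
    rw [hp, extPerm_symm]; exact (extPerm_lt_iff _).2 hi
  have hfalse : ∀ b : Bool, ¬ b = true → b = false := by decide
  set R : BPD n := ofTileAt n (rotheTile p)
    (fun i j _ _ => hb _ _ (by rw [(hE i j).2.1, (hE (i + 1) j).1]; omega))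
    (fun i j _ _ => hb _ _ (by rw [(hE i j).2.2.2, (hE i (j + 1)).2.2.1]; omega))
    (fun j _ => hfalse _ (by rw [(hE 0 j).1]; omega))
    (fun i _ => hfalse _ (by rw [(hE i 0).2.2.1]; omega))
    (fun i j hi hj => (hE i j).2.1.2 (by have := hlt' j hj; omega))
    (fun i j hi hj => (hE i j).2.2.2.2 (by have := hlt i hi; omega)) with hR
  have ht : ∀ i < n, ∀ j < n, R.tileAt i j = rotheTile p i j := fun i hi j hj =>
    tileAt_ofTileAt hi hj
  have H : ∀ a b, R.tileAt a b ≠ .jtile := by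
    intro a b h
    by_cases hab : a < n ∧ b < n
    · rw [ht a hab.1 b hab.2, rotheTile] at h
      split_ifs at h
    · rw [tileAt, dif_neg hab] at h
      simp at h
  refine ⟨R, ?_, ?_, ?_⟩
  · funext i j
    rw [toMatrix, ← tileAt_coe, ht i i.2 j j.2, rotheTile, hp, extPerm_coe]
    by_cases h : π i = j
    · simp [h]
    · have h' : (π i).val ≠ j := fun e => h (Fin.ext e)
      rw [if_neg h', if_neg h]
      split_ifs <;> rfl
  · intro i
    refine exitLabel_eq_of_rtile H i.2 (π i).2 ?_
    rw [ht i i.2 _ (π i).2, rotheTile, hp, extPerm_coe, if_pos rfl]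
  · ext ⟨i, j⟩
    rw [mem_blanks, mem_diagram]
    constructor
    · rintro ⟨hi, hj, h⟩
      rw [ht i hi j hj, rotheTile] at h
      split_ifs at h with h1 h2 h3
      refine ⟨h2, lt_of_le_of_ne (not_lt.1 h3) ?_⟩
      rintro rfl
      simp at h1
    · rintro ⟨h1, h2⟩
      have h3 := lt_of_extPerm_inversion π h2 (by rw [← hp]; simpa using h1)
      have hi : i < n := h2.trans h3
      have hj : j < n := h1.trans (hlt i hi)
      refine ⟨hi, hj, ?_⟩
      rw [ht i hi j hj, rotheTile, if_neg (by omega), if_pos h1, if_neg (by omega)]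

/-- A bumpless pipe dream without `j`-tiles is the Rothe bumpless pipe dream of its permutation. -/
lemma isRothe_of_no_jtile {π : Equiv.Perm (Fin n)} (hD : D.HasPerm π)
    (H : ∀ a b, D.tileAt a b ≠ .jtile) : D.IsRothe π := by
  have h1 : ∀ i j : Fin n, D.tile i j = .rtile → π i = j := by
    intro i j h
    apply Fin.ext
    rw [← hD i]
    exact exitLabel_eq_of_rtile H i.2 j.2 (by rw [tileAt_coe, h])
  have h2 : ∀ i j : Fin n, D.tile i j ≠ .jtile := fun i j => by rw [← tileAt_coe]; exact H i j
  funext i j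
  by_cases h : π i = j
  · rw [if_pos h]
    have hsum := D.isASM_toMatrix.row_sum i
    obtain ⟨j', -, hj'⟩ := Finset.exists_ne_zero_of_sum_ne_zero
      (show ∑ j, D.toMatrix i j ≠ 0 by rw [hsum]; exact one_ne_zero)
    have h3 := h2 i j'
    have h4 : D.tile i j' = .rtile := by
      rw [toMatrix] at hj'
      cases ht : D.tile i j' <;> simp_all
    have h5 := h1 i j' h4
    rw [← h, h5, toMatrix, h4]
  · rw [if_neg h, toMatrix]
    have h3 := h2 i j
    have h4 : D.tile i j ≠ .rtile := fun e => h (h1 i j e)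
    cases ht : D.tile i j <;> simp_all

end BPD

/-- The effect of a simple droop on the set of blank cells: a cell moves diagonally to the NW in a
`2 × 2` square whose other cells are not in the set. -/
def DroopStep (X Y : Set (ℕ × ℕ)) : Prop :=
  ∃ i j : ℕ, (i + 1, j + 1) ∈ X ∧ (i, j) ∉ X ∧ (i, j + 1) ∉ X ∧ (i + 1, j) ∉ X ∧
    Y = insert (i, j) (X \ {(i + 1, j + 1)})

namespace BPD

variable {n : ℕ} {D D' : BPD n} {i j k : ℕ}

/-! ### Simple droops -/

/-- `D'` arises from `D` by a simple droop in the `2 × 2` square with NW corner `(i, j)`. -/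
structure DroopAt (D D' : BPD n) (i j : ℕ) : Prop where
  row : i + 1 < n
  col : j + 1 < n
  nw : D.tileAt i j = .rtile
  nw' : D'.tileAt i j = .blank
  se : D.tileAt (i + 1) (j + 1) = .blank
  se' : D'.tileAt (i + 1) (j + 1) = .jtile
  ne : (D.tileAt i (j + 1) = .horiz ∧ D'.tileAt i (j + 1) = .rtile) ∨
    (D.tileAt i (j + 1) = .jtile ∧ D'.tileAt i (j + 1) = .vert)
  sw : (D.tileAt (i + 1) j = .vert ∧ D'.tileAt (i + 1) j = .rtile) ∨
    (D.tileAt (i + 1) j = .jtile ∧ D'.tileAt (i + 1) j = .horiz)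
  other : ∀ a b, ¬ ((a = i ∨ a = i + 1) ∧ (b = j ∨ b = j + 1)) → D'.tileAt a b = D.tileAt a b

lemma simpleDroop_iff : SimpleDroop D D' ↔ ∃ i j, DroopAt D D' i j := by
  constructor
  · rintro ⟨⟨i, hi⟩, ⟨i', hi'⟩, ⟨j, hj⟩, ⟨j', hj'⟩, h1, h2, h3, h4, h5, h6, h7, h8, h9⟩
    simp only at h1 h2
    subst h1 h2
    refine ⟨i, j, hi', hj', ?_, ?_, ?_, ?_, ?_, ?_, ?_⟩
    all_goals try rw [tileAt_of_lt _ (by omega) (by omega)]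
    · exact h3
    · exact h4
    · exact h5
    · exact h6
    · rw [tileAt_of_lt _ (by omega) (by omega)]
      exact h7
    · rw [tileAt_of_lt _ (by omega) (by omega)]
      exact h8
    · intro a b hab
      by_cases hn : a < n ∧ b < n
      · rw [tileAt_of_lt _ hn.1 hn.2, tileAt_of_lt _ hn.1 hn.2]
        apply h9
        simpa [Fin.ext_iff] using hab
      · rw [tileAt, tileAt, dif_neg hn, dif_neg hn]
  · rintro ⟨i, j, h⟩
    refine ⟨⟨i, by have := h.row; omega⟩, ⟨i + 1, h.row⟩, ⟨j, by have := h.col; omega⟩,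
      ⟨j + 1, h.col⟩, rfl, rfl, ?_⟩
    simp only [← tileAt_coe]
    refine ⟨h.nw, h.nw', h.se, h.se', h.ne, h.sw, ?_⟩
    intro a b hab
    apply h.other
    simpa [Fin.ext_iff] using hab

/-- Four tiles can be replaced if the outer sides of the square stay the same. -/
lemma exists_replace (D : BPD n) (hi : i + 1 < n) (hj : j + 1 < n) (a b c d : Tile)
    (h1 : a.north = (D.tileAt i j).north) (h2 : a.west = (D.tileAt i j).west)
    (h3 : b.north = (D.tileAt i (j + 1)).north) (h4 : b.east = (D.tileAt i (j + 1)).east)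
    (h5 : c.west = (D.tileAt (i + 1) j).west) (h6 : c.south = (D.tileAt (i + 1) j).south)
    (h7 : d.south = (D.tileAt (i + 1) (j + 1)).south)
    (h8 : d.east = (D.tileAt (i + 1) (j + 1)).east)
    (h9 : a.south = c.north) (h10 : b.south = d.north) (h11 : a.east = b.west)
    (h12 : c.east = d.west) :
    ∃ D' : BPD n, D'.tileAt i j = a ∧ D'.tileAt i (j + 1) = b ∧ D'.tileAt (i + 1) j = c ∧
      D'.tileAt (i + 1) (j + 1) = d ∧
      ∀ x y, ¬ ((x = i ∨ x = i + 1) ∧ (y = j ∨ y = j + 1)) → D'.tileAt x y = D.tileAt x y := by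
  set t : ℕ → ℕ → Tile := fun x y =>
    if x = i then (if y = j then a else if y = j + 1 then b else D.tileAt x y)
    else if x = i + 1 then (if y = j then c else if y = j + 1 then d else D.tileAt x y)
    else D.tileAt x y with ht
  have t1 : t i j = a := by simp [ht]
  have t2 : t i (j + 1) = b := by simp [ht]
  have t3 : t (i + 1) j = c := by simp [ht]
  have t4 : t (i + 1) (j + 1) = d := by simp [ht]
  have t5 : ∀ x y, ¬ ((x = i ∨ x = i + 1) ∧ (y = j ∨ y = j + 1)) → t x y = D.tileAt x y := by
    intro x y hxy
    simp only [ht]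
    split_ifs <;> first | rfl | omega
  -- the outer sides
  have north : ∀ x y, x ≠ i + 1 → (t x y).north = (D.tileAt x y).north := by
    intro x y hx
    by_cases h : x = i ∧ (y = j ∨ y = j + 1)
    · obtain ⟨rfl, rfl | rfl⟩ := h
      · rw [t1, h1]
      · rw [t2, h3]
    · rw [t5 x y (by omega)]
  have south : ∀ x y, x ≠ i → (t x y).south = (D.tileAt x y).south := by
    intro x y hx
    by_cases h : x = i + 1 ∧ (y = j ∨ y = j + 1)
    · obtain ⟨rfl, rfl | rfl⟩ := h
      · rw [t3, h6]
      · rw [t4, h7]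
    · rw [t5 x y (by omega)]
  have west : ∀ x y, y ≠ j + 1 → (t x y).west = (D.tileAt x y).west := by
    intro x y hx
    by_cases h : (x = i ∨ x = i + 1) ∧ y = j
    · obtain ⟨rfl | rfl, rfl⟩ := h
      · rw [t1, h2]
      · rw [t3, h5]
    · rw [t5 x y (by omega)]
  have east : ∀ x y, y ≠ j → (t x y).east = (D.tileAt x y).east := by
    intro x y hx
    by_cases h : (x = i ∨ x = i + 1) ∧ y = j + 1
    · obtain ⟨rfl | rfl, rfl⟩ := h
      · rw [t2, h4]
      · rw [t4, h8]
    · rw [t5 x y (by omega)]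
  have vert : ∀ x y, x + 1 < n → y < n → (t x y).south = (t (x + 1) y).north := by
    intro x y hx hy
    by_cases h : x = i
    · subst h
      by_cases hy1 : y = j
      · rw [hy1, t1, t3, h9]
      · by_cases hy2 : y = j + 1
        · rw [hy2, t2, t4, h10]
        · rw [t5 x y (by omega), t5 (x + 1) y (by omega), south_eq_north hx hy]
    · rw [south x y h, north (x + 1) y (by omega), south_eq_north hx hy]
  have horiz : ∀ x y, x < n → y + 1 < n → (t x y).east = (t x (y + 1)).west := by
    intro x y hx hy
    have hD : (D.tileAt x y).east = (D.tileAt x (y + 1)).west := by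
      rw [← westEdge_eq hx hy]; rfl
    by_cases h : y = j
    · subst h
      by_cases hx1 : x = i
      · rw [hx1, t1, t2, h11]
      · by_cases hx2 : x = i + 1
        · rw [hx2, t3, t4, h12]
        · rw [t5 x y (by omega), t5 x (y + 1) (by omega), hD]
    · rw [east x y h, west x (y + 1) (by omega), hD]
  refine ⟨ofTileAt n t vert horiz ?_ ?_ ?_ ?_, ?_⟩
  · intro y hy
    rw [north 0 y (by omega), north_zero hy]
  · intro x hx
    rw [west x 0 (by omega), ← westEdge_eq hx (by omega)]
    rfl
  · intro x y hx hy
    rw [south x y (by omega), south_last hy hx]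
  · intro x y hx hy
    rw [east x y (by omega)]
    subst hy
    exact westEdge_end hx
  · rw [tileAt_ofTileAt (by omega) (by omega), tileAt_ofTileAt (by omega) (by omega),
      tileAt_ofTileAt (by omega) (by omega), tileAt_ofTileAt (by omega) (by omega)]
    refine ⟨t1, t2, t3, t4, fun x y hxy => ?_⟩
    by_cases hn : x < n ∧ y < n
    · rw [tileAt_ofTileAt hn.1 hn.2, t5 x y hxy]
    · rw [tileAt, tileAt, dif_neg hn, dif_neg hn]

/-! ### Simple droops preserve the permutation -/

lemma westLabel_congr {a b b' : ℕ} (hbb : b ≤ b') (hw : D.westLabel a b = D'.westLabel a b)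
    (h : ∀ c, b ≤ c → c < b' → D.southLabel a c = D'.southLabel a c ∧
      D.tileAt a c = D'.tileAt a c) : D.westLabel a b' = D'.westLabel a b' := by
  induction b', hbb using Nat.le_induction with
  | base => exact hw
  | succ b' hb ih =>
    rw [westLabel_succ, westLabel_succ, ih fun c h1 h2 => h c h1 (by omega),
      (h b' hb (by omega)).1, (h b' hb (by omega)).2]

lemma southLabel_congr {a b : ℕ} (ha : a + 1 < n)
    (hs : D.southLabel (a + 1) b = D'.southLabel (a + 1) b)
    (hw : D.westLabel (a + 1) b = D'.westLabel (a + 1) b)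
    (ht : D.tileAt (a + 1) b = D'.tileAt (a + 1) b) : D.southLabel a b = D'.southLabel a b := by
  rw [southLabel_eq_topLabel ha, southLabel_eq_topLabel ha, topLabel, topLabel, hs, hw, ht]

namespace DroopAt

variable (h : DroopAt D D' i j)
include h

/-- The labels are the same except on the sides of the cells of the square that the drooping pipe
leaves or newly passes. -/
lemma labels {a : ℕ} (ha : a < n) :
    (∀ b, ¬ (a = i ∧ (b = j ∨ b = j + 1)) → D.southLabel a b = D'.southLabel a b) ∧
    (∀ b, ¬ ((a = i ∨ a = i + 1) ∧ b = j + 1) → D.westLabel a b = D'.westLabel a b) ∧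
    (a = i → D.southLabel i j = D'.southLabel i (j + 1) ∧ D.southLabel i (j + 1) = 0 ∧
      D'.southLabel i j = 0) := by
  have hi := h.row
  have hO : ∀ a b, ¬ ((a = i ∨ a = i + 1) ∧ (b = j ∨ b = j + 1)) →
    D.tileAt a b = D'.tileAt a b := fun a b hab => (h.other a b hab).symm
  -- the labels in a row follow from those below it
  have row : ∀ a, (∀ b, ¬ (a = i ∧ (b = j ∨ b = j + 1)) →
      D.southLabel a b = D'.southLabel a b) →
      (a = i → D.southLabel i j = D'.southLabel i (j + 1)) →
      ∀ b, ¬ ((a = i ∨ a = i + 1) ∧ b = j + 1) → D.westLabel a b = D'.westLabel a b := by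
    intro a hs hx b hb
    rcases le_or_gt b j with hbj | hbj
    · exact westLabel_congr (Nat.zero_le b) rfl fun c _ hc =>
        ⟨hs c (by omega), hO a c (by omega)⟩
    by_cases ha : a = i ∨ a = i + 1
    · have h0 : D.westLabel a j = D'.westLabel a j :=
        westLabel_congr (Nat.zero_le j) rfl fun c _ hc => ⟨hs c (by omega), hO a c (by omega)⟩
      refine westLabel_congr (b := j + 2) (by omega) ?_ fun c hc _ =>
        ⟨hs c (by omega), hO a c (by omega)⟩
      rw [westLabel_succ (D := D), westLabel_succ (D := D')]
      rcases ha with rfl | rfl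
      · rw [westLabel_succ (D := D), westLabel_succ (D := D'), h.nw, h.nw']
        rcases h.ne with ⟨h1, h2⟩ | ⟨h1, h2⟩ <;> rw [h1, h2] <;> simp [eastLabel, hx rfl]
      · rw [h.se, h.se']
        simp [eastLabel]
    · exact westLabel_congr (Nat.zero_le b) rfl fun c _ hc =>
        ⟨hs c (by omega), hO a c (by omega)⟩
  have main : ∀ r, r < n → (∀ b, ¬ (n - 1 - r = i ∧ (b = j ∨ b = j + 1)) →
        D.southLabel (n - 1 - r) b = D'.southLabel (n - 1 - r) b) ∧
      (n - 1 - r = i → D.southLabel i j = D'.southLabel i (j + 1) ∧ D.southLabel i (j + 1) = 0 ∧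
        D'.southLabel i j = 0) := by
    intro r
    induction r with
    | zero =>
      intro _
      refine ⟨fun b _ => ?_, fun e => by omega⟩
      rw [Nat.sub_zero, southLabel_last, southLabel_last]
    | succ r ih =>
      intro hr
      obtain ⟨hs, hx⟩ := ih (by omega)
      obtain ⟨a, ha⟩ : ∃ a, a = n - 1 - (r + 1) := ⟨_, rfl⟩
      have ha1 : n - 1 - r = a + 1 := by omega
      have han : a + 1 < n := by omega
      rw [← ha]
      rw [ha1] at hs hx
      have hw := row (a + 1) hs fun e => (hx e).1
      refine ⟨fun b hb => ?_, ?_⟩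
      · by_cases hb' : a + 1 = i ∧ (b = j ∨ b = j + 1)
        · obtain ⟨hai, hb'⟩ := hb'
          have hwj := hw j (by omega)
          obtain ⟨x1, x2, x3⟩ := hx hai
          have e1 := h.nw
          have e2 := h.nw'
          rw [southLabel_eq_topLabel han, southLabel_eq_topLabel han, topLabel, topLabel]
          rw [← hai] at e1 e2
          rcases hb' with rfl | rfl
          · rw [e1, e2]
            simp [northLabel]
          · have e3 := h.ne
            rw [← hai] at e3 x1
            rw [westLabel_succ (D := D), westLabel_succ (D := D'), e1, e2]
            rcases e3 with ⟨h1, h2⟩ | ⟨h1, h2⟩ <;> rw [h1, h2] <;>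
              simp [northLabel, eastLabel, x1]
        · by_cases hb'' : a + 1 = i + 1 ∧ (b = j ∨ b = j + 1)
          · omega
          · by_cases hb3 : (a + 1 = i ∨ a + 1 = i + 1) ∧ b = j + 1
            · omega
            · exact southLabel_congr han (hs b hb') (hw b hb3) (hO _ _ (by omega))
      · rintro rfl
        have hwj := hw j (by omega)
        have hsj := hs j (by omega)
        rw [southLabel_eq_topLabel han, southLabel_eq_topLabel han, southLabel_eq_topLabel han,
          southLabel_eq_topLabel han, topLabel, topLabel, topLabel, topLabel, h.se, h.se',
          westLabel_succ (D := D), westLabel_succ (D := D')]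
        rcases h.sw with ⟨h1, h2⟩ | ⟨h1, h2⟩ <;> rw [h1, h2] <;>
          simp [northLabel, eastLabel, hwj, hsj]
  have hm := main (n - 1 - a) (by omega)
  rw [show n - 1 - (n - 1 - a) = a by omega] at hm
  exact ⟨hm.1, row a hm.1 fun e => (hm.2 e).1, hm.2⟩

lemma exitLabel_eq {a : ℕ} (ha : a < n) : D.exitLabel a = D'.exitLabel a := by
  have := h.col
  exact (h.labels ha).2.1 n (by omega)

lemma hasPerm_iff {π : Equiv.Perm (Fin n)} : D.HasPerm π ↔ D'.HasPerm π :=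
  forall_congr' fun a => by rw [h.exitLabel_eq a.2]

lemma tileAt_cross_iff {a b : ℕ} : D'.tileAt a b = .cross ↔ D.tileAt a b = .cross := by
  by_cases hab : (a = i ∨ a = i + 1) ∧ (b = j ∨ b = j + 1)
  · obtain ⟨rfl | rfl, rfl | rfl⟩ := hab
    · simp [h.nw, h.nw']
    · rcases h.ne with ⟨h1, h2⟩ | ⟨h1, h2⟩ <;> simp [h1, h2]
    · rcases h.sw with ⟨h1, h2⟩ | ⟨h1, h2⟩ <;> simp [h1, h2]
    · simp [h.se, h.se']
  · rw [h.other a b hab]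

lemma droopStep : DroopStep D.blanks D'.blanks := by
  have hi := h.row
  have hj := h.col
  refine ⟨i, j, ?_, ?_, ?_, ?_, ?_⟩
  · exact mem_blanks.2 ⟨hi, hj, h.se⟩
  · rw [mem_blanks, h.nw]; simp
  · rw [mem_blanks]
    rcases h.ne with ⟨h1, h2⟩ | ⟨h1, h2⟩ <;> rw [h1] <;> simp
  · rw [mem_blanks]
    rcases h.sw with ⟨h1, h2⟩ | ⟨h1, h2⟩ <;> rw [h1] <;> simp
  · ext ⟨a, b⟩
    rw [mem_blanks]
    simp only [Set.mem_insert_iff, Set.mem_sdiff, Set.mem_singleton_iff, Prod.mk.injEq, mem_blanks]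
    by_cases hab : (a = i ∨ a = i + 1) ∧ (b = j ∨ b = j + 1)
    · obtain ⟨rfl | rfl, rfl | rfl⟩ := hab
      · simp [h.nw']; omega
      · rcases h.ne with ⟨h1, h2⟩ | ⟨h1, h2⟩ <;> simp [h1, h2]
      · rcases h.sw with ⟨h1, h2⟩ | ⟨h1, h2⟩ <;> simp [h1, h2]
      · simp [h.se']
    · rw [h.other a b hab]
      constructor
      · intro h1
        exact Or.inr ⟨h1, by omega⟩
      · rintro (h1 | h1)
        · omega
        · exact h1.1

end DroopAt

/-! ### The simple droops of a tame bumpless pipe dream -/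

/-- Every diagonal move of a blank of a tame bumpless pipe dream is a simple droop: the NW corner of the
square is not a crossing, which leaves only an `r`-tile. -/
lemma Tame.exists_droopAt_of_droopStep (hD : D.Tame) {Y : Set (ℕ × ℕ)}
    (h : DroopStep D.blanks Y) : ∃ D' : BPD n, SimpleDroop D D' ∧ D'.blanks = Y := by
  obtain ⟨i, j, h1, h2, h3, h4, h5⟩ := h
  obtain ⟨hi, hj, hse⟩ := mem_blanks.1 h1
  rw [mem_blanks] at h2 h3 h4
  have n1 : D.tileAt i j ≠ .blank := fun e => h2 ⟨by omega, by omega, e⟩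
  have n2 : D.tileAt i (j + 1) ≠ .blank := fun e => h3 ⟨by omega, hj, e⟩
  have n3 : D.tileAt (i + 1) j ≠ .blank := fun e => h4 ⟨hi, by omega, e⟩
  have n4 : D.tileAt i j ≠ .cross := fun e =>
    hD i j (i + 1) (j + 1) (by omega) (by omega) hi hj e (by rw [hse]; rfl) (by rw [hse]; rfl)
  have e1 : (D.tileAt i (j + 1)).south = false := by
    rw [south_eq_north hi hj, hse]; rfl
  have e2 : (D.tileAt (i + 1) j).east = false := by
    have := westEdge_eq (D := D) hi hj
    rw [hse] at this
    exact this
  have e3 : (D.tileAt i j).south = (D.tileAt (i + 1) j).north := south_eq_north hi (by omega)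
  have e4 : (D.tileAt i j).east = (D.tileAt i (j + 1)).west := by
    rw [← westEdge_eq (by omega) hj]; rfl
  have hnw : D.tileAt i j = .rtile := by
    revert n1 n2 n3 n4 e1 e2 e3 e4
    cases D.tileAt i j <;> cases D.tileAt (i + 1) j <;> cases D.tileAt i (j + 1) <;>
      simp [Tile.north, Tile.south, Tile.west, Tile.east]
  obtain ⟨b, hb1, hb2⟩ : ∃ b : Tile, ((D.tileAt i (j + 1) = .horiz ∧ b = .rtile) ∨
      (D.tileAt i (j + 1) = .jtile ∧ b = .vert)) ∧ b.north = (D.tileAt i (j + 1)).north ∧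
      b.east = (D.tileAt i (j + 1)).east ∧ b.south = true ∧ b.west = false := by
    rw [hnw] at e4
    revert n2 e1 e4
    cases D.tileAt i (j + 1) <;> simp [Tile.north, Tile.south, Tile.west, Tile.east]
  obtain ⟨c, hc1, hc2⟩ : ∃ c : Tile, ((D.tileAt (i + 1) j = .vert ∧ c = .rtile) ∨
      (D.tileAt (i + 1) j = .jtile ∧ c = .horiz)) ∧ c.west = (D.tileAt (i + 1) j).west ∧
      c.south = (D.tileAt (i + 1) j).south ∧ c.east = true ∧ c.north = false := by
    rw [hnw] at e3
    revert n3 e2 e3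
    cases D.tileAt (i + 1) j <;> simp [Tile.north, Tile.south, Tile.west, Tile.east]
  obtain ⟨D', t1, t2, t3, t4, t5⟩ := D.exists_replace hi hj .blank b c .jtile
    (by rw [hnw]; rfl) (by rw [hnw]; rfl) hb2.1 hb2.2.1 hc2.1 hc2.2.1 (by rw [hse]; rfl)
    (by rw [hse]; rfl) (by rw [hc2.2.2.2]; rfl) (by rw [hb2.2.2.1]; rfl)
    (by rw [hb2.2.2.2]; rfl) (by rw [hc2.2.2.1]; rfl)
  have hDr : DroopAt D D' i j :=
    ⟨hi, hj, hnw, t1, hse, t4, by rw [t2]; exact hb1, by rw [t3]; exact hc1, t5⟩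
  refine ⟨D', simpleDroop_iff.2 ⟨i, j, hDr⟩, ?_⟩
  obtain ⟨i', j', k1, k2, k3, k4, k5⟩ := hDr.droopStep
  rw [h5]
  -- the two descriptions of the blanks of `D'` agree
  ext ⟨a, b'⟩
  simp only [mem_blanks, Set.mem_insert_iff, Set.mem_sdiff, Set.mem_singleton_iff, Prod.mk.injEq]
  by_cases hab : (a = i ∨ a = i + 1) ∧ (b' = j ∨ b' = j + 1)
  · obtain ⟨rfl | rfl, rfl | rfl⟩ := hab
    · simp [t1]; omega
    · rcases hDr.ne with ⟨g1, g2⟩ | ⟨g1, g2⟩ <;> simp [g1, g2]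
    · rcases hDr.sw with ⟨g1, g2⟩ | ⟨g1, g2⟩ <;> simp [g1, g2]
    · simp [t4]
  · rw [t5 a b' hab]
    constructor
    · intro g1
      exact Or.inr ⟨g1, by omega⟩
    · rintro (g1 | g1)
      · omega
      · exact g1.1

/-- A `j`-tile of a tame bumpless pipe dream that has no other `j`-tile to its NW has been produced
by a simple droop. -/
lemma Tame.exists_droopAt_of_jtile (hD : D.Tame) (hj : ∃ a b, D.tileAt a b = .jtile) :
    ∃ (D₀ : BPD n) (i j : ℕ), DroopAt D₀ D i j := by
  classical
  have hlt : ∀ a b, D.tileAt a b = .jtile → a < n ∧ b < n := by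
    intro a b h
    by_contra hcon
    rw [tileAt, dif_neg hcon] at h
    simp at h
  obtain ⟨⟨x, y⟩, hxy, hmin⟩ := Finset.exists_min_image
    ((Finset.range n ×ˢ Finset.range n).filter fun q => D.tileAt q.1 q.2 = .jtile)
    (fun q => q.1 + q.2) (by
      obtain ⟨a, b, h⟩ := hj
      exact ⟨(a, b), by simp [h, hlt a b h]⟩)
  simp only [Finset.mem_filter, Finset.mem_product, Finset.mem_range] at hxy hmin
  obtain ⟨⟨hx, hy⟩, ht⟩ := hxy
  obtain ⟨i, rfl⟩ : ∃ i, x = i + 1 := by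
    rcases x with - | i
    · have := north_zero (D := D) hy
      rw [ht] at this
      simp [Tile.north] at this
    · exact ⟨i, rfl⟩
  obtain ⟨j, rfl⟩ : ∃ j, y = j + 1 := by
    rcases y with - | j
    · have := westEdge_eq (D := D) hx hy
      rw [ht] at this
      simp [Tile.west, westEdge] at this
    · exact ⟨j, rfl⟩
  have n1 : D.tileAt i j ≠ .jtile := fun e => by
    have := hmin (i, j) ⟨by omega, e⟩
    simp only at this
    omega
  have n2 : D.tileAt i (j + 1) ≠ .cross := fun e =>
    hD i (j + 1) (i + 1) (j + 1) (by omega) (by omega) hx hy e (by rw [ht]; rfl) (by rw [ht]; rfl)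
  have n3 : D.tileAt (i + 1) j ≠ .cross := fun e =>
    hD (i + 1) j (i + 1) (j + 1) (by omega) (by omega) hx hy e (by rw [ht]; rfl) (by rw [ht]; rfl)
  have e1 : (D.tileAt i (j + 1)).south = true := by
    rw [south_eq_north hx hy, ht]; rfl
  have e2 : (D.tileAt (i + 1) j).east = true := by
    have := westEdge_eq (D := D) hx hy
    rw [ht] at this
    exact this
  have e3 : (D.tileAt i j).south = (D.tileAt (i + 1) j).north := south_eq_north hx (by omega)
  have e4 : (D.tileAt i j).east = (D.tileAt i (j + 1)).west := by
    rw [← westEdge_eq (by omega) hy]; rfl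
  have hnw : D.tileAt i j = .blank := by
    revert n1 n2 n3 e1 e2 e3 e4
    cases D.tileAt i j <;> cases D.tileAt (i + 1) j <;> cases D.tileAt i (j + 1) <;>
      simp [Tile.north, Tile.south, Tile.west, Tile.east]
  obtain ⟨b, hb1, hb2⟩ : ∃ b : Tile, ((b = .horiz ∧ D.tileAt i (j + 1) = .rtile) ∨
      (b = .jtile ∧ D.tileAt i (j + 1) = .vert)) ∧ b.north = (D.tileAt i (j + 1)).north ∧
      b.east = (D.tileAt i (j + 1)).east ∧ b.south = false ∧ b.west = true := by
    rw [hnw] at e4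
    revert n2 e1 e4
    cases D.tileAt i (j + 1) <;> simp [Tile.north, Tile.south, Tile.west, Tile.east]
  obtain ⟨c, hc1, hc2⟩ : ∃ c : Tile, ((c = .vert ∧ D.tileAt (i + 1) j = .rtile) ∨
      (c = .jtile ∧ D.tileAt (i + 1) j = .horiz)) ∧ c.west = (D.tileAt (i + 1) j).west ∧
      c.south = (D.tileAt (i + 1) j).south ∧ c.east = false ∧ c.north = true := by
    rw [hnw] at e3
    revert n3 e2 e3
    cases D.tileAt (i + 1) j <;> simp [Tile.north, Tile.south, Tile.west, Tile.east]
  obtain ⟨D₀, t1, t2, t3, t4, t5⟩ := D.exists_replace hx hy .rtile b c .blank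
    (by rw [hnw]; rfl) (by rw [hnw]; rfl) hb2.1 hb2.2.1 hc2.1 hc2.2.1 (by rw [ht]; rfl)
    (by rw [ht]; rfl) (by rw [hc2.2.2.2]; rfl) (by rw [hb2.2.2.1]; rfl)
    (by rw [hb2.2.2.2]; rfl) (by rw [hc2.2.2.1]; rfl)
  exact ⟨D₀, i, j, hx, hy, t1, hnw, t4, ht, by rw [t2]; exact hb1, by rw [t3]; exact hc1,
    fun a b' hab => (t5 a b' hab).symm⟩

lemma rank_le (D : BPD n) : D.rank ≤ ∑ c : Fin n × Fin n, (c.1.val + c.2.val) :=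
  Finset.sum_le_sum_of_subset (Finset.subset_univ _)

/-- Every bumpless pipe dream of a permutation avoiding `2143` arises from the Rothe bumpless pipe
dream by simple droops. -/
lemma HasPerm.exists_isRothe {π : Equiv.Perm (Fin n)} (h2143 : Avoids2143 (extPerm π))
    (hD : D.HasPerm π) : ∃ R : BPD n, R.IsRothe π ∧ ReflTransGen SimpleDroop R D := by
  induction hs : (∑ c : Fin n × Fin n, (c.1.val + c.2.val)) - D.rank using Nat.strong_induction_on
    generalizing D with
  | _ s ih =>
    by_cases hj : ∃ a b, D.tileAt a b = .jtile
    · have hT : D.Tame := tame_of_avoids (p := extPerm π)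
        (fun i hi => by rw [extPerm_of_lt π hi]; exact hD ⟨i, hi⟩) h2143
      obtain ⟨D₀, i, j, h⟩ := hT.exists_droopAt_of_jtile hj
      have hsd : SimpleDroop D₀ D := simpleDroop_iff.2 ⟨i, j, h⟩
      have h1 := hsd.rank_lt
      have h2 := D₀.rank_le
      obtain ⟨R, hR1, hR2⟩ := ih _ (by omega) (h.hasPerm_iff.2 hD) rfl
      exact ⟨R, hR1, hR2.tail hsd⟩
    · push Not at hj
      exact ⟨D, isRothe_of_no_jtile hD hj, .refl⟩

end BPD

/-! ### The bumpless pipe dreams obtained by simple droops -/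

section droop

variable {n : ℕ} {π : Equiv.Perm (Fin n)}

lemma Droop.hasPerm (D : Droop π) : D.1.HasPerm π := by
  obtain ⟨D, R, hR, h⟩ := D
  obtain ⟨R', hR', hperm, -⟩ := BPD.exists_isRothe π
  obtain rfl := BPD.toMatrix_injective (hR.trans hR'.symm)
  show D.HasPerm π
  induction h with
  | refl => exact hperm
  | tail _ h ih =>
    obtain ⟨i, j, h⟩ := BPD.simpleDroop_iff.1 h
    exact h.hasPerm_iff.1 ih

lemma Droop.tame (h2143 : Avoids2143 (extPerm π)) (D : Droop π) : D.1.Tame :=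
  BPD.tame_of_avoids (p := extPerm π)
    (fun i hi => by rw [extPerm_of_lt π hi]; exact D.hasPerm ⟨i, hi⟩) h2143

/-- Simple droops do not change the crossings. So all elements of `droop(π)` have the same crossings,
and the blanks determine the other tiles. -/
lemma Droop.eq_of_blanks {D D' : Droop π} (h : D.1.blanks = D'.1.blanks) : D = D' := by
  apply Subtype.ext
  have hcross : ∀ {R D : BPD n}, ReflTransGen BPD.SimpleDroop R D → ∀ a b,
      D.tileAt a b = .cross ↔ R.tileAt a b = .cross := by
    intro R D h a b
    induction h with
    | refl => rfl
    | tail _ h ih =>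
      obtain ⟨i, j, h⟩ := BPD.simpleDroop_iff.1 h
      rw [h.tileAt_cross_iff, ih]
  obtain ⟨R, hR, hRD⟩ := D.2
  obtain ⟨R', hR', hRD'⟩ := D'.2
  obtain rfl := BPD.toMatrix_injective (hR.trans hR'.symm)
  refine BPD.ext_of_blank_cross ?_ fun i _ j _ => by rw [hcross hRD, hcross hRD']
  intro i hi j hj
  have h1 := Set.ext_iff.1 h (i, j)
  rw [BPD.mem_blanks, BPD.mem_blanks] at h1
  simpa [hi, hj] using h1

/-- The Rothe bumpless pipe dream is the least element of `droop(π)`. -/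
lemma Droop.exists_bot (π : Equiv.Perm (Fin n)) :
    ∃ R : Droop π, R.1.blanks = diagram (extPerm π) ∧ ∀ D, R ≤ D := by
  obtain ⟨R, hR, -, hb⟩ := BPD.exists_isRothe π
  refine ⟨⟨R, R, hR, .refl⟩, hb, fun D => ?_⟩
  obtain ⟨D, R', hR', h⟩ := D
  obtain rfl := BPD.toMatrix_injective (hR.trans hR'.symm)
  exact h

/-- Diagonal moves of the blanks are realized by simple droops. -/
lemma Droop.exists_of_reflTransGen (h2143 : Avoids2143 (extPerm π)) (D : Droop π)
    {Y : Set (ℕ × ℕ)} (h : ReflTransGen DroopStep D.1.blanks Y) :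
    ∃ D' : Droop π, D ≤ D' ∧ D'.1.blanks = Y := by
  induction h with
  | refl => exact ⟨D, le_rfl, rfl⟩
  | tail _ h ih =>
    obtain ⟨D', h1, rfl⟩ := ih
    obtain ⟨E, h2, h3⟩ := (D'.tame h2143).exists_droopAt_of_droopStep h
    obtain ⟨R, hR, hRD⟩ := D'.2
    exact ⟨⟨E, R, hR, hRD.tail h2⟩, h1.trans (ReflTransGen.single h2), h3⟩

lemma Droop.reflTransGen_of_le {D D' : Droop π} (h : D ≤ D') :
    ReflTransGen DroopStep D.1.blanks D'.1.blanks := by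
  have h' : ReflTransGen BPD.SimpleDroop D.1 D'.1 := h
  refine h'.lift BPD.blanks ?_
  intro a b hab
  obtain ⟨i, j, hab⟩ := BPD.simpleDroop_iff.1 hab
  exact hab.droopStep

lemma Droop.le_iff (h2143 : Avoids2143 (extPerm π)) {D D' : Droop π} :
    D ≤ D' ↔ ReflTransGen DroopStep D.1.blanks D'.1.blanks := by
  refine ⟨reflTransGen_of_le, fun h => ?_⟩
  obtain ⟨E, h1, h2⟩ := D.exists_of_reflTransGen h2143 h
  rwa [← Droop.eq_of_blanks h2]

/-- For a permutation avoiding `2143`, the alternating sign matrices of `π` are the matrices of the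
elements of `droop(π)`. -/
lemma exists_asm_equiv_droop (h2143 : Avoids2143 (extPerm π)) :
    ∃ β : ASMOf π ≃ Droop π, ∀ A : ASMOf π, (β A).1.toMatrix = A.1 := by
  have hex : ∀ A : ASMOf π, ∃ D : Droop π, D.1.toMatrix = A.1 := by
    rintro ⟨A, hA, D, rfl, hD⟩
    obtain ⟨R, hR, h⟩ := hD.exists_isRothe h2143
    exact ⟨⟨D, R, hR, h⟩, rfl⟩
  choose f hf using hex
  refine ⟨Equiv.ofBijective f ⟨?_, ?_⟩, hf⟩
  · intro A B h
    apply Subtype.ext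
    rw [← hf, ← hf, h]
  · intro D
    refine ⟨⟨D.1.toMatrix, D.1.isASM_toMatrix, D.1, rfl, D.hasPerm⟩, ?_⟩
    apply Subtype.ext
    exact BPD.toMatrix_injective (hf _)

end droop

/-! ### Labels of the pipes of a pipe dream -/

namespace PD

variable {m : ℕ} (D : PD m)

lemma ext_crosses {D D' : PD m} (h : D.crosses = D'.crosses) : D = D' := by
  cases D; cases D'; simp_all

lemma not_mem_of_lt {i j : ℕ} (h : m < i + j + 2) : (i, j) ∉ D.crosses := by
  intro hc
  have := D.above _ hc
  simp only at this
  omega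

/-- The label of the pipe leaving the cell `(i, j)` to the west. -/
noncomputable def west (i j : ℕ) : ℕ := D.top i (D.nextElbow i j)

lemma exitLabel_eq (i : ℕ) : D.exitLabel i = D.west i 0 := rfl

lemma right_eq (i j : ℕ) : D.right i j = D.west i (j + 1) := rfl

lemma nextElbow_spec (i j : ℕ) :
    j ≤ D.nextElbow i j ∧ (i, D.nextElbow i j) ∉ D.crosses := by
  have : {k | j ≤ k ∧ (i, k) ∉ D.crosses}.Nonempty :=
    ⟨j + m, by omega, D.not_mem_of_lt (by omega)⟩
  exact Nat.sInf_mem this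

lemma nextElbow_le {i j k : ℕ} (h : j ≤ k) (h' : (i, k) ∉ D.crosses) : D.nextElbow i j ≤ k :=
  Nat.sInf_le ⟨h, h'⟩

lemma mem_of_lt_nextElbow {i j k : ℕ} (h : j ≤ k) (h' : k < D.nextElbow i j) :
    (i, k) ∈ D.crosses := by
  by_contra hc
  exact absurd (D.nextElbow_le h hc) (not_le.2 h')

variable {D} {i j k : ℕ}

lemma nextElbow_elbow (h : (i, j) ∉ D.crosses) : D.nextElbow i j = j :=
  le_antisymm (D.nextElbow_le le_rfl h) (D.nextElbow_spec i j).1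

lemma nextElbow_cross (h : (i, j) ∈ D.crosses) : D.nextElbow i j = D.nextElbow i (j + 1) := by
  apply le_antisymm
  · exact D.nextElbow_le ((Nat.le_succ j).trans (D.nextElbow_spec i (j + 1)).1)
      (D.nextElbow_spec i (j + 1)).2
  · apply D.nextElbow_le _ (D.nextElbow_spec i j).2
    rcases Nat.eq_or_lt_of_le (D.nextElbow_spec i j).1 with h1 | h1
    · exact absurd h (by have := (D.nextElbow_spec i j).2; rwa [← h1] at this)
    · exact h1

lemma west_elbow (h : (i, j) ∉ D.crosses) : D.west i j = D.top i j := by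
  rw [west, nextElbow_elbow h]

lemma west_cross (h : (i, j) ∈ D.crosses) : D.west i j = D.west i (j + 1) := by
  rw [west, nextElbow_cross h, west]

lemma top_zero : D.top 0 j = j := rfl

lemma top_succ_cross (h : (i, j) ∈ D.crosses) : D.top (i + 1) j = D.top i j := by
  simp [top, h]

lemma top_succ_elbow (h : (i, j) ∉ D.crosses) : D.top (i + 1) j = D.west i (j + 1) := by
  simp [top, h, west]

lemma le_top (D : PD m) (i j : ℕ) : j ≤ D.top i j := by
  induction i generalizing j with
  | zero => exact le_rfl
  | succ i ih =>
    by_cases h : (i, j) ∈ D.crosses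
    · rw [top_succ_cross h]; exact ih j
    · rw [top_succ_elbow h, west]
      have := (D.nextElbow_spec i (j + 1)).1
      have := ih (D.nextElbow i (j + 1))
      omega

/-- The pipe entering the cell `(i + 1, j)` from the north has come from the north side of the row
above in this column. -/
noncomputable def source (D : PD m) (i j : ℕ) : ℕ :=
  if (i, j) ∈ D.crosses then j else D.nextElbow i (j + 1)

lemma top_succ (D : PD m) (i j : ℕ) : D.top (i + 1) j = D.top i (D.source i j) := by
  by_cases h : (i, j) ∈ D.crosses
  · rw [top_succ_cross h, source, if_pos h]
  · rw [top_succ_elbow h, source, if_neg h, west]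

/-- If two pipes change their order in a row, then they cross in it. -/
lemma source_le (D : PD m) (i : ℕ) {j k : ℕ} (hjk : j < k) (h : D.source i k ≤ D.source i j) :
    (i, k) ∈ D.crosses ∧ D.source i j = D.nextElbow i (k + 1) := by
  by_cases hj : (i, j) ∈ D.crosses
  · exfalso
    rw [source, source, if_pos hj] at h
    split_ifs at h with hk
    · omega
    · have := (D.nextElbow_spec i (k + 1)).1
      omega
  · rw [source, source, if_neg hj] at h
    by_cases hk : (i, k) ∈ D.crosses
    · rw [if_pos hk] at h
      refine ⟨hk, ?_⟩
      rw [source, if_neg hj]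
      have h1 : k ≠ D.nextElbow i (j + 1) := by
        rintro h1
        exact (D.nextElbow_spec i (j + 1)).2 (h1 ▸ hk)
      apply le_antisymm
      · exact D.nextElbow_le (by have := (D.nextElbow_spec i (k + 1)).1; omega)
          (D.nextElbow_spec i (k + 1)).2
      · exact D.nextElbow_le (by omega) (D.nextElbow_spec i (j + 1)).2
    · exfalso
      rw [if_neg hk] at h
      have h1 := D.nextElbow_le (i := i) (j := j + 1) (k := k) hjk hk
      have h2 := (D.nextElbow_spec i (k + 1)).1
      omega

lemma source_injective (D : PD m) (i : ℕ) : Function.Injective (D.source i) := by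
  have key : ∀ j k, j < k → D.source i j ≠ D.source i k := by
    intro j k hjk h
    obtain ⟨hk, h2⟩ := D.source_le i hjk h.ge
    rw [h, source, if_pos hk] at h2
    have := (D.nextElbow_spec i (k + 1)).1
    omega
  intro j k h
  by_contra hne
  rcases lt_or_gt_of_ne hne with h1 | h1
  · exact key _ _ h1 h
  · exact key _ _ h1 h.symm

lemma top_injective (D : PD m) (i : ℕ) : Function.Injective (D.top i) := by
  induction i with
  | zero => exact fun _ _ h => h
  | succ i ih =>
    intro j k h
    rw [top_succ, top_succ] at h
    exact D.source_injective i (ih h)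

/-- A pipe travelling to the west leaves its row through the south or exits. -/
lemma exit_or_top_of_west {v : ℕ} (h : D.west i j = v) :
    D.exitLabel i = v ∨ ∃ k, D.top (i + 1) k = v := by
  induction j with
  | zero => exact Or.inl h
  | succ j ih =>
    by_cases hc : (i, j) ∈ D.crosses
    · exact ih (by rw [west_cross hc, h])
    · exact Or.inr ⟨j, by rw [top_succ_elbow hc, h]⟩

lemma exit_or_top (D : PD m) (i v : ℕ) :
    (∃ i' < i, D.exitLabel i' = v) ∨ ∃ k, D.top i k = v := by
  induction i with
  | zero => exact Or.inr ⟨v, rfl⟩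
  | succ i ih =>
    rcases ih with ⟨i', h1, h2⟩ | ⟨k, hk⟩
    · exact Or.inl ⟨i', by omega, h2⟩
    · by_cases hc : (i, k) ∈ D.crosses
      · exact Or.inr ⟨k, by rw [top_succ_cross hc, hk]⟩
      · rcases exit_or_top_of_west ((west_elbow hc).trans hk) with h | h
        · exact Or.inl ⟨i, by omega, h⟩
        · exact Or.inr h

lemma exists_top_of_top {i i' : ℕ} (h : i ≤ i') (k : ℕ) : ∃ k', D.top i' k = D.top i k' := by
  induction i', h using Nat.le_induction generalizing k with
  | base => exact ⟨k, rfl⟩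
  | succ i' _ ih => rw [top_succ]; exact ih _

lemma exit_ne_top {i' : ℕ} (h : i' < i) (k : ℕ) : D.exitLabel i' ≠ D.top i k := by
  obtain ⟨k', hk'⟩ := exists_top_of_top (D := D) (show i' + 1 ≤ i from h) k
  rw [hk', top_succ, exitLabel]
  intro h
  have h1 := D.top_injective i' h
  rw [source] at h1
  split_ifs at h1 with hc
  · exact (D.nextElbow_spec i' 0).2 (h1 ▸ hc)
  · have := D.nextElbow_le (Nat.zero_le _) hc
    have := (D.nextElbow_spec i' (k' + 1)).1
    omega

/-- In a reduced pipe dream two labels that are not in increasing order belong to pipes that have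
crossed. -/
lemma exists_cross_of_lt (D : PD m) (i : ℕ) {j k : ℕ} (hjk : j < k)
    (h : D.top i k < D.top i j) : ∃ c ∈ D.crosses, c.1 < i ∧
      s(D.top c.1 c.2, D.right c.1 c.2) = s(D.top i j, D.top i k) := by
  induction i generalizing j k with
  | zero =>
    rw [top_zero, top_zero] at h
    omega
  | succ i ih =>
    rw [top_succ, top_succ] at h ⊢
    by_cases hs : D.source i k ≤ D.source i j
    · obtain ⟨h1, h2⟩ := D.source_le i hjk hs
      refine ⟨(i, k), h1, Nat.lt_succ_self i, ?_⟩
      rw [h2, source, if_pos h1, Sym2.eq_swap]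
      rfl
    · obtain ⟨c, h1, h2, h3⟩ := ih (not_le.1 hs) h
      exact ⟨c, h1, by omega, h3⟩

/-- At a cross of a reduced pipe dream the two pipes have not crossed before. -/
lemma IsReduced.top_lt_right (hD : D.IsReduced) (h : (i, j) ∈ D.crosses) :
    D.top i j < D.west i (j + 1) := by
  have h1 : j < D.nextElbow i (j + 1) := (D.nextElbow_spec i (j + 1)).1
  by_contra hcon
  rw [west] at hcon
  have hne : D.top i j ≠ D.top i (D.nextElbow i (j + 1)) := fun e =>
    h1.ne (D.top_injective i e)
  obtain ⟨c, hc1, hc2, hc3⟩ := D.exists_cross_of_lt i h1 (by omega)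
  have := hD c hc1 (i, j) h hc3
  rw [this] at hc2
  simp at hc2

/-! ### Pipe dreams of a permutation of `ℕ` -/

/-- Reduced pipe dreams of a permutation of `ℕ`. -/
structure IsReducedOf (D : PD m) (p : Equiv.Perm ℕ) : Prop where
  reduced : D.IsReduced
  exit : ∀ i, D.exitLabel i = p i

lemma top_of_le (h : m ≤ i + j) : D.top i j = i + j := by
  induction i generalizing j with
  | zero => simp [top_zero]
  | succ i ih =>
    rw [top_succ_elbow (D.not_mem_of_lt (by omega)), west_elbow (D.not_mem_of_lt (by omega)),
      ih (by omega)]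
    omega

lemma hasPerm_iff {σ : Equiv.Perm (Fin m)} :
    D.HasPerm σ ↔ ∀ i, D.exitLabel i = extPerm σ i := by
  constructor
  · intro h i
    by_cases hi : i < m
    · rw [extPerm_of_lt σ hi, ← h ⟨i, hi⟩]
    · rw [extPerm_of_le σ (not_lt.1 hi), exitLabel_eq, west_elbow (D.not_mem_of_lt (by omega)),
        top_of_le (by omega)]
      simp
  · intro h i
    rw [h, extPerm_coe]

lemma isReducedOf_iff {σ : Equiv.Perm (Fin m)} :
    D.IsReducedOf (extPerm σ) ↔ D.IsReduced ∧ D.HasPerm σ :=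
  ⟨fun h => ⟨h.reduced, hasPerm_iff.2 h.exit⟩, fun h => ⟨h.1, hasPerm_iff.1 h.2⟩⟩

/-! ### Transposition -/

/-- The reflection of a pipe dream in the main diagonal. -/
def transpose (D : PD m) : PD m where
  crosses := D.crosses.map (Equiv.prodComm ℕ ℕ).toEmbedding
  above := by
    rintro ⟨a, b⟩ hc
    have := D.above (b, a) (by simpa using hc)
    simp only at this ⊢
    omega

lemma mem_transpose : (i, j) ∈ D.transpose.crosses ↔ (j, i) ∈ D.crosses := by
  simp [transpose]

lemma transpose_transpose (D : PD m) : D.transpose.transpose = D := by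
  apply ext_crosses
  ext ⟨a, b⟩
  rw [mem_transpose, mem_transpose]

section transpose

variable {p : Equiv.Perm ℕ}

/-- The labels of the transposed pipe dream are the rows in which the pipes exit. -/
lemma top_west_transpose (h : ∀ i, D.exitLabel i = p i) (j : ℕ) :
    (∀ i, D.west i j = p (D.transpose.top j i)) ∧
      ∀ i, D.top i j = p (D.transpose.west j i) := by
  have key : ∀ j, (∀ i, D.west i j = p (D.transpose.top j i)) →
      ∀ i, D.top i j = p (D.transpose.west j i) := by
    intro j hj i
    -- follow the column of crosses down to the next elbow
    set k := D.transpose.nextElbow j i with hk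
    have hspec := D.transpose.nextElbow_spec j i
    rw [← hk, mem_transpose] at hspec
    have hcol : ∀ l, i ≤ l → l ≤ k → D.top l j = D.top i j := by
      intro l hl
      induction l, hl using Nat.le_induction with
      | base => exact fun _ => rfl
      | succ l hl ih =>
        intro hlk
        rw [top_succ_cross, ih (by omega)]
        exact mem_transpose.1 (D.transpose.mem_of_lt_nextElbow hl (by omega))
    rw [west, ← hk, ← hj, west_elbow hspec.2, hcol k hspec.1 le_rfl]
  have main : ∀ j i, D.west i j = p (D.transpose.top j i) := by
    intro j
    induction j with
    | zero => exact h
    | succ j ih =>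
      intro i
      by_cases hc : (i, j) ∈ D.crosses
      · rw [← west_cross hc, ih, top_succ_cross (mem_transpose.2 hc)]
      · rw [← top_succ_elbow hc, key j ih, top_succ_elbow (mt mem_transpose.1 hc)]
  exact ⟨main j, key j (main j)⟩

/-- The transpose of a reduced pipe dream is a reduced pipe dream of the inverse permutation. -/
lemma IsReducedOf.transpose (h : D.IsReducedOf p) : D.transpose.IsReducedOf p.symm := by
  refine ⟨?_, ?_⟩
  · have key : ∀ c ∈ D.transpose.crosses, Sym2.map p
        s(D.transpose.top c.1 c.2, D.transpose.right c.1 c.2) =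
          s(D.top c.2 c.1, D.right c.2 c.1) := by
      rintro ⟨j, i⟩ hc
      rw [mem_transpose] at hc
      rw [Sym2.map_mk, right_eq, right_eq]
      simp only
      rw [← (top_west_transpose h.exit j).1, ← (top_west_transpose h.exit j).2, top_succ_cross hc,
        west_cross hc, Sym2.eq_swap]
    rintro ⟨j, i⟩ hc ⟨j', i'⟩ hc' he
    have := congrArg (Sym2.map p) he
    rw [key _ hc, key _ hc'] at this
    have := h.reduced (i, j) (mem_transpose.1 hc) (i', j') (mem_transpose.1 hc') this
    simp only [Prod.mk.injEq] at this ⊢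
    exact this.symm
  · intro j
    rw [exitLabel_eq, Equiv.eq_symm_apply, ← (top_west_transpose h.exit j).2, top_zero]

/-- The row in which a pipe exits is at most the row from which it travels to the west. -/
lemma le_symm_west (h : ∀ i, D.exitLabel i = p i) (i j : ℕ) : i ≤ p.symm (D.west i j) := by
  rw [(top_west_transpose h j).1, Equiv.symm_apply_apply]
  exact le_top _ _ _

lemma IsReducedOf.symm_right_lt (h : D.IsReducedOf p) (hc : (i, j) ∈ D.crosses) :
    p.symm (D.west i (j + 1)) < p.symm (D.top i j) := by
  have h1 := h.transpose.reduced.top_lt_right (mem_transpose.2 hc)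
  rwa [← west_cross hc, (top_west_transpose h.exit j).1, Equiv.symm_apply_apply,
    ← top_succ_cross hc, (top_west_transpose h.exit j).2, Equiv.symm_apply_apply]

/-- Every cross of a reduced pipe dream lies weakly NW of a cell of the diagram. -/
lemma IsReducedOf.exists_diagram (h : D.IsReducedOf p) (hc : (i, j) ∈ D.crosses) :
    ∃ c ∈ diagram p, i ≤ c.1 ∧ j ≤ c.2 := by
  refine ⟨(p.symm (D.west i (j + 1)), D.top i j), ⟨?_, ?_⟩, ?_, le_top _ _ _⟩
  · simpa using h.reduced.top_lt_right hc
  · exact h.symm_right_lt hc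
  · exact le_symm_west h.exit _ _

end transpose

end PD

/-- A simple slide on sets of cells. -/
def SlideStep (X Y : Set (ℕ × ℕ)) : Prop :=
  ∃ i j : ℕ, (i + 1, j) ∈ X ∧ (i, j) ∉ X ∧ (i, j + 1) ∉ X ∧ (i + 1, j + 1) ∉ X ∧
    Y = insert (i, j + 1) (X \ {(i + 1, j)})

namespace PD

variable {m : ℕ} {D D' : PD m} {i j k : ℕ} {p : Equiv.Perm ℕ}

lemma simpleSlide_iff :
    SimpleSlide D D' ↔ SlideStep (D.crosses : Set (ℕ × ℕ)) (D'.crosses : Set (ℕ × ℕ)) := by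
  simp only [SimpleSlide, SlideStep, Finset.mem_coe]
  refine exists_congr fun i => exists_congr fun j => ?_
  rw [← Finset.coe_inj, Finset.coe_insert, Finset.coe_erase]

/-! ### Simple slides preserve the permutation -/

lemma west_congr (hjk : k ≤ j) (hc : ∀ l, k ≤ l → l < j → ((i, l) ∈ D.crosses ↔ (i, l) ∈ D'.crosses))
    (ht : ∀ l, k ≤ l → l < j → D.top i l = D'.top i l) (hw : D.west i j = D'.west i j) :
    D.west i k = D'.west i k := by
  induction j, hjk using Nat.le_induction with
  | base => exact hw
  | succ j hkj ih =>
    refine ih (fun l h1 h2 => hc l h1 (by omega)) (fun l h1 h2 => ht l h1 (by omega)) ?_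
    have hj := hc j hkj (Nat.lt_succ_self j)
    by_cases h : (i, j) ∈ D.crosses
    · rw [west_cross h, west_cross (hj.1 h), hw]
    · rw [west_elbow h, west_elbow (mt hj.2 h), ht j hkj (Nat.lt_succ_self j)]

lemma west_congr_right (hc : ∀ l, k ≤ l → ((i, l) ∈ D.crosses ↔ (i, l) ∈ D'.crosses))
    (ht : ∀ l, k ≤ l → D.top i l = D'.top i l) : D.west i k = D'.west i k := by
  refine west_congr (j := k + m) (Nat.le_add_right k m) (fun l h _ => hc l h)
    (fun l h _ => ht l h) ?_
  rw [west_elbow (D.not_mem_of_lt (by omega)), west_elbow (D'.not_mem_of_lt (by omega)),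
    ht _ (by omega)]

lemma top_succ_congr (hc : (i, j) ∈ D.crosses ↔ (i, j) ∈ D'.crosses)
    (ht : D.top i j = D'.top i j) (hw : D.west i (j + 1) = D'.west i (j + 1)) :
    D.top (i + 1) j = D'.top (i + 1) j := by
  by_cases h : (i, j) ∈ D.crosses
  · rw [top_succ_cross h, top_succ_cross (hc.1 h), ht]
  · rw [top_succ_elbow h, top_succ_elbow (mt hc.2 h), hw]

/-- `D'` arises from `D` by moving the cross at `(i + 1, j)` to `(i, j + 1)`. -/
structure SlideAt (D D' : PD m) (i j : ℕ) : Prop where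
  sw : (i + 1, j) ∈ D.crosses
  nw : (i, j) ∉ D.crosses
  ne : (i, j + 1) ∉ D.crosses
  se : (i + 1, j + 1) ∉ D.crosses
  mem : ∀ c, c ∈ D'.crosses ↔ c = (i, j + 1) ∨ (c ∈ D.crosses ∧ c ≠ (i + 1, j))

lemma simpleSlide_iff_slideAt : SimpleSlide D D' ↔ ∃ i j, SlideAt D D' i j := by
  refine exists_congr fun i => exists_congr fun j => ?_
  constructor
  · rintro ⟨h1, h2, h3, h4, h5⟩
    exact ⟨h1, h2, h3, h4, fun c => by rw [h5]; simp [and_comm]⟩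
  · rintro ⟨h1, h2, h3, h4, h5⟩
    exact ⟨h1, h2, h3, h4, by ext c; rw [h5]; simp [and_comm]⟩

namespace SlideAt

variable (h : SlideAt D D' i j)
include h

lemma mem_iff {a b : ℕ} (h1 : ¬ (a = i ∧ b = j + 1)) (h2 : ¬ (a = i + 1 ∧ b = j)) :
    (a, b) ∈ D.crosses ↔ (a, b) ∈ D'.crosses := by
  rw [h.mem]
  simp only [Prod.mk.injEq, ne_eq]
  tauto

lemma nw' : (i, j) ∉ D'.crosses := by
  rw [← h.mem_iff (by simp) (by simp)]; exact h.nw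

lemma se' : (i + 1, j + 1) ∉ D'.crosses := by
  rw [← h.mem_iff (by simp) (by simp)]; exact h.se

lemma sw' : (i + 1, j) ∉ D'.crosses := by rw [h.mem]; simp

lemma ne' : (i, j + 1) ∈ D'.crosses := by rw [h.mem]; simp

/-- The labels are the same except on the four edges between the four cells of the square. -/
lemma labels (a : ℕ) :
    (∀ b, ¬ (a = i + 1 ∧ (b = j ∨ b = j + 1)) → D.top a b = D'.top a b) ∧
      (∀ b, ¬ ((a = i ∨ a = i + 1) ∧ b = j + 1) → D.west a b = D'.west a b) ∧
      (a = i + 1 → D.top a j = D'.top a (j + 1) ∧ D.top a (j + 1) = D'.top a j) := by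
  induction a with
  | zero =>
    have ht : ∀ b, D.top 0 b = D'.top 0 b := fun b => rfl
    refine ⟨fun b _ => ht b, fun b hb => ?_, fun h => by omega⟩
    by_cases hi : i = 0
    · subst hi
      rcases le_or_gt b j with hbj | hbj
      · refine west_congr hbj (fun l _ _ => h.mem_iff (by omega) (by omega)) (fun l _ _ => ht l) ?_
        rw [west_elbow h.nw, west_elbow h.nw', ht]
      · exact west_congr_right (fun l _ => h.mem_iff (by omega) (by omega)) (fun l _ => ht l)
    · exact west_congr_right (fun l _ => h.mem_iff (by omega) (by omega)) (fun l _ => ht l)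
  | succ a ih =>
    obtain ⟨ht, hw, hx⟩ := ih
    by_cases ha : a = i
    · subst ha
      -- the row below the upper row of the square
      have ht' : ∀ b, D.top a b = D'.top a b := fun b => ht b (by omega)
      have hw2 : D.west a (j + 2) = D'.west a (j + 2) := hw _ (by omega)
      have t1 : ∀ b, ¬ (b = j ∨ b = j + 1) → D.top (a + 1) b = D'.top (a + 1) b := fun b hb =>
        top_succ_congr (h.mem_iff (by omega) (by omega)) (ht' b) (hw _ (by omega))
      have t2 : D.top (a + 1) j = D'.top (a + 1) (j + 1) := by
        rw [top_succ_elbow h.nw, west_elbow h.ne, top_succ_cross h.ne', ht']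
      have t3 : D.top (a + 1) (j + 1) = D'.top (a + 1) j := by
        rw [top_succ_elbow h.ne, top_succ_elbow h.nw', west_cross h.ne', hw2]
      refine ⟨fun b hb => t1 b (by omega), fun b hb => ?_, fun _ => ⟨t2, t3⟩⟩
      rcases le_or_gt b j with hbj | hbj
      · refine west_congr hbj (fun l _ _ => h.mem_iff (by omega) (by omega))
          (fun l _ _ => t1 l (by omega)) ?_
        rw [west_cross h.sw, west_elbow h.se, west_elbow h.sw', t3]
      · exact west_congr_right (fun l _ => h.mem_iff (by omega) (by omega))
          (fun l _ => t1 l (by omega))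
    · have t : ∀ b, D.top (a + 1) b = D'.top (a + 1) b := by
        intro b
        by_cases ha' : a = i + 1
        · subst ha'
          by_cases hb : b = j
          · subst hb
            rw [top_succ_cross h.sw, top_succ_elbow h.sw', west_elbow h.se', (hx rfl).1]
          · by_cases hb' : b = j + 1
            · subst hb'
              rw [top_succ_elbow h.se, top_succ_elbow h.se', hw _ (by omega)]
            · exact top_succ_congr (h.mem_iff (by omega) (by omega)) (ht b (by omega))
                (hw _ (by omega))
        · exact top_succ_congr (h.mem_iff (by omega) (by omega)) (ht b (by omega))
            (hw _ (by omega))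
      refine ⟨fun b _ => t b, fun b hb => ?_, fun e => by omega⟩
      by_cases hi : i = a + 1
      · subst hi
        rcases le_or_gt b j with hbj | hbj
        · refine west_congr hbj (fun l _ _ => h.mem_iff (by omega) (by omega)) (fun l _ _ => t l) ?_
          rw [west_elbow h.nw, west_elbow h.nw', t]
        · exact west_congr_right (fun l _ => h.mem_iff (by omega) (by omega)) (fun l _ => t l)
      · exact west_congr_right (fun l _ => h.mem_iff (by omega) (by omega)) (fun l _ => t l)

lemma exitLabel_eq (a : ℕ) : D.exitLabel a = D'.exitLabel a :=
  (h.labels a).2.1 0 (by omega)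

/-- The pair of pipes at the moving cross does not change. -/
lemma pair_sw : s(D.top (i + 1) j, D.right (i + 1) j) = s(D'.top i (j + 1), D'.right i (j + 1)) := by
  rw [right_eq, right_eq, ((h.labels (i + 1)).2.2 rfl).1, west_elbow h.se,
    ((h.labels (i + 1)).2.2 rfl).2, top_succ_cross h.ne', top_succ_elbow h.nw', west_cross h.ne']

lemma pair {c : ℕ × ℕ} (hc : c ∈ D.crosses) (hne : c ≠ (i + 1, j)) :
    s(D.top c.1 c.2, D.right c.1 c.2) = s(D'.top c.1 c.2, D'.right c.1 c.2) := by
  obtain ⟨a, b⟩ := c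
  have h1 : ¬ (a = i ∧ b = j) := by rintro ⟨rfl, rfl⟩; exact h.nw hc
  have h2 : ¬ (a = i ∧ b = j + 1) := by rintro ⟨rfl, rfl⟩; exact h.ne hc
  have h3 : ¬ (a = i + 1 ∧ b = j + 1) := by rintro ⟨rfl, rfl⟩; exact h.se hc
  have h4 : ¬ (a = i + 1 ∧ b = j) := by rintro ⟨rfl, rfl⟩; exact hne rfl
  simp only [right_eq]
  rw [(h.labels a).1 b (by omega), (h.labels a).2.1 (b + 1) (by omega)]

lemma isReduced_iff : D.IsReduced ↔ D'.IsReduced := by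
  constructor
  · intro hD
    have key : ∀ c ∈ D'.crosses, ∃ d ∈ D.crosses, (c = (i, j + 1) ∧ d = (i + 1, j) ∨
        c = d ∧ d ≠ (i + 1, j)) ∧
        s(D'.top c.1 c.2, D'.right c.1 c.2) = s(D.top d.1 d.2, D.right d.1 d.2) := by
      intro c hc
      rcases (h.mem c).1 hc with rfl | ⟨hc1, hc2⟩
      · exact ⟨_, h.sw, Or.inl ⟨rfl, rfl⟩, h.pair_sw.symm⟩
      · exact ⟨c, hc1, Or.inr ⟨rfl, hc2⟩, (h.pair hc1 hc2).symm⟩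
    intro c hc c' hc' he
    obtain ⟨d, hd, h1, h2⟩ := key c hc
    obtain ⟨d', hd', h1', h2'⟩ := key c' hc'
    have := hD d hd d' hd' (by rw [← h2, ← h2', he])
    subst this
    rcases h1 with ⟨rfl, h3⟩ | ⟨rfl, h3⟩ <;> rcases h1' with ⟨rfl, h4⟩ | ⟨rfl, h4⟩
    · rfl
    · exact absurd h3 h4
    · exact absurd h4 h3
    · rfl
  · intro hD
    have key : ∀ c ∈ D.crosses, ∃ d ∈ D'.crosses, (c = (i + 1, j) ∧ d = (i, j + 1) ∨
        c = d ∧ d ≠ (i, j + 1)) ∧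
        s(D.top c.1 c.2, D.right c.1 c.2) = s(D'.top d.1 d.2, D'.right d.1 d.2) := by
      intro c hc
      by_cases hne : c = (i + 1, j)
      · subst hne
        exact ⟨_, h.ne', Or.inl ⟨rfl, rfl⟩, h.pair_sw⟩
      · exact ⟨c, (h.mem c).2 (Or.inr ⟨hc, hne⟩), Or.inr ⟨rfl, by rintro rfl; exact h.ne hc⟩,
          h.pair hc hne⟩
    intro c hc c' hc' he
    obtain ⟨d, hd, h1, h2⟩ := key c hc
    obtain ⟨d', hd', h1', h2'⟩ := key c' hc'
    have := hD d hd d' hd' (by rw [← h2, ← h2', he])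
    subst this
    rcases h1 with ⟨rfl, h3⟩ | ⟨rfl, h3⟩ <;> rcases h1' with ⟨rfl, h4⟩ | ⟨rfl, h4⟩
    · rfl
    · exact absurd h3 h4
    · exact absurd h4 h3
    · rfl

lemma isReducedOf_iff : D.IsReducedOf p ↔ D'.IsReducedOf p :=
  ⟨fun hD => ⟨h.isReduced_iff.1 hD.1, fun a => by rw [← h.exitLabel_eq, hD.2]⟩,
    fun hD => ⟨h.isReduced_iff.2 hD.1, fun a => by rw [h.exitLabel_eq, hD.2]⟩⟩

end SlideAt

lemma SimpleSlide.isReducedOf_iff (h : SimpleSlide D D') :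
    D.IsReducedOf p ↔ D'.IsReducedOf p := by
  obtain ⟨i, j, h⟩ := simpleSlide_iff_slideAt.1 h
  exact h.isReducedOf_iff

/-! ### Reduced pipe dreams of a permutation that avoids `1432` -/

/-- All crosses are left-justified. -/
def LeftJustified (D : PD m) : Prop :=
  ∀ i j j', j' < j → (i, j) ∈ D.crosses → (i, j') ∈ D.crosses

/-- Weakly NW of every elbow there is a position `(a, p a)`, namely at an elbow with only crosses to
its left and above it. -/
lemma exists_exit_of_elbow (hD : ∀ i, D.exitLabel i = p i) (hc : (i, j) ∉ D.crosses) :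
    ∃ a ≤ i, p a ≤ j := by
  induction hs : i + j using Nat.strong_induction_on generalizing i j with
  | _ s ih =>
    subst hs
    by_cases h1 : ∃ j' < j, (i, j') ∉ D.crosses
    · obtain ⟨j', h1, h2⟩ := h1
      obtain ⟨a, ha, ha'⟩ := ih (i + j') (by omega) h2 rfl
      exact ⟨a, ha, by omega⟩
    by_cases h2 : ∃ i' < i, (i', j) ∉ D.crosses
    · obtain ⟨i', h1, h2⟩ := h2
      obtain ⟨a, ha, ha'⟩ := ih (i' + j) (by omega) h2 rfl
      exact ⟨a, by omega, ha'⟩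
    push Not at h1 h2
    refine ⟨i, le_rfl, ?_⟩
    have hcol : ∀ l ≤ i, D.top l j = j := by
      intro l hl
      induction l with
      | zero => rfl
      | succ l ih' => rw [top_succ_cross (h2 l (by omega)), ih' (by omega)]
    have hrow : ∀ l ≤ j, D.west i (j - l) = D.west i j := by
      intro l hl
      induction l with
      | zero => rfl
      | succ l ih' =>
        rw [west_cross (h1 _ (by omega)), ← ih' (by omega)]
        congr 1
        omega
    have := hrow j le_rfl
    rw [Nat.sub_self, ← PD.exitLabel_eq, hD, west_elbow hc, hcol i le_rfl] at this
    exact this.le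

/-- A reduced pipe dream of a permutation avoiding `1432` that is not left-justified is the result of a
simple slide. In the lowest row in which an elbow is followed by a cross, the cross can be moved
down to the left, past some pairs of crosses; these pairs would yield the pattern `1432`. -/
lemma IsReducedOf.exists_slideAt (hp : Avoids1432 p) (hD : D.IsReducedOf p)
    (hl : ¬ D.LeftJustified) : ∃ (D₀ : PD m) (i j : ℕ), SlideAt D₀ D i j := by
  classical
  have hex : ∃ i j, (i, j) ∉ D.crosses ∧ (i, j + 1) ∈ D.crosses := by
    rw [LeftJustified] at hl
    push Not at hl
    obtain ⟨i, j, j', h1, h2, h3⟩ := hl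
    by_contra hcon
    push Not at hcon
    have : ∀ l, j' ≤ l → (i, l) ∉ D.crosses := by
      intro l hl
      induction l, hl using Nat.le_induction with
      | base => exact h3
      | succ l _ ih => exact hcon i l ih
    exact this j h1.le h2
  -- the lowest row with an elbow followed by a cross
  obtain ⟨i, j, hij, hij', hmax⟩ : ∃ i j, (i, j) ∉ D.crosses ∧ (i, j + 1) ∈ D.crosses ∧
      ∀ a b, i < a → (a, b + 1) ∈ D.crosses → (a, b) ∈ D.crosses := by
    have hS : (D.crosses.filter fun c => ∃ j, c.2 = j + 1 ∧ (c.1, j) ∉ D.crosses).Nonempty := by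
      obtain ⟨i, j, h1, h2⟩ := hex
      exact ⟨(i, j + 1), by simp [h1, h2]⟩
    obtain ⟨⟨i, j'⟩, hc, hmax⟩ := Finset.exists_max_image _ Prod.fst hS
    obtain ⟨hc1, j, rfl, hc2⟩ := Finset.mem_filter.1 hc
    refine ⟨i, j, hc2, hc1, ?_⟩
    intro a b hab h1
    by_contra h2
    have := hmax (a, b + 1) (by simp [h1, h2])
    simp only at this
    omega
  -- the first elbow below the cross
  have hex2 : ∃ k, (i + k + 1, j + 1) ∉ D.crosses := ⟨m, D.not_mem_of_lt (by omega)⟩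
  obtain ⟨k, hk, hkmin⟩ := Nat.findX hex2
  have hcol : ∀ l < k, (i + l + 1, j + 1) ∈ D.crosses := fun l hl => not_not.1 (hkmin l hl)
  have hcol' : ∀ l < k, (i + l + 1, j) ∈ D.crosses := fun l hl =>
    hmax _ _ (by omega) (hcol l hl)
  set b := D.top i (j + 1) with hb
  set e := D.west i (j + 2) with he
  have hw1 : D.west i (j + 1) = e := west_cross hij'
  have htopj : ∀ l ≤ k, D.top (i + l + 1) j = e := by
    intro l hl
    induction l with
    | zero => rw [Nat.add_zero, top_succ_elbow hij, hw1]
    | succ l ih => rw [← Nat.add_assoc, top_succ_cross (hcol' l (by omega)), ih (by omega)]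
  have htopj1 : ∀ l ≤ k, D.top (i + l + 1) (j + 1) = b := by
    intro l hl
    induction l with
    | zero => rw [Nat.add_zero, top_succ_cross hij']
    | succ l ih => rw [← Nat.add_assoc, top_succ_cross (hcol l (by omega)), ih (by omega)]
  -- the lower left corner is an elbow, since two pipes do not cross twice
  have hsw : (i + k + 1, j) ∉ D.crosses := by
    intro hsw
    have := hD.reduced (i, j + 1) hij' (i + k + 1, j) hsw (by
      simp only [right_eq]
      rw [htopj k le_rfl, west_elbow hk, htopj1 k le_rfl, Sym2.eq_swap])
    simp only [Prod.mk.injEq] at this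
    omega
  rcases k with - | k
  · -- a simple slide
    rw [Nat.add_zero] at hsw hk
    refine ⟨⟨insert (i + 1, j) (D.crosses.erase (i, j + 1)), ?_⟩, i, j, ?_⟩
    · intro c hc
      rw [Finset.mem_insert, Finset.mem_erase] at hc
      rcases hc with rfl | ⟨_, hc⟩
      · have := D.above _ hij'
        simp only at this ⊢
        omega
      · exact D.above c hc
    · refine ⟨by simp, by simp [hij], by simp, by simp [hk], ?_⟩
      intro c
      simp only [Finset.mem_insert, Finset.mem_erase, ne_eq]
      by_cases h1 : c = (i, j + 1)
      · simp [h1, hij']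
      · by_cases h2 : c = (i + 1, j)
        · simp [h2, hsw]
        · simp [h1, h2]
  · -- the pattern `1432`
    exfalso
    have c1 := hcol 0 (by omega)
    have c2 := hcol' 0 (by omega)
    have t1 := htopj 0 (by omega)
    have t2 := htopj1 0 (by omega)
    rw [Nat.add_zero] at c1 c2 t1 t2
    set g := D.west (i + 1) (j + 2) with hg
    have hw2 : D.west (i + 1) (j + 1) = g := west_cross c1
    have l1 := hD.reduced.top_lt_right hij'
    have l2 := hD.reduced.top_lt_right c2
    have x1 := hD.symm_right_lt hij'
    have x2 := hD.symm_right_lt c2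
    rw [hw2, t1] at l2 x2
    change b < e at l1
    change p.symm e < p.symm b at x1
    have y := le_symm_west hD.exit (i + 1) (j + 1)
    rw [hw2] at y
    have z : j + 1 ≤ b := le_top _ _ _
    obtain ⟨a, ha, ha'⟩ := exists_exit_of_elbow hD.exit hij
    exact hp a (p.symm g) (p.symm e) (p.symm b) (by omega) x2 x1 (by simp; omega) (by simpa)
      (by simpa)

lemma IsReducedOf.exists_leftJustified (hp : Avoids1432 p) (hD : D.IsReducedOf p) :
    ∃ B : PD m, B.IsReducedOf p ∧ B.LeftJustified ∧ ReflTransGen SimpleSlide B D := by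
  induction hs : (∑ c ∈ D.crosses, c.2) using Nat.strong_induction_on generalizing D with
  | _ s ih =>
    by_cases hl : D.LeftJustified
    · exact ⟨D, hD, hl, .refl⟩
    · obtain ⟨D₀, i, j, h⟩ := hD.exists_slideAt hp hl
      have hlt : ∑ c ∈ D₀.crosses, c.2 < s := by
        have h1 : D.crosses = insert (i, j + 1) (D₀.crosses.erase (i + 1, j)) := by
          ext c; rw [h.mem]; simp [and_comm]
        have h2 := Finset.add_sum_erase D₀.crosses (fun c : ℕ × ℕ => c.2) h.sw
        rw [← hs, h1, Finset.sum_insert (by simp [h.ne])]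
        simp only at h2 ⊢
        omega
      obtain ⟨B, hB1, hB2, hB3⟩ := ih _ hlt (h.isReducedOf_iff.2 hD) rfl
      exact ⟨B, hB1, hB2, hB3.tail (simpleSlide_iff_slideAt.2 ⟨i, j, h⟩)⟩

end PD

/-- The left-justified cells whose number in each row is that of the cells of the diagram. -/
def bottomCells (p : Equiv.Perm ℕ) : Set (ℕ × ℕ) :=
  {c | c.2 < {j | (c.1, j) ∈ diagram p}.ncard}

lemma diagram_row_finite (p : Equiv.Perm ℕ) (i : ℕ) : {j | (i, j) ∈ diagram p}.Finite :=
  (Set.finite_lt_nat (p i)).subset fun _ h => h.1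

namespace PD

variable {m : ℕ} {D D' : PD m} {i j k : ℕ} {p : Equiv.Perm ℕ}

/-! ### The bottom pipe dream -/

lemma LeftJustified.mem_iff (hl : D.LeftJustified) :
    (i, j) ∈ D.crosses ↔ j < D.nextElbow i 0 := by
  constructor
  · intro h
    by_contra hcon
    rw [not_lt] at hcon
    rcases Nat.eq_or_lt_of_le hcon with h1 | h1
    · exact (D.nextElbow_spec i 0).2 (h1 ▸ h)
    · exact (D.nextElbow_spec i 0).2 (hl i j _ h1 h)
  · exact D.mem_of_lt_nextElbow (Nat.zero_le _)

lemma LeftJustified.source_strictMono (hl : D.LeftJustified) (i : ℕ) :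
    StrictMono (D.source i) := by
  intro j k hjk
  by_contra hcon
  obtain ⟨h1, h2⟩ := D.source_le i hjk (not_lt.1 hcon)
  have h3 := hl i k j hjk h1
  rw [source, if_pos h3] at h2
  have := (D.nextElbow_spec i (k + 1)).1
  omega

lemma LeftJustified.top_strictMono (hl : D.LeftJustified) (i : ℕ) : StrictMono (D.top i) := by
  induction i with
  | zero => exact strictMono_id
  | succ i ih =>
    intro j k hjk
    rw [top_succ, top_succ]
    exact ih (hl.source_strictMono i hjk)

/-- In a left-justified pipe dream the labels entering a row are increasing, so the number of crosses
in the row is determined by the label that exits. -/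
lemma LeftJustified.ncard_row (hl : D.LeftJustified) (he : ∀ i' < i, D.exitLabel i' = p i')
    (hk : D.top i k = p i) : {j | (i, j) ∈ diagram p}.ncard = k := by
  have hS : {j | (i, j) ∈ diagram p} = D.top i '' {k' | k' < k} := by
    ext j
    constructor
    · rintro ⟨h1, h2⟩
      rcases D.exit_or_top i j with ⟨i', h3, h4⟩ | ⟨k', rfl⟩
      · rw [he i' h3] at h4
        simp only [← h4, Equiv.symm_apply_apply] at h2
        omega
      · simp only at h1
        rw [← hk] at h1
        exact ⟨k', (hl.top_strictMono i).lt_iff_lt.1 h1, rfl⟩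
    · rintro ⟨k', h1, rfl⟩
      have h2 := hl.top_strictMono i h1
      refine ⟨by rw [← hk]; exact h2, ?_⟩
      simp only
      rcases lt_trichotomy i (p.symm (D.top i k')) with h | h | h
      · exact h
      · exfalso
        rw [Equiv.eq_symm_apply, ← hk] at h
        omega
      · exfalso
        refine exit_ne_top (D := D) h k' ?_
        rw [he _ h]
        simp
  rw [hS, Set.ncard_image_of_injective _ (D.top_injective i), Set.ncard_eq_toFinset_card']
  simp

lemma LeftJustified.crosses_eq (hl : D.LeftJustified) (he : ∀ i, D.exitLabel i = p i) :
    (D.crosses : Set (ℕ × ℕ)) = bottomCells p := by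
  ext ⟨i, j⟩
  have h1 : D.top i (D.nextElbow i 0) = p i := he i
  rw [Finset.mem_coe, hl.mem_iff, bottomCells, Set.mem_ofPred_eq,
    hl.ncard_row (fun i' _ => he i') h1]

lemma LeftJustified.exitLabel_eq (hl : D.LeftJustified)
    (hD : (D.crosses : Set (ℕ × ℕ)) = bottomCells p) (i : ℕ) : D.exitLabel i = p i := by
  induction i using Nat.strong_induction_on with
  | _ i ih =>
    rcases D.exit_or_top i (p i) with ⟨i', h1, h2⟩ | ⟨k, hk⟩
    · rw [ih i' h1] at h2
      exact absurd (p.injective h2) h1.ne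
    · have hn := hl.ncard_row ih hk
      have hk' : D.nextElbow i 0 = k := by
        have : ∀ j, j < D.nextElbow i 0 ↔ j < k := by
          intro j
          rw [← hl.mem_iff, ← Finset.mem_coe, hD, ← hn]
          rfl
        exact le_antisymm (not_lt.1 fun h => lt_irrefl k ((this k).1 h))
          (not_lt.1 fun h => lt_irrefl _ ((this _).2 h))
      rw [exitLabel, hk', hk]

lemma LeftJustified.right_eq_exit (hl : D.LeftJustified) (hc : (i, j) ∈ D.crosses) :
    D.right i j = D.exitLabel i := by
  have hlt := hl.mem_iff.1 hc
  rw [right, exitLabel]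
  congr 1
  apply le_antisymm
  · exact D.nextElbow_le hlt (D.nextElbow_spec i 0).2
  · exact D.nextElbow_le (Nat.zero_le _) (D.nextElbow_spec i (j + 1)).2

lemma LeftJustified.isReduced (hl : D.LeftJustified) : D.IsReduced := by
  have hex : ∀ {i i'}, i < i' → D.exitLabel i ≠ D.exitLabel i' := fun h => exit_ne_top h _
  have key : ∀ i j i' j', (i, j) ∈ D.crosses → (i', j') ∈ D.crosses → i < i' →
      s(D.top i j, D.right i j) ≠ s(D.top i' j', D.right i' j') := by
    intro i j i' j' hc hc' hlt h
    rw [hl.right_eq_exit hc, hl.right_eq_exit hc'] at h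
    have : D.exitLabel i ∈ s(D.top i' j', D.exitLabel i') := by
      rw [← h]; exact Sym2.mem_mk_right _ _
    rcases Sym2.mem_iff.1 this with h | h
    · exact exit_ne_top hlt _ h
    · exact hex hlt h
  rintro ⟨i, j⟩ hc ⟨i', j'⟩ hc' h
  rcases lt_trichotomy i i' with hlt | rfl | hlt
  · exact absurd h (key _ _ _ _ hc hc' hlt)
  · simp only at h
    rw [hl.right_eq_exit hc, hl.right_eq_exit hc', Sym2.congr_left] at h
    rw [D.top_injective i h]
  · exact absurd h.symm (key _ _ _ _ hc' hc hlt)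

lemma IsBottom.crosses_eq {σ : Equiv.Perm (Fin m)} (h : D.IsBottom σ) :
    (D.crosses : Set (ℕ × ℕ)) = bottomCells (extPerm σ) :=
  LeftJustified.crosses_eq h.2.2 (hasPerm_iff.1 h.2.1)

lemma exists_isBottom (σ : Equiv.Perm (Fin m)) :
    ∃ B : PD m, B.IsBottom σ ∧ (B.crosses : Set (ℕ × ℕ)) = bottomCells (extPerm σ) := by
  classical
  have hbound : ∀ i j, (i, j) ∈ bottomCells (extPerm σ) → i + j + 2 ≤ m := by
    intro i j h
    simp only [bottomCells, Set.mem_ofPred_eq] at h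
    have h1 : ∀ j' ∈ {j | (i, j) ∈ diagram (extPerm σ)},
        (extPerm σ).symm j' ∈ (Finset.Ioo i m : Set ℕ) := by
      rintro j' ⟨h1, h2⟩
      simp only at h1 h2
      rw [Finset.mem_coe, Finset.mem_Ioo]
      exact ⟨h2, lt_of_extPerm_inversion σ h2 (by simpa using h1)⟩
    have h2 := Set.ncard_le_ncard_of_injOn _ h1 ((extPerm σ).symm.injective.injOn)
    rw [Set.ncard_coe_finset, Nat.card_Ioo] at h2
    omega
  set B : PD m := ⟨(Finset.range m ×ˢ Finset.range m).filter
    fun c => c ∈ bottomCells (extPerm σ), by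
      rintro ⟨i, j⟩ hc
      exact hbound i j (Finset.mem_filter.1 hc).2⟩ with hB
  have hBc : (B.crosses : Set (ℕ × ℕ)) = bottomCells (extPerm σ) := by
    ext ⟨i, j⟩
    rw [Finset.mem_coe, Finset.mem_filter, and_iff_right_iff_imp]
    intro h
    have := hbound i j h
    simp only [Finset.mem_product, Finset.mem_range]
    omega
  have hl : B.LeftJustified := by
    intro i j j' hjj h
    rw [← Finset.mem_coe, hBc] at h ⊢
    exact lt_trans (show j' < j from hjj) h
  exact ⟨B, ⟨hl.isReduced, hasPerm_iff.2 (hl.exitLabel_eq hBc), hl⟩, hBc⟩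

/-! ### Slides between the bottom and the top pipe dream -/

lemma IsBottom.isReducedOf {σ : Equiv.Perm (Fin m)} (h : D.IsBottom σ) :
    D.IsReducedOf (extPerm σ) := isReducedOf_iff.2 ⟨h.1, h.2.1⟩

lemma isReducedOf_of_reflTransGen (h : ReflTransGen SimpleSlide D D') :
    D.IsReducedOf p ↔ D'.IsReducedOf p := by
  induction h with
  | refl => rfl
  | tail _ h ih => rw [ih, h.isReducedOf_iff]

lemma IsReducedOf.exists_isBottom {σ : Equiv.Perm (Fin m)} (hp : Avoids1432 (extPerm σ))
    (hD : D.IsReducedOf (extPerm σ)) : ∃ B : PD m, B.IsBottom σ ∧ ReflTransGen SimpleSlide B D := by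
  obtain ⟨B, h1, h2, h3⟩ := hD.exists_leftJustified hp
  exact ⟨B, ⟨h1.reduced, hasPerm_iff.2 h1.exit, h2⟩, h3⟩

lemma SimpleSlide.transpose (h : SimpleSlide D D') : SimpleSlide D'.transpose D.transpose := by
  obtain ⟨i, j, h⟩ := simpleSlide_iff_slideAt.1 h
  refine simpleSlide_iff_slideAt.2 ⟨j, i, ?_⟩
  refine ⟨mem_transpose.2 h.ne', mt mem_transpose.1 h.nw', mt mem_transpose.1 h.sw',
    mt mem_transpose.1 h.se', ?_⟩
  rintro ⟨a, b⟩
  rw [mem_transpose, mem_transpose, h.mem]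
  simp only [Prod.mk.injEq, ne_eq]
  constructor
  · intro hc
    by_cases he : b = i + 1 ∧ a = j
    · exact Or.inl ⟨he.2, he.1⟩
    · refine Or.inr ⟨Or.inr ⟨hc, he⟩, ?_⟩
      rintro ⟨rfl, rfl⟩
      exact h.ne hc
  · rintro (⟨rfl, rfl⟩ | ⟨⟨rfl, rfl⟩ | ⟨hc, -⟩, h2⟩)
    · exact h.sw
    · simp at h2
    · exact hc

/-- Every reduced pipe dream of a permutation avoiding `1432` can be slid up to the pipe dream in
which all crosses are top-justified. -/
lemma IsReducedOf.exists_top {σ : Equiv.Perm (Fin m)} (hp : Avoids1432 (extPerm σ))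
    (hD : D.IsReducedOf (extPerm σ)) : ∃ T : PD m,
      (T.crosses : Set (ℕ × ℕ)) = Prod.swap ⁻¹' bottomCells (extPerm σ).symm ∧
      ReflTransGen SimpleSlide D T := by
  obtain ⟨B, h1, h2, h3⟩ := hD.transpose.exists_leftJustified hp.symm
  refine ⟨B.transpose, ?_, ?_⟩
  · ext ⟨i, j⟩
    rw [Finset.mem_coe, mem_transpose, ← Finset.mem_coe, h2.crosses_eq h1.exit]
    rfl
  · have key : ∀ {E F : PD m}, ReflTransGen SimpleSlide E F →
        ReflTransGen SimpleSlide F.transpose E.transpose := by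
      intro E F h
      induction h with
      | refl => exact .refl
      | tail _ h ih => exact ReflTransGen.head h.transpose ih
    simpa [transpose_transpose] using key h3

lemma exists_isReducedOf_top (σ : Equiv.Perm (Fin m)) : ∃ T : PD m, T.IsReducedOf (extPerm σ) ∧
    (T.crosses : Set (ℕ × ℕ)) = Prod.swap ⁻¹' bottomCells (extPerm σ).symm := by
  obtain ⟨B, h1, h2⟩ := PD.exists_isBottom σ.symm
  have h3 := h1.isReducedOf.transpose
  refine ⟨B.transpose, by rwa [extPerm_symm] at h3, ?_⟩
  ext ⟨i, j⟩
  rw [Finset.mem_coe, mem_transpose, ← Finset.mem_coe, h2]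
  rfl

end PD

/-! ### Totally symmetric self-complementary plane partitions and their pipe dreams -/

/-- An initial segment of `ℕ` consists of the numbers below its cardinality. -/
lemma lt_card_filter_range_iff {n : ℕ} {P : ℕ → Prop} [DecidablePred P]
    (hP : ∀ r, P (r + 1) → P r) (hn : ∀ r, P r → r < n) (r : ℕ) :
    r < ((Finset.range n).filter P).card ↔ P r := by
  have hle : ∀ a b, a ≤ b → P b → P a := by
    intro a b hab
    induction b, hab using Nat.le_induction with
    | base => exact id
    | succ b _ ih => exact fun h => ih (hP b h)
  constructor
  · intro h
    by_contra hr
    have hsub : (Finset.range n).filter P ⊆ Finset.range r := by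
      intro a ha
      rw [Finset.mem_filter] at ha
      rw [Finset.mem_range]
      by_contra har
      exact hr (hle r a (by omega) ha.2)
    have := Finset.card_le_card hsub
    rw [Finset.card_range] at this
    omega
  · intro h
    have hsub : Finset.range (r + 1) ⊆ (Finset.range n).filter P := by
      intro a ha
      rw [Finset.mem_range] at ha
      have : P a := hle a r (by omega) h
      exact Finset.mem_filter.2 ⟨Finset.mem_range.2 (hn a this), this⟩
    have := Finset.card_le_card hsub
    rw [Finset.card_range] at this
    omega

namespace TSSCPP

variable {n : ℕ} (T : TSSCPP n)

/-- The lattice point `(i, j, k)` belongs to the plane partition. -/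
def Mem (i j k : ℕ) : Prop := k < T.entry i j

variable {T} {i j k : ℕ}

lemma mem_coe {i j : Fin (2 * n)} : T.Mem i j k ↔ k < T.t i j := by
  simp [Mem, entry]

lemma Mem.lt (h : T.Mem i j k) : i < 2 * n ∧ j < 2 * n ∧ k < 2 * n := by
  rw [Mem, entry] at h
  split_ifs at h with hij
  · exact ⟨hij.1, hij.2, h.trans_le (T.le_box _ _)⟩
  · omega

lemma Mem.swap (h : T.Mem i j k) : T.Mem j i k := by
  obtain ⟨hi, hj, -⟩ := h.lt
  lift i to Fin (2 * n) using hi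
  lift j to Fin (2 * n) using hj
  rw [mem_coe] at h ⊢
  rwa [T.symmetric]

lemma Mem.rotate (h : T.Mem i j k) : T.Mem j k i := by
  obtain ⟨hi, hj, hk⟩ := h.lt
  lift i to Fin (2 * n) using hi
  lift j to Fin (2 * n) using hj
  lift k to Fin (2 * n) using hk
  rw [mem_coe] at h ⊢
  exact T.cyclic i j k h

lemma Mem.mono {i' j' k' : ℕ} (h : T.Mem i j k) (hi' : i' ≤ i) (hj' : j' ≤ j) (hk' : k' ≤ k) :
    T.Mem i' j' k' := by
  obtain ⟨hi, hj, hk⟩ := h.lt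
  have hi1 := hi'.trans_lt hi
  have hj1 := hj'.trans_lt hj
  lift i to Fin (2 * n) using hi
  lift j to Fin (2 * n) using hj
  lift i' to Fin (2 * n) using hi1
  lift j' to Fin (2 * n) using hj1
  rw [mem_coe] at h ⊢
  exact hk'.trans_lt (h.trans_le (T.antitone i' i j' j hi' hj'))

lemma mem_compl (hi : i < 2 * n) (hj : j < 2 * n) (hk : k < 2 * n) :
    T.Mem (2 * n - 1 - i) (2 * n - 1 - j) (2 * n - 1 - k) ↔ ¬ T.Mem i j k := by
  lift i to Fin (2 * n) using hi
  lift j to Fin (2 * n) using hj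
  have e1 : 2 * n - 1 - i.val = i.rev.val := by rw [Fin.val_rev]; omega
  have e2 : 2 * n - 1 - j.val = j.rev.val := by rw [Fin.val_rev]; omega
  rw [e1, e2, mem_coe, mem_coe]
  have h1 := T.self_compl i j
  have h2 := T.le_box i j
  have h3 := T.le_box i.rev j.rev
  omega

lemma ext_mem {T' : TSSCPP n} (h : ∀ i j k, T.Mem i j k ↔ T'.Mem i j k) : T = T' := by
  have ht : T.t = T'.t := by
    funext i j
    apply le_antisymm
    · by_contra hlt
      have := (h i j (T'.t i j)).1 (mem_coe.2 (by omega))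
      rw [mem_coe] at this
      omega
    · by_contra hlt
      have := (h i j (T.t i j)).2 (mem_coe.2 (by omega))
      rw [mem_coe] at this
      omega
  cases T
  cases T'
  simpa using ht

/-- The entries `t_{n, n + y}` are at most `n - 1 - y`: total symmetry takes the point
`(n, n + y, n - 1 - y)` to `(n, n - 1 - y, n + y)`, which dominates its complement
`(n - 1, n - 1 - y, n + y)`. -/
lemma not_mem_domain {y : ℕ} : ¬ T.Mem n (n + y) (n - 1 - y) := by
  intro h
  obtain ⟨h1, h2, h3⟩ := h.lt
  have hc := (mem_compl h1 h2 h3 (T := T)).not.2 (not_not.2 h)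
  apply hc
  refine (h.rotate.rotate.swap.mono
    (i' := 2 * n - 1 - n) (j' := 2 * n - 1 - (n + y)) (k' := 2 * n - 1 - (n - 1 - y)) ?_ ?_ ?_) <;>
    omega

lemma Mem.domain_lt {x y k : ℕ} (h : T.Mem (n + x) (n + y) k) : k + y + 2 ≤ n := by
  by_contra hcon
  exact not_mem_domain (h.mono (by omega) le_rfl (by omega))

lemma lt_diagCount_iff {r k e : ℕ} : r < T.diagCount (k + 1) e ↔ T.Mem (n + r) (n + r + e) k := by
  refine lt_card_filter_range_iff (P := fun r => k + 1 ≤ T.entry (n + r) (n + r + e))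
    (fun r h => ?_) (fun r h => ?_) r
  · exact Mem.mono h (by omega) (by omega) le_rfl
  · have := (Mem.lt h).1
    omega

lemma diagCount_succ_le (k e : ℕ) : T.diagCount (k + 1) (e + 1) ≤ T.diagCount (k + 1) e := by
  by_contra h
  have := lt_diagCount_iff.1 (not_le.1 h)
  have := lt_diagCount_iff.2 (this.mono (j' := n + T.diagCount (k + 1) e + e) le_rfl (by omega) le_rfl)
  omega

lemma diagCount_le_succ (k e : ℕ) : T.diagCount (k + 1) e ≤ T.diagCount (k + 1) (e + 1) + 1 := by
  by_contra h
  have := lt_diagCount_iff.1 (not_le.1 h)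
  have := lt_diagCount_iff.2 (this.mono (i' := n + T.diagCount (k + 1) (e + 1))
    (j' := n + T.diagCount (k + 1) (e + 1) + (e + 1)) (by omega) (by omega) le_rfl)
  omega

lemma diagCount_eq_zero {k e : ℕ} (h : n ≤ k + 1 + e) : T.diagCount (k + 1) e = 0 := by
  by_contra h0
  have := (lt_diagCount_iff (r := 0)).1 (Nat.pos_of_ne_zero h0)
  rw [add_assoc] at this
  have := this.domain_lt
  omega

lemma mem_toPD_crosses {a b : ℕ} : (a, b) ∈ T.toPD.crosses ↔
    a + b + 2 ≤ n ∧ T.diagCount (n - 1 - a - b) a = T.diagCount (n - 1 - a - b) (a + 1) := by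
  refine Finset.mem_filter.trans ?_
  simp only [Finset.mem_product, Finset.mem_range, boolTriangle]
  constructor
  · rintro ⟨-, h, h'⟩
    refine ⟨h, ?_⟩
    rw [show n - (a + 1 + (b + 1) - 1) = n - 1 - a - b by omega,
      show n - (n - (a + 1)) - 1 = a by omega, show n - (n - (a + 1)) = a + 1 by omega] at h'
    by_contra hne
    simp [hne] at h'
  · rintro ⟨h, h'⟩
    refine ⟨by omega, h, ?_⟩
    rw [show n - (a + 1 + (b + 1) - 1) = n - 1 - a - b by omega,
      show n - (n - (a + 1)) - 1 = a by omega, show n - (n - (a + 1)) = a + 1 by omega, if_pos h']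

/-- A totally symmetric self-complementary plane partition is determined by its fundamental
domain. -/
lemma ext_domain {T' : TSSCPP n}
    (h : ∀ r e k, T.Mem (n + r) (n + r + e) k ↔ T'.Mem (n + r) (n + r + e) k) : T = T' := by
  have key : ∀ {T T' : TSSCPP n}, (∀ r e k, T.Mem (n + r) (n + r + e) k →
      T'.Mem (n + r) (n + r + e) k) → ∀ i j k, n ≤ i → n ≤ j → T.Mem i j k → T'.Mem i j k := by
    intro T T' h i j k hi hj hm
    rcases le_total i j with hij | hij
    · have := h (i - n) (j - i) k
      rw [show n + (i - n) = i by omega, show i + (j - i) = j by omega] at this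
      exact this hm
    · have := h (j - n) (i - j) k
      rw [show n + (j - n) = j by omega, show j + (i - j) = i by omega] at this
      exact (this hm.swap).swap
  -- points with at least two large coordinates
  have key' : ∀ {T T' : TSSCPP n}, (∀ r e k, T.Mem (n + r) (n + r + e) k →
      T'.Mem (n + r) (n + r + e) k) → ∀ i j k, (n ≤ i ∧ n ≤ j ∨ n ≤ j ∧ n ≤ k ∨ n ≤ k ∧ n ≤ i) →
      T.Mem i j k → T'.Mem i j k := by
    intro T T' h i j k hc hm
    rcases hc with hc | hc | hc
    · exact key h i j k hc.1 hc.2 hm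
    · exact (key h j k i hc.1 hc.2 hm.rotate).rotate.rotate
    · exact (key h k i j hc.1 hc.2 hm.rotate.rotate).rotate
  -- the complement of a point with at most one large coordinate has at least two of them
  have key'' : ∀ {T T' : TSSCPP n}, (∀ r e k, T.Mem (n + r) (n + r + e) k ↔
      T'.Mem (n + r) (n + r + e) k) → ∀ i j k, T.Mem i j k → T'.Mem i j k := by
    intro T T' h i j k hm
    obtain ⟨hi, hj, hk⟩ := hm.lt
    by_cases hc : n ≤ i ∧ n ≤ j ∨ n ≤ j ∧ n ≤ k ∨ n ≤ k ∧ n ≤ i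
    · exact key' (fun r e k => (h r e k).1) i j k hc hm
    · by_contra hm'
      refine (mem_compl hi hj hk).1 ?_ hm
      exact key' (fun r e k => (h r e k).2) _ _ _ (by omega) ((mem_compl hi hj hk).2 hm')
  exact ext_mem fun i j k => ⟨key'' h i j k, key'' (fun r e k => (h r e k).symm) i j k⟩

/-- The crosses on an antidiagonal tell which steps of a lattice path go to the west, and the diagonal
counts are the numbers of south steps. -/
lemma toPD_injective {T' : TSSCPP n} (h : T.toPD.crosses = T'.toPD.crosses) : T = T' := by
  have hc : ∀ k d, d + k + 1 ≤ n →
      T.diagCount (k + 1) (n - 1 - k - d) = T'.diagCount (k + 1) (n - 1 - k - d) := by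
    intro k d
    induction d with
    | zero => intro _; rw [diagCount_eq_zero (by omega), diagCount_eq_zero (by omega)]
    | succ d ih =>
      intro hd
      have ih' := ih (by omega)
      have hx := Finset.ext_iff.1 h (n - 1 - k - (d + 1), d)
      rw [mem_toPD_crosses, mem_toPD_crosses,
        show n - 1 - (n - 1 - k - (d + 1)) - d = k + 1 by omega,
        show n - 1 - k - (d + 1) + 1 = n - 1 - k - d by omega] at hx
      have h1 := T.diagCount_succ_le k (n - 1 - k - (d + 1))
      have h2 := T.diagCount_le_succ k (n - 1 - k - (d + 1))
      have h3 := T'.diagCount_succ_le k (n - 1 - k - (d + 1))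
      have h4 := T'.diagCount_le_succ k (n - 1 - k - (d + 1))
      rw [show n - 1 - k - (d + 1) + 1 = n - 1 - k - d by omega] at h1 h2 h3 h4
      have h5 : n - 1 - k - (d + 1) + d + 2 ≤ n := by omega
      simp only [h5, true_and] at hx
      omega
  refine ext_domain fun r e k => ?_
  rw [← lt_diagCount_iff, ← lt_diagCount_iff]
  by_cases hke : n ≤ k + 1 + e
  · rw [diagCount_eq_zero hke, diagCount_eq_zero hke]
  · have := hc k (n - 1 - k - e) (by omega)
    rw [show n - 1 - k - (n - 1 - k - e) = e by omega] at this
    rw [this]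

end TSSCPP

/-! ### The pipe dreams that come from plane partitions -/

namespace PD

variable {n : ℕ} {D D' : PD n}

/-- The number of elbows in the rows `≥ e` of the antidiagonal `row + column = n - 1 - k`. If `D` is
the pipe dream of a plane partition, this is the number of south steps that the lattice path of level
`k` has made before it reaches the line `column - row = e`. -/
def elbows (D : PD n) (k e : ℕ) : ℕ :=
  ((Finset.range n).filter fun a => e ≤ a ∧ a + k < n ∧ (a, n - 1 - k - a) ∉ D.crosses).card

/-- The lattice paths with south steps at the elbows do not intersect. -/
def NonIntersecting (D : PD n) : Prop := ∀ k e, D.elbows (k + 1) e ≤ D.elbows k e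

lemma elbows_eq (D : PD n) (k e : ℕ) : D.elbows k e =
    D.elbows k (e + 1) + if e + k < n ∧ (e, n - 1 - k - e) ∉ D.crosses then 1 else 0 := by
  rw [elbows, elbows]
  split_ifs with h
  · rw [← Finset.card_insert_of_notMem (a := e) (by simp)]
    congr 1
    ext a
    simp only [Finset.mem_filter, Finset.mem_range, Finset.mem_insert]
    constructor
    · rintro ⟨h1, h2, h3⟩
      rcases Nat.eq_or_lt_of_le h2 with rfl | h2
      · exact Or.inl rfl
      · exact Or.inr ⟨h1, h2, h3⟩
    · rintro (rfl | ⟨h1, h2, h3⟩)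
      · exact ⟨by omega, le_rfl, h⟩
      · exact ⟨h1, by omega, h3⟩
  · rw [add_zero]
    congr 1
    refine Finset.filter_congr fun a _ => ?_
    constructor
    · rintro ⟨h2, h3⟩
      rcases Nat.eq_or_lt_of_le h2 with rfl | h2
      · exact absurd h3 h
      · exact ⟨h2, h3⟩
    · rintro ⟨h2, h3⟩
      exact ⟨by omega, h3⟩

lemma elbows_le (D : PD n) (k e : ℕ) : D.elbows k e ≤ n - k - e := by
  have : ((Finset.range n).filter fun a => e ≤ a ∧ a + k < n ∧ (a, n - 1 - k - a) ∉ D.crosses) ⊆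
      Finset.Ico e (n - k) := by
    intro a ha
    simp only [Finset.mem_filter] at ha
    rw [Finset.mem_Ico]
    omega
  exact (Finset.card_le_card this).trans (by rw [Nat.card_Ico])

/-- If a cell of a left-justified pipe dream holds an elbow, so does the next cell in its row. -/
lemma LeftJustified.nonIntersecting (h : D.LeftJustified) : D.NonIntersecting := by
  intro k e
  refine Finset.card_le_card fun a ha => ?_
  simp only [Finset.mem_filter] at ha ⊢
  obtain ⟨h1, h2, h3, h4⟩ := ha
  refine ⟨h1, h2, by omega, fun h5 => h4 ?_⟩
  exact h a (n - 1 - k - a) (n - 1 - (k + 1) - a) (by omega) h5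

/-- A simple slide replaces a west step followed by a south step, in the direction of decreasing rows,
by the opposite. The path of the next lower level stays away, since the SE corner of the square holds
an elbow. -/
lemma SimpleSlide.nonIntersecting (hs : SimpleSlide D D') (h : D.NonIntersecting) :
    D'.NonIntersecting := by
  obtain ⟨i, j, h1, h2, h3, h4, h5⟩ := hs
  have hn := D.above _ h1
  simp only at hn
  have hmem : ∀ c, c ≠ (i, j + 1) → c ≠ (i + 1, j) → (c ∈ D'.crosses ↔ c ∈ D.crosses) := by
    intro c hc hc'
    rw [h5]
    simp [hc, hc']
  -- the slide exchanges two adjacent steps of the path of level `m + 1`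
  obtain ⟨m, hm⟩ : ∃ m, m + 1 = n - 2 - i - j := ⟨n - 3 - i - j, by omega⟩
  have other : ∀ k e, k ≠ m + 1 → D'.elbows k e = D.elbows k e := by
    intro k e hk
    rw [elbows, elbows]
    congr 1
    refine Finset.filter_congr fun a ha => ?_
    have : a + k < n → ((a, n - 1 - k - a) ∈ D'.crosses ↔ (a, n - 1 - k - a) ∈ D.crosses) := by
      intro hak
      apply hmem
      all_goals
        rw [ne_eq, Prod.mk.injEq]
        omega
    constructor
    · rintro ⟨g1, g2, g3⟩
      exact ⟨g1, g2, fun g => g3 ((this g2).2 g)⟩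
    · rintro ⟨g1, g2, g3⟩
      exact ⟨g1, g2, fun g => g3 ((this g2).1 g)⟩
  have ge : ∀ e, i + 2 ≤ e → D'.elbows (m + 1) e = D.elbows (m + 1) e := by
    intro e he
    rw [elbows, elbows]
    congr 1
    refine Finset.filter_congr fun a ha => ?_
    have : e ≤ a → ((a, n - 1 - (m + 1) - a) ∈ D'.crosses ↔
        (a, n - 1 - (m + 1) - a) ∈ D.crosses) := by
      intro hak
      apply hmem
      all_goals
        rw [ne_eq, Prod.mk.injEq]
        omega
    constructor
    · rintro ⟨g1, g2, g3⟩
      exact ⟨g1, g2, fun g => g3 ((this g1).2 g)⟩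
    · rintro ⟨g1, g2, g3⟩
      exact ⟨g1, g2, fun g => g3 ((this g1).1 g)⟩
  have e1 : n - 1 - (m + 1) - (i + 1) = j := by omega
  have e0 : n - 1 - (m + 1) - i = j + 1 := by omega
  have D1 : D.elbows (m + 1) (i + 1) = D.elbows (m + 1) (i + 2) := by
    rw [elbows_eq, e1, if_neg (by simp [h1])]
    rfl
  have D1' : D'.elbows (m + 1) (i + 1) = D.elbows (m + 1) (i + 2) + 1 := by
    rw [elbows_eq, e1, ge _ (by omega), if_pos ⟨by omega, by rw [h5]; simp⟩]
  have D0 : D.elbows (m + 1) i = D.elbows (m + 1) (i + 2) + 1 := by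
    rw [elbows_eq, e0, D1, if_pos ⟨by omega, h3⟩]
  have D0' : D'.elbows (m + 1) i = D.elbows (m + 1) (i + 2) + 1 := by
    rw [elbows_eq, e0, D1', if_neg (by rw [h5]; simp)]
  have le : ∀ d, d ≤ i → D'.elbows (m + 1) (i - d) = D.elbows (m + 1) (i - d) := by
    intro d
    induction d with
    | zero => intro _; rw [Nat.sub_zero, D0, D0']
    | succ d ih =>
      intro hd
      rw [elbows_eq, elbows_eq D, show i - (d + 1) + 1 = i - d by omega, ih (by omega)]
      congr 1
      have := hmem (i - (d + 1), n - 1 - (m + 1) - (i - (d + 1)))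
        (by rw [ne_eq, Prod.mk.injEq]; omega) (by rw [ne_eq, Prod.mk.injEq]; omega)
      simp only [this]
  have eq : ∀ e, e ≠ i + 1 → D'.elbows (m + 1) e = D.elbows (m + 1) e := by
    intro e he
    rcases Nat.lt_or_ge e (i + 1) with h | h
    · have := le (i - e) (by omega)
      rwa [show i - (i - e) = e by omega] at this
    · exact ge e (by omega)
  have up : ∀ k e, D.elbows k e ≤ D'.elbows k e := by
    intro k e
    by_cases hk : k = m + 1
    · subst hk
      by_cases he : e = i + 1
      · subst he
        rw [D1, D1']
        omega
      · exact (eq e he).ge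
    · exact (other k e hk).ge
  intro k e
  by_cases hk : k + 1 = m + 1 ∧ e = i + 1
  · obtain ⟨hk, rfl⟩ := hk
    obtain rfl : k = m := by omega
    have g1 := h k (i + 2)
    have g2 : D.elbows k (i + 1) = D.elbows k (i + 2) + 1 := by
      rw [elbows_eq, show n - 1 - k - (i + 1) = j + 1 by omega, if_pos ⟨by omega, h4⟩]
    rw [D1', other k _ (by omega)]
    omega
  · have : D'.elbows (k + 1) e = D.elbows (k + 1) e := by
      by_cases hk' : k + 1 = m + 1
      · rw [hk']
        exact eq e fun he => hk ⟨hk', he⟩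
      · exact other _ e hk'
    rw [this]
    exact (h k e).trans (up k e)

lemma IsReducedOf.nonIntersecting {σ : Equiv.Perm (Fin n)} (hp : Avoids1432 (extPerm σ))
    (h : D.IsReducedOf (extPerm σ)) : D.NonIntersecting := by
  obtain ⟨B, hB, hBD⟩ := h.exists_isBottom hp
  induction hBD with
  | refl => exact LeftJustified.nonIntersecting hB.2.2
  | tail _ hs ih => exact hs.nonIntersecting (ih (hs.isReducedOf_iff.2 h))

end PD

namespace TSSCPP

variable {n : ℕ}

section construction

variable (n) (c : ℕ → ℕ → ℕ)

/-- The lattice point with coordinates `n + x`, `n + y`, `k`, where `k < n`, shall belong to the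
plane partition with diagonal counts `c`. -/
def InDomain (x y k : ℕ) : Prop := min x y < c (k + 1) (max x y - min x y)

/-- At least two coordinates are `≥ n`. -/
def TwoLarge (i j k : ℕ) : Prop := n ≤ i ∧ n ≤ j ∨ n ≤ j ∧ n ≤ k ∨ n ≤ k ∧ n ≤ i

/-- The points with exactly two coordinates `≥ n` of the plane partition with diagonal counts `c`.
No point with three such coordinates belongs to it. -/
def InHalf (i j k : ℕ) : Prop :=
  n ≤ i ∧ n ≤ j ∧ k < n ∧ InDomain c (i - n) (j - n) k ∨
  n ≤ j ∧ n ≤ k ∧ i < n ∧ InDomain c (j - n) (k - n) i ∨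
  n ≤ k ∧ n ≤ i ∧ j < n ∧ InDomain c (k - n) (i - n) j

/-- The points of the plane partition with diagonal counts `c`; those with at most one coordinate
`≥ n` are forced by self-complementarity. -/
def InPartition (i j k : ℕ) : Prop :=
  (i < 2 * n ∧ j < 2 * n ∧ k < 2 * n) ∧
    (InHalf n c i j k ∨ ¬ TwoLarge n i j k ∧
      ¬ InHalf n c (2 * n - 1 - i) (2 * n - 1 - j) (2 * n - 1 - k))

variable {n c} {i j k x y : ℕ}

lemma InDomain.swap (h : InDomain c x y k) : InDomain c y x k := by
  rwa [InDomain, min_comm, max_comm]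

lemma InHalf.rotate (h : InHalf n c i j k) : InHalf n c j k i := by
  rcases h with h | h | h
  · exact Or.inr (Or.inr h)
  · exact Or.inl h
  · exact Or.inr (Or.inl h)

lemma InHalf.swap (h : InHalf n c i j k) : InHalf n c j i k := by
  rcases h with ⟨h1, h2, h3, h4⟩ | ⟨h1, h2, h3, h4⟩ | ⟨h1, h2, h3, h4⟩
  · exact Or.inl ⟨h2, h1, h3, h4.swap⟩
  · exact Or.inr (Or.inr ⟨h2, h1, h3, h4.swap⟩)
  · exact Or.inr (Or.inl ⟨h2, h1, h3, h4.swap⟩)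

lemma InHalf.twoLarge (h : InHalf n c i j k) : TwoLarge n i j k := by
  rcases h with ⟨h1, h2, h3, h4⟩ | ⟨h1, h2, h3, h4⟩ | ⟨h1, h2, h3, h4⟩ <;>
    (rw [TwoLarge]; omega)

lemma InPartition.rotate (h : InPartition n c i j k) : InPartition n c j k i := by
  obtain ⟨⟨h1, h2, h3⟩, h | ⟨h4, h5⟩⟩ := h
  · exact ⟨⟨h2, h3, h1⟩, Or.inl h.rotate⟩
  · exact ⟨⟨h2, h3, h1⟩, Or.inr ⟨by rw [TwoLarge] at h4 ⊢; omega, fun h => h5 h.rotate.rotate⟩⟩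

lemma InPartition.swap (h : InPartition n c i j k) : InPartition n c j i k := by
  obtain ⟨⟨h1, h2, h3⟩, h | ⟨h4, h5⟩⟩ := h
  · exact ⟨⟨h2, h1, h3⟩, Or.inl h.swap⟩
  · exact ⟨⟨h2, h1, h3⟩, Or.inr ⟨by rw [TwoLarge] at h4 ⊢; omega, fun h => h5 h.swap⟩⟩

lemma inPartition_compl (hi : i < 2 * n) (hj : j < 2 * n) (hk : k < 2 * n) :
    InPartition n c i j k ↔
      ¬ InPartition n c (2 * n - 1 - i) (2 * n - 1 - j) (2 * n - 1 - k) := by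
  have e1 : 2 * n - 1 - (2 * n - 1 - i) = i := by omega
  have e2 : 2 * n - 1 - (2 * n - 1 - j) = j := by omega
  have e3 : 2 * n - 1 - (2 * n - 1 - k) = k := by omega
  have hS : TwoLarge n (2 * n - 1 - i) (2 * n - 1 - j) (2 * n - 1 - k) ↔ ¬ TwoLarge n i j k := by
    rw [TwoLarge, TwoLarge]
    omega
  have h1 := InHalf.twoLarge (n := n) (c := c) (i := i) (j := j) (k := k)
  have h2 := InHalf.twoLarge (n := n) (c := c) (i := 2 * n - 1 - i) (j := 2 * n - 1 - j)
    (k := 2 * n - 1 - k)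
  have hbox : 2 * n - 1 - i < 2 * n ∧ 2 * n - 1 - j < 2 * n ∧ 2 * n - 1 - k < 2 * n := by omega
  rw [InPartition, InPartition, e1, e2, e3]
  tauto

variable (h1 : ∀ k e, c (k + 1) e ≤ c k e) (h2 : ∀ k e, c k (e + 1) ≤ c k e)
  (h3 : ∀ k e, c k e ≤ c k (e + 1) + 1) (h4 : ∀ k e, c k e ≤ n - k - e)

include h2 h3 in
lemma InDomain.left (h : InDomain c (x + 1) y k) : InDomain c x y k := by
  rw [InDomain] at h ⊢
  rcases Nat.lt_or_ge x y with hxy | hxy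
  · rw [min_eq_left (by omega), max_eq_right (by omega)] at h ⊢
    have := h3 (k + 1) (y - (x + 1))
    rw [show y - (x + 1) + 1 = y - x by omega] at this
    omega
  · rw [min_eq_right (by omega), max_eq_left (by omega)] at h ⊢
    have := h2 (k + 1) (x - y)
    rw [show x - y + 1 = x + 1 - y by omega] at this
    omega

include h1 in
lemma InDomain.height (h : InDomain c x y (k + 1)) : InDomain c x y k :=
  lt_of_lt_of_le h (h1 _ _)

include h4 in
lemma InDomain.bound (h : InDomain c x y k) : x + k + 2 ≤ n ∧ y + k + 2 ≤ n := by
  have h0 := h.trans_le (h4 _ _)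
  omega

include h1 h2 h3 in
lemma InHalf.pred (h : InHalf n c (i + 1) j k) : InHalf n c i j k ∨ i + 1 = n := by
  rw [or_iff_not_imp_right]
  intro hi
  rcases h with ⟨g1, g2, g3, g4⟩ | ⟨g1, g2, g3, g4⟩ | ⟨g1, g2, g3, g4⟩
  · rw [show i + 1 - n = i - n + 1 by omega] at g4
    exact Or.inl ⟨by omega, g2, g3, g4.left h2 h3⟩
  · exact Or.inr (Or.inl ⟨g1, g2, by omega, g4.height h1⟩)
  · rw [show i + 1 - n = i - n + 1 by omega] at g4
    exact Or.inr (Or.inr ⟨g1, by omega, g3, (g4.swap.left h2 h3).swap⟩)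

include h1 h2 h3 h4 in
lemma InPartition.pred (h : InPartition n c (i + 1) j k) : InPartition n c i j k := by
  obtain ⟨⟨hi, hj, hk⟩, h⟩ := h
  refine ⟨⟨by omega, hj, hk⟩, ?_⟩
  rcases h with h | ⟨hS, h⟩
  · rcases h.pred h1 h2 h3 with h' | rfl
    · exact Or.inl h'
    -- the first coordinate of the point gets small, that of the complementary point large
    right
    rcases h with ⟨g1, g2, g3, g4⟩ | ⟨g1, g2, g3, g4⟩ | ⟨g1, g2, g3, g4⟩
    · have b := g4.bound h4
      refine ⟨by rw [TwoLarge]; omega, ?_⟩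
      rintro (⟨f1, f2, f3, f4⟩ | ⟨f1, f2, f3, f4⟩ | ⟨f1, f2, f3, f4⟩)
      · omega
      · omega
      · have b' := f4.bound h4
        omega
    · omega
    · have b := g4.bound h4
      refine ⟨by rw [TwoLarge]; omega, ?_⟩
      rintro (⟨f1, f2, f3, f4⟩ | ⟨f1, f2, f3, f4⟩ | ⟨f1, f2, f3, f4⟩)
      · have b' := f4.bound h4
        omega
      · omega
      · omega
  · refine Or.inr ⟨by rw [TwoLarge] at hS ⊢; omega, fun h' => ?_⟩
    rw [show 2 * n - 1 - i = 2 * n - 1 - (i + 1) + 1 by omega] at h'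
    rcases h'.pred h1 h2 h3 with h'' | hi'
    · exact h h''
    · rw [TwoLarge] at hS
      rcases h' with ⟨f1, f2, f3, -⟩ | ⟨f1, f2, f3, -⟩ | ⟨f1, f2, f3, -⟩ <;> omega

include h1 h2 h3 h4 in
/-- Numbers are the diagonal counts of a plane partition if they are at most `n - k - e` and decrease in
the level `k` and, by at most one at a time, in the diagonal `e`. -/
lemma exists_diagCount_eq : ∃ T : TSSCPP n, ∀ k e, T.diagCount (k + 1) e = c (k + 1) e := by
  classical
  have pred : ∀ {i j k}, InPartition n c (i + 1) j k → InPartition n c i j k :=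
    fun h => h.pred h1 h2 h3 h4
  have anti : ∀ {i i' j k}, i ≤ i' → InPartition n c i' j k → InPartition n c i j k := by
    intro i i' j k hi
    induction i', hi using Nat.le_induction with
    | base => exact id
    | succ i' _ ih => exact fun h => ih (pred h)
  set t : ℕ → ℕ → ℕ := fun i j => ((Finset.range (2 * n)).filter (InPartition n c i j)).card with ht
  have hlt : ∀ i j k, k < t i j ↔ InPartition n c i j k := fun i j =>
    lt_card_filter_range_iff (fun k h => (pred h.rotate.rotate).rotate) fun k h => h.1.2.2
  have hbox : ∀ i j, t i j ≤ 2 * n := fun i j =>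
    (Finset.card_filter_le _ _).trans (Finset.card_range _).le
  have hle : ∀ i j i' j', (∀ k, InPartition n c i j k → InPartition n c i' j' k) →
      t i j ≤ t i' j' := by
    intro i j i' j' h
    by_contra hcon
    have := (hlt _ _ _).2 (h _ ((hlt _ _ _).1 (not_le.1 hcon)))
    omega
  let T : TSSCPP n :=
    { t := fun i j => t i j
      le_box := fun i j => hbox i j
      antitone := fun i i' j j' hi hj => hle _ _ _ _ fun k h =>
        (anti hj (anti hi h).rotate).rotate.rotate
      symmetric := fun i j => le_antisymm (hle _ _ _ _ fun k h => h.swap)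
        (hle _ _ _ _ fun k h => h.swap)
      cyclic := fun i j k h => (hlt _ _ _).2 ((hlt _ _ _).1 h).rotate
      self_compl := by
        intro i j
        have hc : ∀ k, k < 2 * n → (k < t i j ↔ ¬ 2 * n - 1 - k < t i.rev j.rev) := by
          intro k hk
          rw [hlt, hlt, inPartition_compl i.2 j.2 hk, Fin.val_rev, Fin.val_rev,
            Nat.sub_sub, Nat.sub_sub, add_comm 1, add_comm 1]
        have b1 := hbox i j
        have b2 := hbox i.rev j.rev
        have c1 := hc (t i j)
        have c2 := hc (2 * n - t i.rev j.rev)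
        omega }
  have hmem : ∀ i j k, T.Mem i j k ↔ InPartition n c i j k := by
    intro i j k
    constructor
    · intro h
      obtain ⟨hi, hj, -⟩ := h.lt
      exact (hlt i j k).1 ((mem_coe (i := ⟨i, hi⟩) (j := ⟨j, hj⟩)).1 h)
    · intro h
      exact (mem_coe (i := ⟨i, h.1.1⟩) (j := ⟨j, h.1.2.1⟩)).2 ((hlt i j k).2 h)
  refine ⟨T, fun k e => ?_⟩
  have key : ∀ r, r < T.diagCount (k + 1) e ↔ r < c (k + 1) e := by
    intro r
    rw [lt_diagCount_iff, hmem]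
    have hdom : InDomain c r (r + e) k ↔ r < c (k + 1) e := by
      rw [InDomain, min_eq_left (by omega), max_eq_right (by omega), Nat.add_sub_cancel_left]
    rw [← hdom]
    constructor
    · rintro ⟨-, (⟨g1, g2, g3, g4⟩ | ⟨g1, g2, g3, g4⟩ | ⟨g1, g2, g3, g4⟩) | ⟨g, -⟩⟩
      · rwa [Nat.add_sub_cancel_left, add_assoc, Nat.add_sub_cancel_left] at g4
      · omega
      · omega
      · rw [TwoLarge] at g
        omega
    · intro h
      have b := h.bound h4
      refine ⟨by omega, Or.inl (Or.inl ⟨by omega, by omega, by omega, ?_⟩)⟩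
      rwa [Nat.add_sub_cancel_left, add_assoc, Nat.add_sub_cancel_left]
  by_contra hne
  have := key (T.diagCount (k + 1) e)
  have := key (c (k + 1) e)
  omega

end construction

lemma exists_toPD_crosses_eq {D : PD n} (hD : D.NonIntersecting) :
    ∃ T : TSSCPP n, T.toPD.crosses = D.crosses := by
  obtain ⟨T, hT⟩ := exists_diagCount_eq hD (fun k e => by rw [D.elbows_eq k e]; omega)
    (fun k e => by rw [D.elbows_eq k e]; split_ifs <;> omega) D.elbows_le
  refine ⟨T, ?_⟩
  ext ⟨a, b⟩
  rw [mem_toPD_crosses]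
  by_cases h : a + b + 2 ≤ n
  · rw [show n - 1 - a - b = (n - 2 - a - b) + 1 by omega, hT, hT, PD.elbows_eq,
      show n - 1 - (n - 2 - a - b + 1) - a = b by omega]
    have : a + (n - 2 - a - b + 1) < n := by omega
    simp [h, this]
  · simp only [h, false_and, false_iff]
    exact fun hc => h (D.above _ hc)

end TSSCPP

/-! ### Blocks and corners of the dominant region -/

lemma Avoids2143.symm {p : Equiv.Perm ℕ} (h : Avoids2143 p) : Avoids2143 p.symm := by
  intro a b c d hab hbc hcd h1 h2 h3
  exact h (p.symm b) (p.symm a) (p.symm d) (p.symm c) h1 h2 h3 (by simpa using hab)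
    (by simpa using hbc) (by simpa using hcd)

lemma exists_descent {p : ℕ → ℕ} {a b : ℕ} (hab : a < b) (h : p b < p a) :
    ∃ x, a ≤ x ∧ x < b ∧ p (x + 1) < p x := by
  by_contra! hcon
  have : ∀ x, a ≤ x → x ≤ b → p a ≤ p x := by
    intro x hx
    induction x, hx using Nat.le_induction with
    | base => exact fun _ => le_rfl
    | succ x hx ih => exact fun hxb => (ih (by omega)).trans (hcon x hx (by omega))
  exact absurd (this b hab.le le_rfl) (not_le.2 h)

/-- An occurrence of `1432` gives two descents. -/
lemma IsGrassmannian.avoids1432 {m : ℕ} {σ : Equiv.Perm (Fin m)} (h : IsGrassmannian σ) :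
    Avoids1432 (extPerm σ) := by
  intro a b c d hab hbc hcd _ h2 h3
  have key : ∀ x, extPerm σ (x + 1) < extPerm σ x → ∃ hx : x < m,
      (⟨x, hx⟩ : Fin m) ∈ {i : Fin m | ∃ i' : Fin m, i'.val = i.val + 1 ∧ σ i' < σ i} := by
    intro x hx
    have hx1 := lt_of_extPerm_inversion σ (Nat.lt_succ_self x) hx
    rw [extPerm_of_lt σ hx1, extPerm_of_lt σ (by omega)] at hx
    exact ⟨by omega, ⟨x + 1, hx1⟩, rfl, hx⟩
  obtain ⟨x, hx1, hx2, hx3⟩ := exists_descent hbc h3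
  obtain ⟨y, hy1, hy2, hy3⟩ := exists_descent hcd h2
  obtain ⟨hx, hx'⟩ := key x hx3
  obtain ⟨hy, hy'⟩ := key y hy3
  have := h hx' hy'
  rw [Fin.mk.injEq] at this
  omega

lemma IsInvGrassmannian.avoids1432 {m : ℕ} {σ : Equiv.Perm (Fin m)} (h : IsInvGrassmannian σ) :
    Avoids1432 (extPerm σ) := by
  have := (IsGrassmannian.avoids1432 h).symm
  rwa [extPerm_symm, Equiv.Perm.inv_def, Equiv.symm_symm] at this

/-- If all essential boxes with corner `k` lie in one row, then the columns of the part of the diagram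
with this corner reach down to that row. -/
lemma diagram_down {p : Equiv.Perm ℕ} (hp : Avoids2143 p) {k : ℕ × ℕ} {R : ℕ}
    (hR : ∀ e ∈ essBoxes p, IsCorner p k e → e.1 = R) {x x' j : ℕ} (hx : (x, j) ∈ diagram p)
    (hk : IsCorner p k (x, j)) (hxx : x ≤ x') (hx' : x' ≤ R) : (x', j) ∈ diagram p := by
  induction x', hxx using Nat.le_induction with
  | base => exact hx
  | succ y hxy ih =>
    have hy := ih (by omega)
    by_contra hy1
    have hkd : (y, j) ∉ domRegion p := fun h => hk.not_mem_dom (domRegion_mono h hxy le_rfl)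
    obtain ⟨j', hj', he⟩ := exists_essBox_right hy hy1
    obtain ⟨k', hk'⟩ := exists_isCorner hp hy hkd
    obtain ⟨k'', hk''⟩ := exists_isCorner hp he.1 fun h => hkd (domRegion_mono h le_rfl hj')
    obtain rfl := hk.eq_of_snd hk' rfl
    obtain rfl := hk'.eq_of_fst hk'' rfl
    have := hR _ he hk''
    simp only at this
    omega

/-- The transpose of `diagram_down`. -/
lemma diagram_right {p : Equiv.Perm ℕ} (hp : Avoids2143 p) {k : ℕ × ℕ} {J : ℕ}
    (hJ : ∀ e ∈ essBoxes p, IsCorner p k e → e.2 = J) {i y y' : ℕ} (hy : (i, y) ∈ diagram p)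
    (hk : IsCorner p k (i, y)) (hyy : y ≤ y') (hy' : y' ≤ J) : (i, y') ∈ diagram p := by
  have := diagram_down (p := p.symm) (k := k.swap) (R := J) hp.symm ?_ (mem_diagram_symm.2 hy)
    hk.swap hyy hy'
  · exact mem_diagram_symm.1 this
  · rintro ⟨a, b⟩ he hk'
    exact hJ (b, a) (mem_essBoxes_symm.1 he) hk'.swap

/-- Cells that pairwise lie in the same row or column lie in one row or in one column. -/
lemma aligned_row_or_col {S : Set (ℕ × ℕ)} (h : ∀ e ∈ S, ∀ f ∈ S, e.1 = f.1 ∨ e.2 = f.2) :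
    (∀ e ∈ S, ∀ f ∈ S, e.1 = f.1) ∨ ∀ e ∈ S, ∀ f ∈ S, e.2 = f.2 := by
  by_contra! hcon
  obtain ⟨⟨e, he, f, hf, hef⟩, g, hg, g', hg', hgg⟩ := hcon
  have h1 := h e he f hf
  have h2 := h g hg g' hg'
  have h3 := h g hg e he
  have h4 := h g hg f hf
  have h5 := h g' hg' e he
  have h6 := h g' hg' f hf
  omega

section blocks

variable {n : ℕ} {π : Equiv.Perm (Fin n)}

lemma Block.boxes_nonempty (b : Block π) : b.boxes.Nonempty := by
  obtain ⟨⟨c, h⟩, rfl⟩ := Quot.exists_rep b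
  exact ⟨c, h, rfl⟩

lemma Block.mem_essBoxes {b : Block π} {c : ℕ × ℕ} (h : c ∈ b.boxes) :
    c ∈ essBoxes (extPerm π) := by
  rw [← essential_eq]
  exact h.1.1

lemma finite_rotheDiagram (π : Equiv.Perm (Fin n)) : (rotheDiagram π).Finite := by
  refine ((Finset.range n ×ˢ Finset.range n).finite_toSet).subset ?_
  rintro c ⟨i, j, rfl, -, -⟩
  simp

lemma Block.boxes_finite (b : Block π) : b.boxes.Finite :=
  (finite_rotheDiagram π).subset fun _ h => h.1.1.1

instance : Finite (Block π) := by
  have : Finite {c : ℕ × ℕ // c ∈ essential π ∧ c ∉ dominant π} :=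
    Set.Finite.subset (finite_rotheDiagram π) fun _ h => h.1.1
  exact Finite.of_surjective (Quot.mk (Aligned π)) Quot.exists_rep

lemma Block.exists_row (b : Block π) : ∃ c ∈ b.boxes, c.1 = b.row :=
  Nat.sSup_mem (b.boxes_nonempty.image _) (b.boxes_finite.image _).bddAbove

lemma Block.exists_col (b : Block π) : ∃ c ∈ b.boxes, c.2 = b.col :=
  Nat.sSup_mem (b.boxes_nonempty.image _) (b.boxes_finite.image _).bddAbove

lemma Block.le_row_col {b : Block π} {c : ℕ × ℕ} (h : c ∈ b.boxes) : c ≤ (b.row, b.col) :=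
  ⟨le_csSup (b.boxes_finite.image _).bddAbove ⟨c, h, rfl⟩,
    le_csSup (b.boxes_finite.image _).bddAbove ⟨c, h, rfl⟩⟩

/-- Two essential boxes of the same block have the same corner. -/
lemma Block.exists_isCorner (h2143 : Avoids2143 (extPerm π)) (b : Block π) :
    ∃ k, ∀ c ∈ b.boxes, IsCorner (extPerm π) k c := by
  have hex : ∀ e : {c : ℕ × ℕ // c ∈ essential π ∧ c ∉ dominant π},
      ∃ k, IsCorner (extPerm π) k e.1 := by
    rintro ⟨c, h1, h2⟩
    rw [essential_eq] at h1
    rw [dominant_eq] at h2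
    exact PipeDreams.exists_isCorner h2143 h1.1 h2
  choose K hK using hex
  let K' : Block π → ℕ × ℕ := Quot.lift K fun e f h => by
    rcases h with h | h
    · exact (hK e).eq_of_fst (hK f) h
    · exact (hK e).eq_of_snd (hK f) h
  refine ⟨K' b, ?_⟩
  rintro c ⟨h, rfl⟩
  exact hK ⟨c, h⟩

/-- What the gluing of components needs to know about the blocks: the corner `K b` and the lowest and
rightmost cell `E b` of the rectangle of each block; that the rectangles are told apart by their
corners; that every cell of the diagram outside the dominant region lies in the rectangle of the block
with the same corner; and that the diagram is justified to the bottom or to the right in the rectangle,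
according to the kind of the block. -/
structure IsBlockSystem {ι : Type*} (p : Equiv.Perm ℕ) (κ : ι → Kind) (K E : ι → ℕ × ℕ) :
    Prop where
  corner : ∀ b, IsCorner p (K b) (E b)
  injective : Function.Injective K
  le : ∀ b c, c ∈ diagram p → IsCorner p (K b) c → c ≤ E b
  exists_block : ∀ c ∈ diagram p, c ∉ domRegion p → ∃ b, IsCorner p (K b) c
  down : ∀ b, κ b = Kind.grass → ∀ x x' j, (x, j) ∈ diagram p → IsCorner p (K b) (x, j) →
    x ≤ x' → x' ≤ (E b).1 → (x', j) ∈ diagram p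
  right : ∀ b, κ b = Kind.invGrass → ∀ i y y', (i, y) ∈ diagram p → IsCorner p (K b) (i, y) →
    y ≤ y' → y' ≤ (E b).2 → (i, y') ∈ diagram p

lemma exists_isKindAssignment (h2143 : Avoids2143 (extPerm π)) (h1432 : Avoids1432 (extPerm π)) :
    ∃ κ : Block π → Kind, IsKindAssignment κ := by
  have hex : ∀ b : Block π, ∃ k : Kind, match k with
      | .grass => ∀ e ∈ b.boxes, ∀ f ∈ b.boxes, e.1 = f.1
      | .invGrass => ∀ e ∈ b.boxes, ∀ f ∈ b.boxes, e.2 = f.2 := by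
    intro b
    obtain ⟨k, hk⟩ := b.exists_isCorner h2143
    rcases aligned_row_or_col (S := b.boxes) fun e he f hf => essBoxes_aligned h2143 h1432
      (Block.mem_essBoxes he) (Block.mem_essBoxes hf) (hk e he) (hk f hf) with h | h
    · exact ⟨.grass, h⟩
    · exact ⟨.invGrass, h⟩
  choose κ hκ using hex
  exact ⟨κ, hκ⟩

lemma exists_isBlockSystem (h2143 : Avoids2143 (extPerm π)) (h1432 : Avoids1432 (extPerm π))
    {κ : Block π → Kind} (hκ : IsKindAssignment κ) :
    ∃ K : Block π → ℕ × ℕ,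
      IsBlockSystem (extPerm π) κ K (fun b => (b.row, b.col)) ∧ ∀ b k, b.corner k = K b := by
  choose K hK using fun b : Block π => b.exists_isCorner h2143
  have hbox : ∀ b e, e ∈ essBoxes (extPerm π) → IsCorner (extPerm π) (K b) e → e ∈ b.boxes := by
    intro b e he hk
    have h : e ∈ essential π ∧ e ∉ dominant π := by
      rw [essential_eq, dominant_eq]
      exact ⟨he, hk.not_mem_dom⟩
    refine ⟨h, ?_⟩
    obtain ⟨⟨c, hc⟩, rfl⟩ := Quot.exists_rep b
    have hcb : c ∈ Block.boxes (Quot.mk (Aligned π) ⟨c, hc⟩ : Block π) := ⟨hc, rfl⟩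
    exact Quot.sound (essBoxes_aligned h2143 h1432 he (Block.mem_essBoxes hcb) hk (hK _ c hcb))
  have hcorner : ∀ b : Block π, IsCorner (extPerm π) (K b) (b.row, b.col) := by
    intro b
    obtain ⟨c, hc, hc'⟩ := b.exists_row
    obtain ⟨d, hd, hd'⟩ := b.exists_col
    exact (hK b c hc).mk' (hK b d hd) hc'.symm hd'.symm
  have key : ∀ b c, c ∈ diagram (extPerm π) → IsCorner (extPerm π) (K b) c →
      c ≤ (b.row, b.col) := by
    intro b c hc hk
    obtain ⟨e, he, hce, hke⟩ := exists_essBox_of_mem_diagram h2143 hk hc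
    exact hce.trans (Block.le_row_col (hbox b e he hke))
  refine ⟨K, ⟨hcorner, ?_, key, ?_, ?_, ?_⟩, ?_⟩
  · intro b b' h
    obtain ⟨c, hc⟩ := b'.boxes_nonempty
    have hk := hK b' c hc
    rw [← h] at hk
    obtain ⟨h1, rfl⟩ := hbox b c (Block.mem_essBoxes hc) hk
    exact hc.2
  · intro c hc hd
    obtain ⟨k, hk⟩ := PipeDreams.exists_isCorner h2143 hc hd
    obtain ⟨e, he, -, hke⟩ := exists_essBox_of_mem_diagram h2143 hk hc
    have h : e ∈ essential π ∧ e ∉ dominant π := by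
      rw [essential_eq, dominant_eq]
      exact ⟨he, hke.not_mem_dom⟩
    refine ⟨Quot.mk _ ⟨e, h⟩, ?_⟩
    rwa [(hK (Quot.mk _ ⟨e, h⟩) e ⟨h, rfl⟩).eq_of_fst hke rfl]
  · intro b hb x x' j hx hk hxx hx'
    have hb' := hκ b
    rw [hb] at hb'
    obtain ⟨d, hd, hd'⟩ := b.exists_row
    exact diagram_down h2143 (fun e he hke => (hb' e (hbox b e he hke) d hd).trans hd') hx hk
      hxx hx'
  · intro b hb x x' j hx hk hxx hx'
    have hb' := hκ b
    rw [hb] at hb'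
    obtain ⟨d, hd, hd'⟩ := b.exists_col
    exact diagram_right h2143 (fun e he hke => (hb' e (hbox b e he hke) d hd).trans hd') hx hk
      hxx hx'
  · intro b k
    have hc := hcorner b
    have hc' : IsCorner (extPerm π) (K b) (K b) := hc.mono le_rfl hc.le
    have hrow : ∀ {c : ℕ × ℕ}, IsCorner (extPerm π) (K b) c →
        sInf {y | (c.1, y) ∉ dominant π} = (K b).2 := by
      intro c h
      have : {y | (c.1, y) ∉ dominant π} = Set.Ici (K b).2 := by
        ext y
        rw [dominant_eq, Set.mem_ofPred_eq, h.mem_dom_row, not_lt, Set.mem_Ici]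
      rw [this, csInf_Ici]
    have hcol : ∀ {c : ℕ × ℕ}, IsCorner (extPerm π) (K b) c →
        sInf {x | (x, c.2) ∉ dominant π} = (K b).1 := by
      intro c h
      have : {x | (x, c.2) ∉ dominant π} = Set.Ici (K b).1 := by
        ext y
        rw [dominant_eq, Set.mem_ofPred_eq, h.mem_dom_col, not_lt, Set.mem_Ici]
      rw [this, csInf_Ici]
    cases k
    · simp only [Block.corner]
      rw [hrow hc, hcol hc']
    · simp only [Block.corner]
      rw [hcol hc, hrow hc']

end blocks

namespace IsBlockSystem

variable {ι : Type*} {p : Equiv.Perm ℕ} {κ : ι → Kind} {K E : ι → ℕ × ℕ}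
  (h : IsBlockSystem p κ K E)
include h

lemma isCorner {b : ι} {c : ℕ × ℕ} (hc : c ∈ Set.Icc (K b) (E b)) : IsCorner p (K b) c :=
  (h.corner b).mono hc.1 hc.2

lemma mem_Icc {b : ι} {c : ℕ × ℕ} (hc : c ∈ diagram p) (hk : IsCorner p (K b) c) :
    c ∈ Set.Icc (K b) (E b) :=
  ⟨hk.le, h.le b c hc hk⟩

lemma eq_of_fst {b b' : ι} {c c' : ℕ × ℕ} (hc : c ∈ Set.Icc (K b) (E b))
    (hc' : c' ∈ Set.Icc (K b') (E b')) (e : c.1 = c'.1) : b = b' :=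
  h.injective ((h.isCorner hc).eq_of_fst (h.isCorner hc') e)

lemma disjoint {b b' : ι} (hbb : b ≠ b') :
    Disjoint (Set.Icc (K b) (E b)) (Set.Icc (K b') (E b')) := by
  rw [Set.disjoint_left]
  exact fun c hc hc' => hbb (h.eq_of_fst hc hc' rfl)

lemma not_mem_dom {b : ι} {c : ℕ × ℕ} (hc : c ∈ Set.Icc (K b) (E b)) : c ∉ domRegion p :=
  (h.isCorner hc).not_mem_dom

/-- In the row of a cell of a rectangle, the diagram outside the dominant region lies in the
rectangle. -/
lemma mem_Icc_of_row {b : ι} {c : ℕ × ℕ} (hc : c ∈ Set.Icc (K b) (E b)) {j : ℕ}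
    (hj : (K b).2 ≤ j) (hd : (c.1, j) ∈ diagram p) : (c.1, j) ∈ Set.Icc (K b) (E b) := by
  have hn : (c.1, j) ∉ domRegion p := by
    rw [(h.isCorner hc).mem_dom_row]
    omega
  obtain ⟨b', hb'⟩ := h.exists_block _ hd hn
  obtain rfl := h.eq_of_fst hc (h.mem_Icc hd hb') rfl
  exact h.mem_Icc hd hb'

lemma mem_Icc_of_col {b : ι} {c : ℕ × ℕ} (hc : c ∈ Set.Icc (K b) (E b)) {i : ℕ}
    (hi : (K b).1 ≤ i) (hd : (i, c.2) ∈ diagram p) : (i, c.2) ∈ Set.Icc (K b) (E b) := by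
  have hn : (i, c.2) ∉ domRegion p := by
    rw [(h.isCorner hc).mem_dom_col]
    omega
  obtain ⟨b', hb'⟩ := h.exists_block _ hd hn
  obtain rfl := h.injective ((h.isCorner hc).eq_of_snd hb' rfl)
  exact h.mem_Icc hd hb'

end IsBlockSystem

section blocks

variable {n : ℕ} {π : Equiv.Perm (Fin n)} {κ : Block π → Kind} {K : Block π → ℕ × ℕ}

lemma exists_isBlockPerm (h : IsBlockSystem (extPerm π) κ K (fun b => (b.row, b.col)))
    (hK : ∀ b k, b.corner k = K b) (b : Block π) :
    ∃ σ : Equiv.Perm (Fin (b.size (κ b))), IsBlockPerm b (κ b) σ := by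
  have hE : (b.row, b.col) ∈ Set.Icc (K b) (b.row, b.col) := ⟨(h.corner b).le, le_rfl⟩
  have hreg : ∀ k, b.region k = Set.Icc (K b) (b.row, b.col) := fun k => by
    rw [Block.region, hK]
  have hset : ∀ (k : Kind) (x y : ℕ), b.corner k + (x, y) ∈ rotheDiagram π ∩ b.region k ↔
      ((K b).1 + x, (K b).2 + y) ∈ diagram (extPerm π) ∧ (K b).1 + x ≤ b.row ∧
        (K b).2 + y ≤ b.col := by
    intro k x y
    rw [hK, hreg, rotheDiagram_eq]
    have e : K b + (x, y) = ((K b).1 + x, (K b).2 + y) := rfl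
    rw [e]
    simp only [Set.mem_inter_iff, Set.mem_Icc, Prod.le_def]
    constructor
    · rintro ⟨h1, h2, h3⟩
      exact ⟨h1, h3⟩
    · rintro ⟨h1, h2⟩
      exact ⟨h1, by simp, h2⟩
  cases hb : κ b with
  | grass =>
    have hsize : b.size Kind.grass = (b.row + 1 - (K b).1) +
        {j | (K b).2 ≤ j ∧ (b.row, j) ∈ diagram (extPerm π)}.ncard := by
      rw [Block.size, hK, rotheDiagram_eq]
    rw [hsize]
    obtain ⟨σ, hσ, hmem⟩ := exists_isGrassmannian_window (p := extPerm π) (r := (K b).1)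
      (c := (K b).2) (R := b.row) (J := b.col) (h.corner b)
      (fun x x' j h1 h2 h3 h4 h5 h6 => h.down b hb x x' j h6
        (h.isCorner ⟨⟨h1, h4⟩, ⟨h2.trans h3, h5⟩⟩) h2 h3)
      (fun j hj hd => (h.mem_Icc_of_row hE hj hd).2.2)
    refine ⟨σ, hσ, ?_⟩
    ext ⟨x, y⟩
    exact (hmem x y).trans (hset Kind.grass x y).symm
  | invGrass =>
    have hsize : b.size Kind.invGrass = (b.col + 1 - (K b).2) +
        {j | (K b).1 ≤ j ∧ (b.col, j) ∈ diagram (extPerm π).symm}.ncard := by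
      rw [Block.size, hK, rotheDiagram_eq]
      simp only [mem_diagram_symm]
    rw [hsize]
    obtain ⟨σ, hσ, hmem⟩ := exists_isGrassmannian_window (p := (extPerm π).symm) (r := (K b).2)
      (c := (K b).1) (R := b.col) (J := b.row) (h.corner b).swap
      (fun x x' j h1 h2 h3 h4 h5 h6 => mem_diagram_symm.2 (h.right b hb j x x'
        (mem_diagram_symm.1 h6) (h.isCorner ⟨⟨h4, h1⟩, ⟨h5, h2.trans h3⟩⟩) h2 h3))
      (fun j hj hd => (h.mem_Icc_of_col hE hj (mem_diagram_symm.1 hd)).2.1)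
    refine ⟨σ⁻¹, ?_, ?_⟩
    · show IsGrassmannian σ⁻¹⁻¹
      rwa [inv_inv]
    · ext ⟨x, y⟩
      rw [mem_rotheDiagram_inv, hmem, mem_diagram_symm]
      refine Iff.trans ?_ (hset Kind.invGrass x y).symm
      tauto

lemma isBlockDecomposition (h : IsBlockSystem (extPerm π) κ K (fun b => (b.row, b.col)))
    (hK : ∀ b k, b.corner k = K b) (hκ : IsKindAssignment κ)
    {σ : ∀ b : Block π, Equiv.Perm (Fin (b.size (κ b)))} (hσ : ∀ b, IsBlockPerm b (κ b) (σ b)) :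
    IsBlockDecomposition κ σ := by
  have hreg : ∀ b : Block π, b.region (κ b) = Set.Icc (K b) (b.row, b.col) := fun b => by
    rw [Block.region, hK]
  refine ⟨hκ, hσ, ?_, ?_, ?_⟩
  · intro b b' hbb
    rw [hreg, hreg]
    exact h.disjoint hbb
  · intro b
    rw [hreg, dominant_eq, Set.disjoint_right]
    exact fun c hc => h.not_mem_dom hc
  · intro c hc
    rw [rotheDiagram_eq] at hc
    rw [dominant_eq]
    by_cases hd : c ∈ domRegion (extPerm π)
    · exact Or.inl hd
    · obtain ⟨b, hb⟩ := h.exists_block c hc hd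
      refine Or.inr (Set.mem_iUnion.2 ⟨b, ?_⟩)
      rw [hreg]
      exact h.mem_Icc hc hb

end blocks

/-! ### Moves in squares and gluing -/

/-- A family of `2 × 2` squares, in which a cell can move to the opposite corner: `Q a b u v` means
that `a` and `b` are opposite corners of such a square, that a cell can move from `a` to `b`, and that
`u` and `v` are the other two corners. -/
abbrev Squares := ℕ × ℕ → ℕ × ℕ → ℕ × ℕ → ℕ × ℕ → Prop

/-- The set `Y` arises from `X` by a move in a square of which `X` contains a single corner. -/
def Move (Q : Squares) (X Y : Set (ℕ × ℕ)) : Prop :=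
  ∃ a b u v, Q a b u v ∧ a ∈ X ∧ b ∉ X ∧ u ∉ X ∧ v ∉ X ∧ Y = insert b (X \ {a})

section gluing

variable {ι : Type*} {Q : Squares} {q : ι → Squares} {dom : Set (ℕ × ℕ)}
  {ψ : ι → ℕ × ℕ → ℕ × ℕ} {W : ι → Set (ℕ × ℕ)}

/-- The union of a fixed set and of copies of the sets `F β`, embedded by the charts `ψ β`. -/
def glue (dom : Set (ℕ × ℕ)) (ψ : ι → ℕ × ℕ → ℕ × ℕ) (F : ι → Set (ℕ × ℕ)) : Set (ℕ × ℕ) :=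
  dom ∪ ⋃ β, ψ β '' F β

/-- The charts `ψ β`, defined on the windows `W β`, are embeddings with disjoint images under which
the moves in the squares `q β` correspond to the moves in the squares `Q`. -/
structure IsGluing (Q : Squares) (q : ι → Squares) (dom : Set (ℕ × ℕ)) (ψ : ι → ℕ × ℕ → ℕ × ℕ)
    (W : ι → Set (ℕ × ℕ)) : Prop where
  inj : ∀ β γ x y, x ∈ W β → y ∈ W γ → ψ β x = ψ γ y → β = γ ∧ x = y
  not_dom : ∀ β, ∀ x ∈ W β, ψ β x ∉ dom
  move : ∀ β a b u v, q β a b u v → a ∈ W β → b ∈ W β →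
    Q (ψ β a) (ψ β b) (ψ β u) (ψ β v) ∧ u ∈ W β ∧ v ∈ W β
  lift : ∀ β a b u v, Q a b u v → a ∈ ψ β '' W β → b ∉ dom → u ∉ dom → v ∉ dom →
    ∃ a' b' u' v', q β a' b' u' v' ∧ a' ∈ W β ∧ ψ β a' = a ∧ ψ β b' = b ∧ ψ β u' = u ∧ ψ β v' = v
  dom_stable : ∀ a b u v, Q a b u v → a ∈ dom → b ∈ dom ∨ u ∈ dom ∨ v ∈ dom

namespace IsGluing

variable (h : IsGluing Q q dom ψ W) {F F' : ι → Set (ℕ × ℕ)}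
include h

lemma mem_glue_iff (hF : ∀ β, F β ⊆ W β) {β : ι} {x : ℕ × ℕ} (hx : x ∈ W β) :
    ψ β x ∈ glue dom ψ F ↔ x ∈ F β := by
  constructor
  · rintro (hd | hu)
    · exact absurd hd (h.not_dom β x hx)
    · obtain ⟨γ, y, hy, hxy⟩ := Set.mem_iUnion.1 hu
      obtain ⟨rfl, rfl⟩ := h.inj γ β y x (hF γ hy) hx hxy
      exact hy
  · exact fun hx => Or.inr (Set.mem_iUnion.2 ⟨β, x, hx, rfl⟩)

lemma glue_injective (hF : ∀ β, F β ⊆ W β) (hF' : ∀ β, F' β ⊆ W β)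
    (hFF : glue dom ψ F = glue dom ψ F') : F = F' := by
  funext β
  ext x
  constructor
  · intro hx
    rwa [← h.mem_glue_iff hF' (hF β hx), ← hFF, h.mem_glue_iff hF (hF β hx)]
  · intro hx
    rwa [← h.mem_glue_iff hF (hF' β hx), hFF, h.mem_glue_iff hF' (hF' β hx)]

lemma glue_update [DecidableEq ι] (hF : ∀ β, F β ⊆ W β) {β : ι} {a b : ℕ × ℕ} (ha : a ∈ F β) :
    glue dom ψ (Function.update F β (insert b (F β \ {a}))) =
      insert (ψ β b) (glue dom ψ F \ {ψ β a}) := by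
  ext x
  constructor
  · rintro (hd | hu)
    · refine Or.inr ⟨Or.inl hd, ?_⟩
      rintro rfl
      exact h.not_dom β a (hF β ha) hd
    · obtain ⟨γ, y, hy, rfl⟩ := Set.mem_iUnion.1 hu
      by_cases hγ : γ = β
      · subst hγ
        rw [Function.update_self] at hy
        rcases hy with rfl | ⟨hy, hya⟩
        · exact Or.inl rfl
        · refine Or.inr ⟨(h.mem_glue_iff hF (hF γ hy)).2 hy, fun hxy => hya ?_⟩
          exact (h.inj γ γ y a (hF γ hy) (hF γ ha) hxy).2
      · rw [Function.update_of_ne hγ] at hy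
        refine Or.inr ⟨(h.mem_glue_iff hF (hF γ hy)).2 hy, fun hxy => hγ ?_⟩
        exact (h.inj γ β y a (hF γ hy) (hF β ha) hxy).1
  · rintro (rfl | ⟨hd | hu, hxa⟩)
    · exact Or.inr (Set.mem_iUnion.2 ⟨β, b, by rw [Function.update_self]; exact Or.inl rfl, rfl⟩)
    · exact Or.inl hd
    · obtain ⟨γ, y, hy, rfl⟩ := Set.mem_iUnion.1 hu
      refine Or.inr (Set.mem_iUnion.2 ⟨γ, y, ?_, rfl⟩)
      by_cases hγ : γ = β
      · subst hγ
        rw [Function.update_self]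
        exact Or.inr ⟨hy, fun hya => hxa (by rw [hya]; rfl)⟩
      · rwa [Function.update_of_ne hγ]

/-- A move in one of the glued sets is a move in the union. -/
lemma move_update [DecidableEq ι] (hF : ∀ β, F β ⊆ W β) {β : ι} {Y : Set (ℕ × ℕ)} (hY : Y ⊆ W β)
    (hm : Move (q β) (F β) Y) : Move Q (glue dom ψ F) (glue dom ψ (Function.update F β Y)) := by
  obtain ⟨a, b, u, v, hq, ha, hb, hu, hv, rfl⟩ := hm
  have hbW : b ∈ W β := hY (Or.inl rfl)
  obtain ⟨hQ, huW, hvW⟩ := h.move β a b u v hq (hF β ha) hbW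
  refine ⟨_, _, _, _, hQ, (h.mem_glue_iff hF (hF β ha)).2 ha, ?_, ?_, ?_, h.glue_update hF ha⟩
  · rwa [h.mem_glue_iff hF hbW]
  · rwa [h.mem_glue_iff hF huW]
  · rwa [h.mem_glue_iff hF hvW]

/-- A move in the union is a move in one of the glued sets. -/
lemma exists_move_of_move [DecidableEq ι] (hF : ∀ β, F β ⊆ W β) {Z : Set (ℕ × ℕ)}
    (hm : Move Q (glue dom ψ F) Z) :
    ∃ β Y, Move (q β) (F β) Y ∧ Z = glue dom ψ (Function.update F β Y) := by
  obtain ⟨a, b, u, v, hQ, ha, hb, hu, hv, rfl⟩ := hm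
  have hd : ∀ {x}, x ∉ glue dom ψ F → x ∉ dom := fun hx hxd => hx (Or.inl hxd)
  rcases ha with ha | ha
  · rcases h.dom_stable a b u v hQ ha with h1 | h1 | h1
    · exact absurd h1 (hd hb)
    · exact absurd h1 (hd hu)
    · exact absurd h1 (hd hv)
  · obtain ⟨β, a₀, ha₀, rfl⟩ := Set.mem_iUnion.1 ha
    obtain ⟨a', b', u', v', hq, haW, haa, rfl, rfl, rfl⟩ :=
      h.lift β _ b u v hQ ⟨a₀, hF β ha₀, rfl⟩ (hd hb) (hd hu) (hd hv)
    obtain ⟨-, rfl⟩ := h.inj β β a' a₀ haW (hF β ha₀) haa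
    have hF' : ∀ {x}, ψ β x ∉ glue dom ψ F → x ∉ F β := fun hx hxF =>
      hx (Or.inr (Set.mem_iUnion.2 ⟨β, _, hxF, rfl⟩))
    exact ⟨β, _, ⟨a', b', u', v', hq, ha₀, hF' hb, hF' hu, hF' hv, rfl⟩,
      (h.glue_update hF ha₀).symm⟩

end IsGluing

end gluing

/-! ### Reachability in a product -/

section product

variable {ι X : Type*} [DecidableEq ι] {S : ι → Type*} {r : ∀ β, S β → S β → Prop}
  {step : X → X → Prop} {G : (∀ β, S β) → X}

lemma reflTransGen_of_forall [Finite ι]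
    (h : ∀ f β s, r β (f β) s → step (G f) (G (Function.update f β s)))
    {f f' : ∀ β, S β} (hf : ∀ β, ReflTransGen (r β) (f β) (f' β)) :
    ReflTransGen step (G f) (G f') := by
  classical
  cases nonempty_fintype ι
  have one : ∀ (g : ∀ β, S β) β s, ReflTransGen (r β) (g β) s →
      ReflTransGen step (G g) (G (Function.update g β s)) := by
    intro g β s hs
    induction hs with
    | refl => rw [Function.update_eq_self]
    | @tail s t _ hst ih =>
      refine ih.tail ?_
      have := h (Function.update g β s) β t (by rwa [Function.update_self])
      rwa [Function.update_idem] at this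
  have key : ∀ A : Finset ι, ReflTransGen step (G f) (G fun β => if β ∈ A then f' β else f β) := by
    intro A
    induction A using Finset.induction_on with
    | empty => simp [ReflTransGen.refl]
    | @insert β A hβ ih =>
      have h1 := one (fun β => if β ∈ A then f' β else f β) β (f' β) (by simpa [hβ] using hf β)
      have h2 : Function.update (fun β => if β ∈ A then f' β else f β) β (f' β) =
          fun γ => if γ ∈ insert β A then f' γ else f γ := by
        funext γ
        by_cases hγ : γ = β
        · subst hγ
          simp
        · simp [hγ]
      rw [h2] at h1
      exact ih.trans h1
  simpa using key Finset.univ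

lemma exists_of_reflTransGen
    (h : ∀ f Y, step (G f) Y → ∃ β s, r β (f β) s ∧ Y = G (Function.update f β s))
    {f : ∀ β, S β} {Y : X} (hY : ReflTransGen step (G f) Y) :
    ∃ f', Y = G f' ∧ ∀ β, ReflTransGen (r β) (f β) (f' β) := by
  induction hY with
  | refl => exact ⟨f, rfl, fun _ => .refl⟩
  | tail _ hs ih =>
    obtain ⟨f', rfl, hf'⟩ := ih
    obtain ⟨β, s, h1, rfl⟩ := h f' _ hs
    refine ⟨_, rfl, fun γ => ?_⟩
    by_cases hγ : γ = β
    · subst hγ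
      rw [Function.update_self]
      exact (hf' γ).tail h1
    · rw [Function.update_of_ne hγ]
      exact hf' γ

end product

/-! ### Moves of blanks and crosses -/

/-- The squares of simple slides. -/
def slideSquares : Squares := fun a b u v =>
  ∃ i j : ℕ, a = (i + 1, j) ∧ b = (i, j + 1) ∧ u = (i, j) ∧ v = (i + 1, j + 1)

/-- The squares of simple droops, as moves of the blanks. -/
def droopSquares : Squares := fun a b u v =>
  ∃ i j : ℕ, a = (i + 1, j + 1) ∧ b = (i, j) ∧ u = (i, j + 1) ∧ v = (i + 1, j)

/-- The moves of the mirror images of the blanks of a block: slides for an inverse-Grassmannian block,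
reversed slides for a Grassmannian block. -/
def kindSquares : Kind → Squares
  | .invGrass => slideSquares
  | .grass => fun a b u v => slideSquares b a v u

lemma droopStep_iff {X Y : Set (ℕ × ℕ)} : DroopStep X Y ↔ Move droopSquares X Y := by
  constructor
  · rintro ⟨i, j, h1, h2, h3, h4, h5⟩
    exact ⟨_, _, _, _, ⟨i, j, rfl, rfl, rfl, rfl⟩, h1, h2, h3, h4, h5⟩
  · rintro ⟨_, _, _, _, ⟨i, j, rfl, rfl, rfl, rfl⟩, h1, h2, h3, h4, h5⟩
    exact ⟨i, j, h1, h2, h3, h4, h5⟩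

lemma slideStep_iff {X Y : Set (ℕ × ℕ)} : SlideStep X Y ↔ Move slideSquares X Y := by
  constructor
  · rintro ⟨i, j, h1, h2, h3, h4, h5⟩
    exact ⟨_, _, _, _, ⟨i, j, rfl, rfl, rfl, rfl⟩, h1, h3, h2, h4, h5⟩
  · rintro ⟨_, _, _, _, ⟨i, j, rfl, rfl, rfl, rfl⟩, h1, h2, h3, h4, h5⟩
    exact ⟨i, j, h1, h3, h2, h4, h5⟩

lemma Move.reverse {Q : Squares} (hQ : ∀ a b u v, Q a b u v → u ≠ b ∧ v ≠ b)
    {X Y : Set (ℕ × ℕ)} (h : Move Q X Y) : Move (fun a b u v => Q b a v u) Y X := by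
  obtain ⟨a, b, u, v, hq, ha, hb, hu, hv, rfl⟩ := h
  obtain ⟨h1, h2⟩ := hQ a b u v hq
  have hab : a ≠ b := fun e => hb (e ▸ ha)
  refine ⟨b, a, v, u, hq, Or.inl rfl, ?_, ?_, ?_, ?_⟩
  · simp [hab]
  · simp [h2, hv]
  · simp [h1, hu]
  · ext x
    simp only [Set.mem_insert_iff, Set.mem_sdiff, Set.mem_singleton_iff]
    by_cases hxa : x = a
    · simp [hxa, ha]
    · by_cases hxb : x = b
      · simp [hxb, hb, hab.symm]
      · simp [hxa, hxb]

lemma Kind.eq_or_eq (k : Kind) : k = .invGrass ∨ k = .grass := by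
  cases k <;> simp

lemma slideSquares_ne {a b u v : ℕ × ℕ} (h : slideSquares a b u v) : u ≠ b ∧ v ≠ b := by
  obtain ⟨i, j, rfl, rfl, rfl, rfl⟩ := h
  simp

lemma kindSquares_grass_ne {a b u v : ℕ × ℕ} (h : kindSquares .grass a b u v) :
    u ≠ b ∧ v ≠ b := by
  obtain ⟨i, j, rfl, rfl, rfl, rfl⟩ := h
  simp

namespace PD

variable {m : ℕ} {D D' : PD m}

/-- The steps that go up in the component of a block: simple slides for an inverse-Grassmannian
block, their inverses for a Grassmannian block. -/
def KindStep : Kind → PD m → PD m → Prop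
  | .invGrass, D, D' => SimpleSlide D D'
  | .grass, D, D' => SimpleSlide D' D

lemma KindStep.move {k : Kind} (h : KindStep k D D') :
    Move (kindSquares k) (D.crosses : Set (ℕ × ℕ)) (D'.crosses : Set (ℕ × ℕ)) := by
  cases k with
  | invGrass => exact slideStep_iff.1 (simpleSlide_iff.1 h)
  | grass =>
    exact (slideStep_iff.1 (simpleSlide_iff.1 h)).reverse fun _ _ _ _ => slideSquares_ne

lemma exists_kindStep_of_move {k : Kind} {Y : Set (ℕ × ℕ)}
    (h : Move (kindSquares k) (D.crosses : Set (ℕ × ℕ)) Y) :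
    ∃ D' : PD m, (D'.crosses : Set (ℕ × ℕ)) = Y ∧ KindStep k D D' := by
  -- the two ends of a slide lie on the same antidiagonal
  have hsum : ∀ a b u v, kindSquares k a b u v → a.1 + a.2 = b.1 + b.2 := by
    intro a b u v hq
    cases k <;> obtain ⟨i, j, rfl, rfl, rfl, rfl⟩ := hq <;> simp only <;> omega
  obtain ⟨a, b, u, v, hq, ha, hb, hu, hv, rfl⟩ := id h
  have hs := hsum a b u v hq
  refine ⟨⟨insert b (D.crosses.erase a), fun c hc => ?_⟩, by simp, ?_⟩
  · rcases Finset.mem_insert.1 hc with rfl | hc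
    · have := D.above a ha
      omega
    · exact D.above c (Finset.mem_of_mem_erase hc)
  · have e : insert b ((D.crosses : Set (ℕ × ℕ)) \ {a}) =
        ((insert b (D.crosses.erase a) : Finset (ℕ × ℕ)) : Set (ℕ × ℕ)) := by simp
    rw [e] at h
    cases k with
    | invGrass => exact simpleSlide_iff.2 (slideStep_iff.2 h)
    | grass =>
      exact simpleSlide_iff.2 (slideStep_iff.2 (h.reverse fun _ _ _ _ => kindSquares_grass_ne))

end PD

section slide

variable {m : ℕ} {σ : Equiv.Perm (Fin m)}

lemma Slide.isReducedOf (s : Slide σ) : s.1.IsReducedOf (extPerm σ) := by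
  obtain ⟨D, B, hB, h⟩ := s
  exact (PD.isReducedOf_of_reflTransGen h).1 hB.isReducedOf

lemma Slide.ext_crosses {s t : Slide σ}
    (h : (s.1.crosses : Set (ℕ × ℕ)) = (t.1.crosses : Set (ℕ × ℕ))) : s = t :=
  Subtype.ext (PD.ext_crosses (Finset.coe_injective h))

lemma Slide.le_iff {s t : Slide σ} :
    s ≤ t ↔ ReflTransGen (fun s t : Slide σ => PD.SimpleSlide s.1 t.1) s t := by
  constructor
  · intro h
    obtain ⟨D, hD⟩ := t
    change ReflTransGen PD.SimpleSlide s.1 D at h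
    induction h with
    | refl => exact .refl
    | @tail b c h1 h2 ih =>
      obtain ⟨B, hB, hBs⟩ := s.2
      exact (ih ⟨B, hB, hBs.trans h1⟩).tail h2
  · intro h
    induction h with
    | refl => exact le_rfl
    | tail _ h2 ih => exact ih.trans (ReflTransGen.single h2)

lemma Slide.reflTransGen_invGrass {k : Kind} (hk : k = .invGrass) {s t : Slide σ} :
    ReflTransGen (fun s t : Slide σ => PD.KindStep k s.1 t.1) s t ↔ s ≤ t := by
  subst hk
  exact Slide.le_iff.symm

lemma Slide.reflTransGen_grass {k : Kind} (hk : k = .grass) {s t : Slide σ} :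
    ReflTransGen (fun s t : Slide σ => PD.KindStep k s.1 t.1) s t ↔ t ≤ s := by
  subst hk
  refine Iff.trans ?_ Slide.le_iff.symm
  exact reflTransGen_swap (r := fun s t : Slide σ => PD.SimpleSlide s.1 t.1)

lemma Slide.exists_kindStep_of_move (hσ : Avoids1432 (extPerm σ)) {k : Kind} {s : Slide σ}
    {Y : Set (ℕ × ℕ)} (h : Move (kindSquares k) (s.1.crosses : Set (ℕ × ℕ)) Y) :
    ∃ t : Slide σ, (t.1.crosses : Set (ℕ × ℕ)) = Y ∧ PD.KindStep k s.1 t.1 := by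
  obtain ⟨D, hD, hk⟩ := PD.exists_kindStep_of_move h
  have hred : D.IsReducedOf (extPerm σ) := by
    cases k with
    | invGrass => exact (PD.SimpleSlide.isReducedOf_iff hk).1 s.isReducedOf
    | grass => exact (PD.SimpleSlide.isReducedOf_iff hk).2 s.isReducedOf
  exact ⟨⟨D, hred.exists_isBottom hσ⟩, hD, hk⟩

/-- The least element of the component of a block in the product: the bottom pipe dream, or the top
pipe dream for a Grassmannian block. -/
lemma Slide.exists_least (hσ : Avoids1432 (extPerm σ)) (k : Kind) :
    ∃ s : Slide σ, (s.1.crosses : Set (ℕ × ℕ)) = (match k with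
        | .invGrass => bottomCells (extPerm σ)
        | .grass => Prod.swap ⁻¹' bottomCells (extPerm σ).symm) ∧
      ∀ t : Slide σ, ReflTransGen (fun s t : Slide σ => PD.KindStep k s.1 t.1) s t := by
  cases k with
  | invGrass =>
    obtain ⟨B, hB, hc⟩ := PD.exists_isBottom σ
    refine ⟨⟨B, B, hB, .refl⟩, hc, fun t => (Slide.reflTransGen_invGrass rfl).2 ?_⟩
    obtain ⟨D, B', hB', h⟩ := t
    have : B' = B := PD.ext_crosses (Finset.coe_injective (hB'.crosses_eq.trans hc.symm))
    subst this
    exact h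
  | grass =>
    obtain ⟨T, hT, hc⟩ := PD.exists_isReducedOf_top σ
    refine ⟨⟨T, hT.exists_isBottom hσ⟩, hc, fun t => (Slide.reflTransGen_grass rfl).2 ?_⟩
    obtain ⟨T', hT', h⟩ := t.isReducedOf.exists_top hσ
    have : T' = T := PD.ext_crosses (Finset.coe_injective (hT'.trans hc.symm))
    subst this
    exact h

end slide

/-! ### The gluings of the blocks -/

section charts

variable {ι : Type*} {p : Equiv.Perm ℕ} {κ : ι → Kind} {K E : ι → ℕ × ℕ}

/-- The coordinates of the cells of the rectangle of a block relative to its NW corner. -/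
def blockWindow (k e : ℕ × ℕ) : Set (ℕ × ℕ) := {x | k + x ≤ e}

/-- The chart that identifies the mirror image of the rectangle `[k, e]` of a block with the
rectangle. -/
def mirrorChart (κ : Kind) (k e : ℕ × ℕ) : ℕ × ℕ → ℕ × ℕ :=
  match κ with
  | .invGrass => fun x => (k.1 + x.1, e.2 - x.2)
  | .grass => fun x => (e.1 - x.1, k.2 + x.2)

lemma mem_blockWindow {k e x : ℕ × ℕ} :
    x ∈ blockWindow k e ↔ k.1 + x.1 ≤ e.1 ∧ k.2 + x.2 ≤ e.2 := Iff.rfl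

lemma add_mem_Icc {k e x : ℕ × ℕ} (hx : x ∈ blockWindow k e) : k + x ∈ Set.Icc k e :=
  ⟨le_self_add, hx⟩

lemma mirrorChart_mem_Icc {κ : Kind} {k e x : ℕ × ℕ} (hx : x ∈ blockWindow k e) :
    mirrorChart κ k e x ∈ Set.Icc k e := by
  rw [mem_blockWindow] at hx
  cases κ <;> simp only [mirrorChart, Set.mem_Icc, Prod.le_def] <;> omega

lemma mirrorChart_injOn {κ : Kind} {k e x y : ℕ × ℕ} (hx : x ∈ blockWindow k e)
    (hy : y ∈ blockWindow k e) (h : mirrorChart κ k e x = mirrorChart κ k e y) : x = y := by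
  rw [mem_blockWindow] at hx hy
  cases κ <;> simp only [mirrorChart, Prod.mk.injEq] at h <;> ext <;> omega

/-- The mirror images of the blanks of the blocks are glued to the set of all blanks. -/
lemma IsBlockSystem.isGluing_droop (h : IsBlockSystem p κ K E) :
    IsGluing droopSquares (fun β => kindSquares (κ β)) (domRegion p)
      (fun β => mirrorChart (κ β) (K β) (E β)) fun β => blockWindow (K β) (E β) where
  inj β γ x y hx hy hxy := by
    have h1 := mirrorChart_mem_Icc (κ := κ β) hx
    have h2 := mirrorChart_mem_Icc (κ := κ γ) hy
    obtain rfl := h.eq_of_fst h1 h2 (congrArg Prod.fst hxy)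
    exact ⟨rfl, mirrorChart_injOn hx hy hxy⟩
  not_dom β x hx := h.not_mem_dom (mirrorChart_mem_Icc hx)
  move β a b u v hq ha hb := by
    simp only [mem_blockWindow] at ha hb ⊢
    cases hκ : κ β with
    | invGrass =>
      rw [hκ] at hq
      obtain ⟨i, j, rfl, rfl, rfl, rfl⟩ := hq
      simp only [mirrorChart] at ha hb ⊢
      refine ⟨⟨(K β).1 + i, (E β).2 - (j + 1), ?_⟩, by omega, by omega⟩
      simp only [Prod.mk.injEq, true_and, and_true]
      omega
    | grass =>
      rw [hκ] at hq
      obtain ⟨i, j, rfl, rfl, rfl, rfl⟩ := hq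
      simp only [mirrorChart] at ha hb ⊢
      refine ⟨⟨(E β).1 - (i + 1), (K β).2 + j, ?_⟩, by omega, by omega⟩
      simp only [Prod.mk.injEq, true_and, and_true]
      omega
  lift β a b u v hQ ha hb hu hv := by
    obtain ⟨x, hx, hxa⟩ := ha
    have haI := mirrorChart_mem_Icc (κ := κ β) hx
    rw [hxa] at haI
    have hk := h.isCorner haI
    obtain ⟨i, j, rfl, rfl, rfl, rfl⟩ := hQ
    have hi : (K β).1 ≤ i := not_lt.1 fun hi => hu (hk.mem_dom_col.2 hi)
    have hj : (K β).2 ≤ j := not_lt.1 fun hj => hv (hk.mem_dom_row.2 hj)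
    simp only [Set.mem_Icc, Prod.le_def] at haI
    simp only [mem_blockWindow]
    cases hκ : κ β with
    | invGrass =>
      refine ⟨_, _, _, _, ⟨i - (K β).1, (E β).2 - (j + 1), rfl, rfl, rfl, rfl⟩, ?_⟩
      simp only [mirrorChart, Prod.mk.injEq]
      omega
    | grass =>
      refine ⟨_, _, _, _, ⟨(E β).1 - (i + 1), j - (K β).2, rfl, rfl, rfl, rfl⟩, ?_⟩
      simp only [mirrorChart, Prod.mk.injEq]
      omega
  dom_stable a b u v hQ ha := by
    obtain ⟨i, j, rfl, rfl, rfl, rfl⟩ := hQ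
    exact Or.inl (domRegion_mono ha (Nat.le_succ i) (Nat.le_succ j))

/-- The crosses of the blocks are glued to the set of all crosses. -/
lemma IsBlockSystem.isGluing_slide (h : IsBlockSystem p κ K E) :
    IsGluing slideSquares (fun _ => slideSquares) (domRegion p)
      (fun β x => K β + x) fun β => blockWindow (K β) (E β) where
  inj β γ x y hx hy hxy := by
    obtain rfl := h.eq_of_fst (add_mem_Icc hx) (add_mem_Icc hy) (congrArg Prod.fst hxy)
    exact ⟨rfl, add_left_cancel hxy⟩
  not_dom β x hx := h.not_mem_dom (add_mem_Icc hx)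
  move β a b u v hq ha hb := by
    simp only [mem_blockWindow] at ha hb ⊢
    obtain ⟨i, j, rfl, rfl, rfl, rfl⟩ := hq
    simp only at ha hb ⊢
    exact ⟨⟨(K β).1 + i, (K β).2 + j, rfl, rfl, rfl, rfl⟩, by omega, by omega⟩
  lift β a b u v hQ ha hb hu hv := by
    obtain ⟨x, hx, hxa⟩ := ha
    have haI := add_mem_Icc hx
    simp only at hxa
    rw [hxa] at haI
    have hk := h.isCorner haI
    obtain ⟨i, j, rfl, rfl, rfl, rfl⟩ := hQ
    have hi : (K β).1 ≤ i := not_lt.1 fun hi => hu (hk.mem_dom_col.2 hi)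
    simp only [Set.mem_Icc, Prod.le_def] at haI
    simp only [mem_blockWindow]
    refine ⟨_, _, _, _, ⟨i - (K β).1, j - (K β).2, rfl, rfl, rfl, rfl⟩, ?_⟩
    simp only [Prod.ext_iff, Prod.fst_add, Prod.snd_add]
    omega
  dom_stable a b u v hQ ha := by
    obtain ⟨i, j, rfl, rfl, rfl, rfl⟩ := hQ
    exact Or.inr (Or.inl (domRegion_mono ha (Nat.le_succ i) le_rfl))

end charts

/-- A final segment of `{0, …, M}` is determined by its cardinality. -/
lemma mem_iff_lt_ncard {S : Set ℕ} {M y : ℕ} (hS : ∀ y ∈ S, y ≤ M)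
    (hup : ∀ y ∈ S, ∀ y', y ≤ y' → y' ≤ M → y' ∈ S) (hy : y ≤ M) :
    y ∈ S ↔ M - y < S.ncard := by
  rcases S.eq_empty_or_nonempty with rfl | hne
  · simp
  · have hS' : S = (Finset.Icc (sInf S) M : Finset ℕ) := by
      ext x
      rw [Finset.coe_Icc, Set.mem_Icc]
      exact ⟨fun hx => ⟨Nat.sInf_le hx, hS x hx⟩,
        fun hx => hup _ (Nat.sInf_mem hne) x hx.1 hx.2⟩
    have hle : sInf S ≤ M := hS _ (Nat.sInf_mem hne)
    have hcard : S.ncard = M + 1 - sInf S := by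
      rw [hS', Set.ncard_coe_finset, Nat.card_Icc, ← hS']
    rw [hcard]
    constructor
    · intro h
      have := Nat.sInf_le h
      omega
    · intro h
      exact hup _ (Nat.sInf_mem hne) y (by omega) hy

section base

variable {ι : Type*} {p : Equiv.Perm ℕ} {κ : ι → Kind} {K E : ι → ℕ × ℕ}
  (h : IsBlockSystem p κ K E) {P : ι → Equiv.Perm ℕ}
  (hP : ∀ β x, x ∈ diagram (P β) ↔ K β + x ∈ diagram p ∧ x ∈ blockWindow (K β) (E β))
include h hP

/-- Mirrored, the part of the diagram in a block is left-justified for an inverse-Grassmannian and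
top-justified for a Grassmannian block. -/
lemma mirrorChart_mem_diagram_iff {β : ι} {x : ℕ × ℕ} (hx : x ∈ blockWindow (K β) (E β)) :
    mirrorChart (κ β) (K β) (E β) x ∈ diagram p ↔
      x ∈ (match κ β with
        | .invGrass => bottomCells (P β)
        | .grass => Prod.swap ⁻¹' bottomCells (P β).symm) := by
  obtain ⟨i, j⟩ := x
  rw [mem_blockWindow] at hx
  simp only at hx
  cases hκ : κ β with
  | invGrass =>
    have hiff : ∀ y, y ≤ (E β).2 - (K β).2 →
        (y ∈ {y | (i, y) ∈ diagram (P β)} ↔ ((K β).1 + i, (K β).2 + y) ∈ diagram p) := by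
      intro y hy
      rw [Set.mem_ofPred_eq, hP, mem_blockWindow]
      simp only
      constructor
      · exact fun h' => h'.1
      · exact fun h' => ⟨h', hx.1, by omega⟩
    have hle : ∀ y ∈ {y | (i, y) ∈ diagram (P β)}, y ≤ (E β).2 - (K β).2 := by
      intro y hy
      have := ((hP _ _).1 hy).2
      rw [mem_blockWindow] at this
      simp only at this
      omega
    have key := mem_iff_lt_ncard (S := {y | (i, y) ∈ diagram (P β)}) (M := (E β).2 - (K β).2)
      (y := (E β).2 - (K β).2 - j) hle (fun y hy y' hyy hy' => (hiff y' hy').2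
        (h.right β hκ _ _ _ ((hiff y (hle y hy)).1 hy)
          (h.isCorner ⟨⟨by simp, by simp⟩, ⟨hx.1, by have := hle y hy; simp only; omega⟩⟩)
          (by omega) (by omega))) (by omega)
    rw [hiff _ (by omega), show (K β).2 + ((E β).2 - (K β).2 - j) = (E β).2 - j by omega,
      show (E β).2 - (K β).2 - ((E β).2 - (K β).2 - j) = j by omega] at key
    exact key
  | grass =>
    have hiff : ∀ y, y ≤ (E β).1 - (K β).1 →
        (y ∈ {y | (j, y) ∈ diagram (P β).symm} ↔ ((K β).1 + y, (K β).2 + j) ∈ diagram p) := by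
      intro y hy
      rw [Set.mem_ofPred_eq, mem_diagram_symm, hP, mem_blockWindow]
      simp only
      constructor
      · exact fun h' => h'.1
      · exact fun h' => ⟨h', by omega, hx.2⟩
    have hle : ∀ y ∈ {y | (j, y) ∈ diagram (P β).symm}, y ≤ (E β).1 - (K β).1 := by
      intro y hy
      rw [Set.mem_ofPred_eq, mem_diagram_symm] at hy
      have := ((hP _ _).1 hy).2
      rw [mem_blockWindow] at this
      simp only at this
      omega
    have key := mem_iff_lt_ncard (S := {y | (j, y) ∈ diagram (P β).symm})
      (M := (E β).1 - (K β).1) (y := (E β).1 - (K β).1 - i) hle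
      (fun y hy y' hyy hy' => (hiff y' hy').2
        (h.down β hκ _ _ _ ((hiff y (hle y hy)).1 hy)
          (h.isCorner ⟨⟨by simp, by simp⟩, ⟨by have := hle y hy; simp only; omega, hx.2⟩⟩)
          (by omega) (by omega))) (by omega)
    rw [hiff _ (by omega), show (K β).1 + ((E β).1 - (K β).1 - i) = (E β).1 - i by omega,
      show (E β).1 - (K β).1 - ((E β).1 - (K β).1 - i) = i by omega] at key
    exact key

lemma glue_mirrorChart_eq_diagram {F : ι → Set (ℕ × ℕ)}
    (hF : ∀ β, F β ⊆ blockWindow (K β) (E β))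
    (hF' : ∀ β, F β = match κ β with
        | .invGrass => bottomCells (P β)
        | .grass => Prod.swap ⁻¹' bottomCells (P β).symm) :
    glue (domRegion p) (fun β => mirrorChart (κ β) (K β) (E β)) F = diagram p := by
  apply Set.Subset.antisymm
  · rintro c (hd | hu)
    · exact domRegion_subset p hd
    · obtain ⟨β, x, hx, rfl⟩ := Set.mem_iUnion.1 hu
      refine (mirrorChart_mem_diagram_iff h hP (hF β hx)).2 ?_
      rwa [← hF']
  · intro c hc
    by_cases hd : c ∈ domRegion p
    · exact Or.inl hd
    · obtain ⟨β, hβ⟩ := h.exists_block c hc hd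
      have hI := h.mem_Icc hc hβ
      -- the chart maps the window onto the rectangle
      obtain ⟨x, hx, rfl⟩ : ∃ x ∈ blockWindow (K β) (E β),
          mirrorChart (κ β) (K β) (E β) x = c := by
        simp only [Set.mem_Icc, Prod.le_def] at hI
        cases κ β with
        | invGrass =>
          refine ⟨(c.1 - (K β).1, (E β).2 - c.2), ?_, ?_⟩
          · simp only [mem_blockWindow]; omega
          · ext <;> simp only [mirrorChart] <;> omega
        | grass =>
          refine ⟨((E β).1 - c.1, c.2 - (K β).2), ?_, ?_⟩
          · simp only [mem_blockWindow]; omega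
          · ext <;> simp only [mirrorChart] <;> omega
      refine Or.inr (Set.mem_iUnion.2 ⟨β, x, ?_, rfl⟩)
      rw [hF']
      exact (mirrorChart_mem_diagram_iff h hP hx).1 hc

/-- The bottom pipe dream is glued from the bottom pipe dreams of the blocks: each row meets at most one
block, and the diagram in this row consists of cells of the dominant region and of cells of the
block. -/
lemma glue_add_eq_bottomCells :
    glue (domRegion p) (fun β x => K β + x) (fun β => bottomCells (P β)) = bottomCells p := by
  ext ⟨i, j⟩
  have hfin : {y | (i, y) ∈ diagram p}.Finite := diagram_row_finite p i
  by_cases hex : ∃ y, (i, y) ∈ diagram p ∧ (i, y) ∉ domRegion p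
  · -- the row meets the rectangle of exactly one block
    obtain ⟨y, hy, hyd⟩ := hex
    obtain ⟨β, hβ⟩ := h.exists_block _ hy hyd
    have hI := h.mem_Icc hy hβ
    have hK : (K β).1 ≤ i := hI.1.1
    have hiE : i ≤ (E β).1 := hI.2.1
    have hrow : {y | (i, y) ∈ diagram p} = Set.Iio (K β).2 ∪
        (fun z => (K β).2 + z) '' {z | (i - (K β).1, z) ∈ diagram (P β)} := by
      ext z
      rw [Set.mem_ofPred_eq, Set.mem_union, Set.mem_Iio]
      constructor
      · intro hz
        rcases Nat.lt_or_ge z (K β).2 with hlt | hge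
        · exact Or.inl hlt
        · have hz' := h.mem_Icc_of_row hI hge hz
          refine Or.inr ⟨z - (K β).2, ?_, by simp only; omega⟩
          rw [Set.mem_ofPred_eq, hP, mem_blockWindow]
          have e : K β + (i - (K β).1, z - (K β).2) = (i, z) := by
            ext <;> simp only [Prod.fst_add, Prod.snd_add] <;> omega
          rw [e]
          have := hz'.2.2
          simp only at this ⊢
          exact ⟨hz, by omega, by omega⟩
      · rintro (hz | ⟨z, hz, rfl⟩)
        · exact domRegion_subset p (hβ.mem_dom_row.2 hz)
        · have := ((hP _ _).1 hz).1
          have e : K β + (i - (K β).1, z) = (i, (K β).2 + z) :=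
            Prod.ext (by simp only [Prod.fst_add]; omega) rfl
          rwa [e] at this
    have hcard : {y | (i, y) ∈ diagram p}.ncard =
        (K β).2 + {z | (i - (K β).1, z) ∈ diagram (P β)}.ncard := by
      rw [hrow] at hfin ⊢
      rw [Set.ncard_union_eq _ (hfin.subset Set.subset_union_left)
        (hfin.subset Set.subset_union_right),
        Set.ncard_image_of_injective _ (add_right_injective _)]
      · simp [Set.ncard_eq_toFinset_card']
      · rw [Set.disjoint_left]
        rintro z hz ⟨w, -, rfl⟩
        have hz' : (K β).2 + w < (K β).2 := hz
        omega
    show _ ↔ j < {y | (i, y) ∈ diagram p}.ncard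
    rw [hcard]
    constructor
    · rintro (hd | hu)
      · have : j < (K β).2 := hβ.mem_dom_row.1 hd
        omega
      · obtain ⟨γ, ⟨x, z⟩, hxz, he⟩ := Set.mem_iUnion.1 hu
        have e1 : (K γ).1 + x = i := congrArg Prod.fst he
        have e2 : (K γ).2 + z = j := congrArg Prod.snd he
        -- the row of the component at `γ` is not empty
        obtain ⟨w, hw⟩ : {w | (x, w) ∈ diagram (P γ)}.Nonempty := by
          apply Set.nonempty_of_ncard_ne_zero
          have : z < {w | (x, w) ∈ diagram (P γ)}.ncard := hxz
          omega
        have hw' := (hP γ (x, w)).1 hw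
        obtain rfl := h.eq_of_fst hI (add_mem_Icc hw'.2) e1.symm
        rw [show i - (K β).1 = x by omega]
        have : z < {w | (x, w) ∈ diagram (P β)}.ncard := hxz
        omega
    · intro hj
      rcases Nat.lt_or_ge j (K β).2 with hlt | hge
      · exact Or.inl (hβ.mem_dom_row.2 hlt)
      · refine Or.inr (Set.mem_iUnion.2 ⟨β, (i - (K β).1, j - (K β).2), ?_, ?_⟩)
        · show j - (K β).2 < {z | (i - (K β).1, z) ∈ diagram (P β)}.ncard
          omega
        · ext <;> simp only [Prod.fst_add, Prod.snd_add] <;> omega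
  · push Not at hex
    have hrow : {y | (i, y) ∈ diagram p} = {y | (i, y) ∈ domRegion p} := by
      ext y
      exact ⟨hex y, fun hy => domRegion_subset p hy⟩
    have hdown : (i, j) ∈ domRegion p ↔ j < {y | (i, y) ∈ diagram p}.ncard := by
      rw [hrow] at hfin ⊢
      have hcoe : {y | (i, y) ∈ domRegion p} = (hfin.toFinset : Set ℕ) := by simp
      rw [hcoe, Set.ncard_coe_finset]
      obtain ⟨M, hM⟩ := hfin.bddAbove
      have := lt_card_filter_range_iff (n := M + 1) (P := fun y => y ∈ hfin.toFinset)
        (fun r hr => by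
          simp only [Set.Finite.mem_toFinset, Set.mem_ofPred_eq] at hr ⊢
          exact domRegion_mono hr le_rfl (Nat.le_succ r))
        (fun r hr => by
          simp only [Set.Finite.mem_toFinset] at hr
          exact Nat.lt_succ_of_le (hM hr)) j
      have e : (Finset.range (M + 1)).filter (fun y => y ∈ hfin.toFinset) = hfin.toFinset := by
        ext y
        simp only [Finset.mem_filter, Finset.mem_range, and_iff_right_iff_imp]
        intro hy
        exact Nat.lt_succ_of_le (hM (hfin.mem_toFinset.1 hy))
      rw [e] at this
      rw [this]
      simp
    show _ ↔ j < {y | (i, y) ∈ diagram p}.ncard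
    rw [← hdown]
    constructor
    · rintro (hd | hu)
      · exact hd
      · obtain ⟨γ, ⟨x, z⟩, hxz, he⟩ := Set.mem_iUnion.1 hu
        have e1 : (K γ).1 + x = i := congrArg Prod.fst he
        obtain ⟨w, hw⟩ : {w | (x, w) ∈ diagram (P γ)}.Nonempty := by
          apply Set.nonempty_of_ncard_ne_zero
          have : z < {w | (x, w) ∈ diagram (P γ)}.ncard := hxz
          omega
        have hw' := (hP γ (x, w)).1 hw
        have e : K γ + (x, w) = (i, (K γ).2 + w) := by
          ext
          · exact e1
          · rfl
        have hd := hex _ (e ▸ hw'.1)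
        rw [← e] at hd
        exact absurd hd (h.not_mem_dom (add_mem_Icc hw'.2))
    · exact fun hd => Or.inl hd

end base

/-! ### Products of slide posets -/

section product

variable {ι : Type*} {m : ι → ℕ} {σ : ∀ β, Equiv.Perm (Fin (m β))} {Q : Squares}
  {κ : ι → Kind} {dom : Set (ℕ × ℕ)} {ψ : ι → ℕ × ℕ → ℕ × ℕ} {W : ι → Set (ℕ × ℕ)}

/-- The set glued from the crosses of one pipe dream for each block. -/
def glueSlides (dom : Set (ℕ × ℕ)) (ψ : ι → ℕ × ℕ → ℕ × ℕ) (s : ∀ β, Slide (σ β)) :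
    Set (ℕ × ℕ) :=
  glue dom ψ fun β => ((s β).1.crosses : Set (ℕ × ℕ))

lemma IsGluing.glueSlides_injective (h : IsGluing Q (fun β => kindSquares (κ β)) dom ψ W)
    (hW : ∀ β (s : Slide (σ β)), (s.1.crosses : Set (ℕ × ℕ)) ⊆ W β) {s t : ∀ β, Slide (σ β)}
    (hst : glueSlides dom ψ s = glueSlides dom ψ t) : s = t := by
  have := h.glue_injective (fun β => hW β (s β)) (fun β => hW β (t β)) hst
  funext β
  exact Slide.ext_crosses (congrFun this β)

/-- What can be reached by moves from a glued set is glued from what can be reached in the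
components. -/
lemma IsGluing.reflTransGen_iff [Finite ι]
    (h : IsGluing Q (fun β => kindSquares (κ β)) dom ψ W)
    (hW : ∀ β (s : Slide (σ β)), (s.1.crosses : Set (ℕ × ℕ)) ⊆ W β)
    (hσ : ∀ β, Avoids1432 (extPerm (σ β))) {s : ∀ β, Slide (σ β)} {Y : Set (ℕ × ℕ)} :
    ReflTransGen (Move Q) (glueSlides dom ψ s) Y ↔ ∃ t, Y = glueSlides dom ψ t ∧
      ∀ β, ReflTransGen (fun s t : Slide (σ β) => PD.KindStep (κ β) s.1 t.1) (s β) (t β) := by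
  classical
  have hupd : ∀ (s : ∀ β, Slide (σ β)) β (t : Slide (σ β)),
      (fun γ => ((Function.update s β t γ).1.crosses : Set (ℕ × ℕ))) =
        Function.update (fun γ => ((s γ).1.crosses : Set (ℕ × ℕ))) β t.1.crosses := by
    intro s β t
    funext γ
    by_cases hγ : γ = β
    · subst hγ
      simp
    · simp [hγ]
  constructor
  · intro hY
    refine exists_of_reflTransGen (G := glueSlides dom ψ)
      (r := fun β (s t : Slide (σ β)) => PD.KindStep (κ β) s.1 t.1) ?_ hY
    intro f Y hY
    obtain ⟨β, Z, hZ, rfl⟩ := h.exists_move_of_move (fun β => hW β (f β)) hY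
    obtain ⟨t, rfl, ht⟩ := Slide.exists_kindStep_of_move (hσ β) hZ
    refine ⟨β, t, ht, ?_⟩
    rw [glueSlides, hupd]
  · rintro ⟨t, rfl, ht⟩
    refine reflTransGen_of_forall (fun f β t' hs => ?_) ht
    rw [glueSlides, glueSlides, hupd]
    exact h.move_update (fun β => hW β (f β)) (hW β t') hs.move

end product

section components

variable {n : ℕ} {π : Equiv.Perm (Fin n)} {κ : Block π → Kind} {K : Block π → ℕ × ℕ}
  {σ : ∀ b : Block π, Equiv.Perm (Fin (b.size (κ b)))}

/-- The SE corner of the rectangle of a block. -/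
noncomputable def Block.last (b : Block π) : ℕ × ℕ := (b.row, b.col)

/-- The blanks glued from the mirror images `s b` of the blanks of the blocks. -/
noncomputable def glueBlanks (K : Block π → ℕ × ℕ) (s : ∀ b, Slide (σ b)) : Set (ℕ × ℕ) :=
  glueSlides (domRegion (extPerm π)) (fun b => mirrorChart (κ b) (K b) b.last) s

/-- The crosses glued from the crosses `s b` of the blocks. -/
def glueCrosses (K : Block π → ℕ × ℕ) (s : ∀ b, Slide (σ b)) : Set (ℕ × ℕ) :=
  glueSlides (domRegion (extPerm π)) (fun b x => K b + x) s

variable (h : IsBlockSystem (extPerm π) κ K Block.last) (hK : ∀ b k, b.corner k = K b)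
  (hσ : ∀ b, IsBlockPerm b (κ b) (σ b))

lemma IsBlockPerm.avoids1432 {b : Block π} {k : Kind} {m : ℕ} {τ : Equiv.Perm (Fin m)}
    (hτ : IsBlockPerm b k τ) : Avoids1432 (extPerm τ) := by
  cases k with
  | grass => exact IsGrassmannian.avoids1432 hτ.1
  | invGrass => exact IsInvGrassmannian.avoids1432 hτ.1

include hK hσ in
lemma IsBlockPerm.mem_diagram_iff (b : Block π) (x : ℕ × ℕ) : x ∈ diagram (extPerm (σ b)) ↔
    K b + x ∈ diagram (extPerm π) ∧ x ∈ blockWindow (K b) b.last := by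
  rw [← rotheDiagram_eq, (hσ b).2, Set.mem_ofPred_eq, Block.region, hK, rotheDiagram_eq,
    Set.mem_inter_iff, Set.mem_Icc]
  exact and_congr_right fun _ => ⟨fun h => h.2, fun h => ⟨le_self_add, h⟩⟩

include hK hσ in
lemma Slide.crosses_subset_blockWindow (b : Block π) (s : Slide (σ b)) :
    (s.1.crosses : Set (ℕ × ℕ)) ⊆ blockWindow (K b) b.last := by
  rintro ⟨i, j⟩ hc
  obtain ⟨c, hc, hi, hj⟩ := s.isReducedOf.exists_diagram hc
  have := ((IsBlockPerm.mem_diagram_iff hK hσ b c).1 hc).2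
  rw [mem_blockWindow] at this ⊢
  simp only
  omega

include h hK hσ in
/-- The blanks of the elements of `droop(π)` are glued from arbitrary elements of the components, and
the order is that of the product. -/
lemma exists_droop_components (h2143 : Avoids2143 (extPerm π)) :
    ∃ f : Droop π → ∀ b, Slide (σ b), Function.Bijective f ∧
      (∀ D, D.1.blanks = glueBlanks K (f D)) ∧
      ∀ D D', D ≤ D' ↔ ∀ b,
        ReflTransGen (fun s t : Slide (σ b) => PD.KindStep (κ b) s.1 t.1) (f D b) (f D' b) := by
  have hW := Slide.crosses_subset_blockWindow hK hσ
  have hav := fun b => (hσ b).avoids1432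
  have hmove : (DroopStep : Set (ℕ × ℕ) → Set (ℕ × ℕ) → Prop) = Move droopSquares := by
    funext X Y
    exact propext droopStep_iff
  choose s₀ hs₀ hmin using fun b => Slide.exists_least (hav b) (κ b)
  obtain ⟨R, hR, hRle⟩ := Droop.exists_bot π
  have hbase : R.1.blanks = glueBlanks K s₀ := by
    rw [hR]
    exact (glue_mirrorChart_eq_diagram h (IsBlockPerm.mem_diagram_iff hK hσ)
      (fun b => hW b (s₀ b)) hs₀).symm
  have hreach : ∀ (s : ∀ b, Slide (σ b)) Y, ReflTransGen DroopStep (glueBlanks K s) Y ↔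
      ∃ t, Y = glueBlanks K t ∧ ∀ b,
        ReflTransGen (fun s t : Slide (σ b) => PD.KindStep (κ b) s.1 t.1) (s b) (t b) := by
    intro s Y
    rw [hmove]
    exact h.isGluing_droop.reflTransGen_iff hW hav
  have hinj : ∀ s t : ∀ b, Slide (σ b), glueBlanks K s = glueBlanks K t → s = t :=
    fun s t hst => h.isGluing_droop.glueSlides_injective hW hst
  have hex : ∀ D : Droop π, ∃ s : ∀ b, Slide (σ b), D.1.blanks = glueBlanks K s := by
    intro D
    have := Droop.reflTransGen_of_le (hRle D)
    rw [hbase, hreach] at this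
    obtain ⟨t, ht, -⟩ := this
    exact ⟨t, ht⟩
  choose f hf using hex
  refine ⟨f, ⟨?_, ?_⟩, hf, ?_⟩
  · intro D D' hDD
    apply Droop.eq_of_blanks
    rw [hf, hf, hDD]
  · intro s
    have : ReflTransGen DroopStep R.1.blanks (glueBlanks K s) := by
      rw [hbase, hreach]
      exact ⟨s, rfl, fun b => hmin b (s b)⟩
    obtain ⟨D, -, hD⟩ := R.exists_of_reflTransGen h2143 this
    exact ⟨D, hinj _ _ ((hf D).symm.trans hD)⟩
  · intro D D'
    rw [Droop.le_iff h2143, hf, hf, hreach]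
    constructor
    · rintro ⟨t, ht, htb⟩
      rwa [hinj _ _ ht]
    · exact fun hb => ⟨_, rfl, hb⟩

include h hK hσ in
/-- The crosses of the reduced pipe dreams of `π` are glued from arbitrary elements of the
components, and these pipe dreams come from plane partitions. -/
lemma exists_tsscpp_components (h1432 : Avoids1432 (extPerm π)) :
    ∃ g : (∀ b, Slide (σ b)) → TSSCPPRed π, Function.Bijective g ∧
      ∀ s, ((g s).1.toPD.crosses : Set (ℕ × ℕ)) = glueCrosses K s := by
  have hW := Slide.crosses_subset_blockWindow hK hσ
  have hav := fun b => (hσ b).avoids1432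
  have hglue : IsGluing slideSquares (fun _ => kindSquares Kind.invGrass) _ _ _ :=
    h.isGluing_slide
  choose s₀ hs₀ hmin using fun b => Slide.exists_least (hav b) Kind.invGrass
  obtain ⟨B, hB, hBle⟩ := Slide.exists_least h1432 Kind.invGrass
  have hbase : (B.1.crosses : Set (ℕ × ℕ)) = glueCrosses K s₀ := by
    rw [hB, glueCrosses, glueSlides]
    simp only [hs₀]
    exact (glue_add_eq_bottomCells h (IsBlockPerm.mem_diagram_iff hK hσ)).symm
  have hinj : ∀ s t : ∀ b, Slide (σ b), glueCrosses K s = glueCrosses K t → s = t :=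
    fun s t hst => hglue.glueSlides_injective hW hst
  have hex : ∀ s : ∀ b, Slide (σ b), ∃ T : TSSCPPRed π,
      (T.1.toPD.crosses : Set (ℕ × ℕ)) = glueCrosses K s := by
    intro s
    have hs : ReflTransGen (Move slideSquares) (B.1.crosses : Set (ℕ × ℕ)) (glueCrosses K s) := by
      rw [hbase]
      exact (hglue.reflTransGen_iff hW hav).2 ⟨s, rfl, fun b => hmin b (s b)⟩
    obtain ⟨t, ht⟩ : ∃ t : Slide π, (t.1.crosses : Set (ℕ × ℕ)) = glueCrosses K s := by
      generalize glueCrosses K s = Y at hs ⊢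
      induction hs with
      | refl => exact ⟨B, rfl⟩
      | tail _ hm ih =>
        obtain ⟨t, rfl⟩ := ih
        obtain ⟨t', ht', -⟩ := Slide.exists_kindStep_of_move (k := Kind.invGrass) h1432 hm
        exact ⟨t', ht'⟩
    obtain ⟨T, hT⟩ := TSSCPP.exists_toPD_crosses_eq (t.isReducedOf.nonIntersecting h1432)
    have hTt : T.toPD = t.1 := PD.ext_crosses hT
    refine ⟨⟨T, ?_⟩, by rw [hTt, ht]⟩
    rw [hTt]
    exact PD.isReducedOf_iff.1 t.isReducedOf
  choose g hg using hex
  refine ⟨g, ⟨?_, ?_⟩, hg⟩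
  · intro s t hst
    apply hinj
    rw [← hg, ← hg, hst]
  · intro T
    have hred : T.1.toPD.IsReducedOf (extPerm π) := PD.isReducedOf_iff.2 T.2
    let t : Slide π := ⟨T.1.toPD, hred.exists_isBottom h1432⟩
    have ht : ReflTransGen (Move slideSquares) (B.1.crosses : Set (ℕ × ℕ)) t.1.crosses :=
      (hBle t).lift (fun t : Slide π => (t.1.crosses : Set (ℕ × ℕ))) fun _ _ hs =>
        PD.KindStep.move (k := Kind.invGrass) hs
    rw [hbase] at ht
    obtain ⟨s, hs, -⟩ := (hglue.reflTransGen_iff hW hav).1 ht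
    refine ⟨s, Subtype.ext (TSSCPP.toPD_injective (Finset.coe_injective ?_))⟩
    rw [hg]
    exact hs.symm

lemma Block.mirror_eq {b : Block π} {k : Kind} {D : BPD n} {S : Set (ℕ × ℕ)}
    (hb : b.corner k = K b) (hS : S ⊆ blockWindow (K b) b.last)
    (hmem : ∀ x ∈ blockWindow (K b) b.last, mirrorChart k (K b) b.last x ∈ D.blanks ↔ x ∈ S) :
    b.mirror k D = S := by
  have hreg : b.region k = Set.Icc (K b) b.last := by rw [Block.region, hb]; rfl
  cases k with
  | grass =>
    ext x
    simp only [Block.mirror, hreg, hb]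
    constructor
    · rintro ⟨c, ⟨hc, hI⟩, rfl⟩
      simp only [Set.mem_Icc, Prod.le_def, Block.last] at hI
      refine (hmem _ (mem_blockWindow.2 ?_)).1 ?_
      · simp only [Block.last]; omega
      · convert hc using 1
        ext <;> simp only [mirrorChart, Block.last] <;> omega
    · intro hx
      have hx' := hS hx
      refine ⟨mirrorChart .grass (K b) b.last x, ⟨(hmem x hx').2 hx, mirrorChart_mem_Icc hx'⟩, ?_⟩
      simp only [mem_blockWindow, Block.last] at hx'
      ext <;> simp only [mirrorChart, Block.last] <;> omega
  | invGrass =>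
    ext x
    simp only [Block.mirror, hreg, hb]
    constructor
    · rintro ⟨c, ⟨hc, hI⟩, rfl⟩
      simp only [Set.mem_Icc, Prod.le_def, Block.last] at hI
      refine (hmem _ (mem_blockWindow.2 ?_)).1 ?_
      · simp only [Block.last]; omega
      · convert hc using 1
        ext <;> simp only [mirrorChart, Block.last] <;> omega
    · intro hx
      have hx' := hS hx
      refine ⟨mirrorChart .invGrass (K b) b.last x,
        ⟨(hmem x hx').2 hx, mirrorChart_mem_Icc hx'⟩, ?_⟩
      simp only [mem_blockWindow, Block.last] at hx'
      ext <;> simp only [mirrorChart, Block.last] <;> omega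

include h hK hσ in
lemma mirror_eq_crosses {D : BPD n} {s : ∀ b, Slide (σ b)} (hD : D.blanks = glueBlanks K s)
    (b : Block π) : b.mirror (κ b) D = ((s b).1.crosses : Set (ℕ × ℕ)) := by
  have hW := Slide.crosses_subset_blockWindow hK hσ
  refine Block.mirror_eq (hK b (κ b)) (hW b (s b)) fun x hx => ?_
  rw [hD]
  exact h.isGluing_droop.mem_glue_iff (fun b => hW b (s b)) hx

end components

/-- The product of the components of all blocks, sorted by the kinds of the blocks. -/
lemma exists_orderIso_prod {n : ℕ} {π : Equiv.Perm (Fin n)} {κ : Block π → Kind}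
    {σ : ∀ b : Block π, Equiv.Perm (Fin (b.size (κ b)))} {f : Droop π → ∀ b, Slide (σ b)}
    (hf : Function.Bijective f)
    (hle : ∀ D D', D ≤ D' ↔ ∀ b,
      ReflTransGen (fun s t : Slide (σ b) => PD.KindStep (κ b) s.1 t.1) (f D b) (f D' b)) :
    ∃ Φ : Droop π ≃o ((∀ b : {b : Block π // κ b = Kind.invGrass}, Slide (σ b.1)) ×
        (∀ b : {b : Block π // κ b = Kind.grass}, (Slide (σ b.1))ᵒᵈ)),
      ∀ D, (∀ b, (Φ D).1 b = f D b.1) ∧ ∀ b, OrderDual.ofDual ((Φ D).2 b) = f D b.1 := by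
  let F : Droop π → ((∀ b : {b : Block π // κ b = Kind.invGrass}, Slide (σ b.1)) ×
      (∀ b : {b : Block π // κ b = Kind.grass}, (Slide (σ b.1))ᵒᵈ)) :=
    fun D => (fun b => f D b.1, fun b => OrderDual.toDual (f D b.1))
  have hF : ∀ D D', F D ≤ F D' ↔ D ≤ D' := by
    intro D D'
    rw [hle]
    constructor
    · rintro ⟨h1, h2⟩ b
      rcases Kind.eq_or_eq (κ b) with hb | hb
      · exact (Slide.reflTransGen_invGrass hb).2 (h1 ⟨b, hb⟩)
      · exact (Slide.reflTransGen_grass hb).2 (h2 ⟨b, hb⟩)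
    · exact fun h => ⟨fun b => (Slide.reflTransGen_invGrass b.2).1 (h b.1),
        fun b => (Slide.reflTransGen_grass b.2).1 (h b.1)⟩
  have hsurj : Function.Surjective F := by
    rintro ⟨u, v⟩
    have hex : ∀ b, ∃ t : Slide (σ b), (∀ hb : κ b = Kind.invGrass, t = u ⟨b, hb⟩) ∧
        ∀ hb : κ b = Kind.grass, t = OrderDual.ofDual (v ⟨b, hb⟩) := by
      intro b
      rcases Kind.eq_or_eq (κ b) with hb | hb
      · exact ⟨u ⟨b, hb⟩, fun _ => rfl, fun h => absurd (hb.symm.trans h) (by simp)⟩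
      · exact ⟨OrderDual.ofDual (v ⟨b, hb⟩), fun h => absurd (hb.symm.trans h) (by simp), fun _ => rfl⟩
    choose s hs1 hs2 using hex
    obtain ⟨D, rfl⟩ := hf.2 s
    refine ⟨D, Prod.ext ?_ ?_⟩
    · funext b
      exact hs1 b.1 b.2
    · funext b
      exact congrArg OrderDual.toDual (hs2 b.1 b.2)
  exact ⟨RelIso.ofSurjective (OrderEmbedding.ofMapLEIff F hF) hsurj,
    fun D => ⟨fun b => rfl, fun b => rfl⟩⟩

end PipeDreams

theorem mainTheorem4 {n : ℕ} (π : Equiv.Perm (Fin n))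
    (h2143 : Avoids π ![2, 1, 4, 3]) (h1432 : Avoids π ![1, 4, 3, 2]) :
    (∃ κ : Block π → Kind, IsKindAssignment κ) ∧
    ∀ κ : Block π → Kind, IsKindAssignment κ →
      ∃ σ : ∀ b : Block π, Equiv.Perm (Fin (b.size (κ b))),
        IsBlockDecomposition κ σ ∧
        ∃ (β : ASMOf π ≃ Droop π)
          (Φ : Droop π ≃o
            ((∀ b : {b : Block π // κ b = Kind.invGrass}, Slide (σ b.1)) ×
              (∀ b : {b : Block π // κ b = Kind.grass}, (Slide (σ b.1))ᵒᵈ)))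
          (ψ : ASMOf π ≃ TSSCPPRed π),
          (∀ A : ASMOf π, (β A).1.toMatrix = A.1) ∧
          (∀ (D : Droop π) (b : {b : Block π // κ b = Kind.invGrass}),
            (((Φ D).1 b).1.crosses : Set (ℕ × ℕ)) = b.1.mirror Kind.invGrass D.1) ∧
          (∀ (D : Droop π) (b : {b : Block π // κ b = Kind.grass}),
            ((OrderDual.ofDual ((Φ D).2 b)).1.crosses : Set (ℕ × ℕ)) =
              b.1.mirror Kind.grass D.1) ∧
          ∀ A : ASMOf π,
            ((ψ A).1.toPD.crosses : Set (ℕ × ℕ)) =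
              dominant π ∪
                ⋃ b : Block π, (fun c => b.corner (κ b) + c) '' b.mirror (κ b) (β A).1 := by
  have h2143' := h2143.ext2143
  have h1432' := h1432.ext1432
  refine ⟨exists_isKindAssignment h2143' h1432', fun κ hκ => ?_⟩
  obtain ⟨K, h, hK⟩ := exists_isBlockSystem h2143' h1432' hκ
  choose σ hσ using exists_isBlockPerm h hK
  obtain ⟨β, hβ⟩ := exists_asm_equiv_droop h2143'
  obtain ⟨f, hf, hfb, hfle⟩ := exists_droop_components h hK hσ h2143'
  obtain ⟨Φ, hΦ⟩ := exists_orderIso_prod hf hfle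
  obtain ⟨g, hg, hgc⟩ := exists_tsscpp_components h hK hσ h1432'
  have hmirror : ∀ (D : Droop π) (b : Block π),
      b.mirror (κ b) D.1 = ((f D b).1.crosses : Set (ℕ × ℕ)) :=
    fun D b => mirror_eq_crosses h hK hσ (hfb D) b
  refine ⟨σ, isBlockDecomposition h hK hκ hσ, β, Φ,
    Equiv.ofBijective (fun A => g (f (β A))) (hg.comp (hf.comp β.bijective)), hβ, ?_, ?_, ?_⟩
  · intro D b
    rw [(hΦ D).1, ← hmirror, b.2]
  · intro D b
    rw [(hΦ D).2, ← hmirror, b.2]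
  · intro A
    refine (hgc (f (β A))).trans ?_
    rw [dominant_eq]
    simp only [hK, hmirror]
    rfl
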